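/- **Setting.** Let $a<b$, $K\ge 0$, delays $0<\tau_1<\dots<\tau_K$, and $n_{\rm p}=(n_1,n_2,n_3)$, $\|n_{\rm p}\|=n_1+n_2+n_3$. For $u=(u_1,u_2,u_3)\in U:=L_2^{n_1}\times H_1^{n_2}\times H_2^{n_3}$ on $[a,b]$ put $D_{\rm int}u=(u_1,u_2,u_3,\partial u_2,\partial u_3,\partial^2u_3)$, $D_{\rm bc}u=(u_2,u_3,\partial u_3)$, $\Lambda u=((D_{\rm bc}u)(a),(D_{\rm bc}u)(b))$ and $\mathscr D u=(u_1,\partial u_2,\partial^2 u_3)$. Consider the linear ODE with delays coupled to the linear 1D PDE with delays $$\dot u=Au+B_ww+\sum_jA_ju(t-\tau_j),\qquad z=C_zu+\sum_jC_{z,j}u(t-\tau_j),$$ $$\begin{pmatrix}\partial_tu_{\rm p}\\ w\end{pmatrix}=\mathcal G\begin{pmatrix}D_{\rm int}u_{\rm p}\\ \Lambda u_{\rm p}\\ z\end{pmatrix}(t)+\sum_j\mathcal G_j\begin{pmatrix}D_{\rm int}u_{\rm p}\\ \Lambda u_{\rm p}\\ z\end{pmatrix}(t-\tau_j),\qquad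 \mathcal E(D_{\rm int}u_{\rm p},\Lambda u_{\rm p},z)=0,$$ where $u(t)\in\mathbb R^{n_u}$, $z(t)\in\mathbb R^{n_z}$, $w(t)\in\mathbb R^{n_w}$; $\mathcal G$ (and likewise each $\mathcal G_j$) has the form $\mathcal G(d,\beta,z)=(A_{\rm p}d+A_{\rm b}\beta+B_zz,\ \int_a^bC_{w\rm p}d+C_{w\rm b}\beta+D_{wz}z)$ with $A_{\rm p}\in L_\infty$, $A_{\rm b},B_z,C_{w\rm p}\in L_2$ and constant matrices $C_{w\rm b},D_{wz}$; and $\mathcal E(d,\beta,z)=\int_a^bE_{\rm p}d+E_{\rm b}\beta+E_zz\in\mathbb R^{n_2+2n_3}$ with $E_{\rm p}\in L_2$ and constant matrices $E_{\rm b},E_z$. Assume the boundary conditions are well-posed: the square matrix expressing $\mathcal E$, for $z=0$ and functions $u$ with $\mathscr Du=0$, in terms of $c=(D_{\rm bc}u)(a)\in\mathbb R^{n_2+2n_3}$ is invertible. Then for all $v\in L_2^{\|n_{\rm p}\|}[a,b]$ and $z\in\mathbb R^{n_z}$ let $\mathcal T_0v+\mathcal T_zz$ denote the unique $u\in U$ with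 $\mathscr Du=v$ and $\mathcal E(D_{\rm int}u,\Lambda u,z)=0$, and put $\mathcal F(v,z)=(D_{\rm int}u,\Lambda u,z)$ for this $u$. **Solutions of the delayed system.** The delays are expanded as transport equations on $s\in[0,1]$: with $\phi_j(t,s)=u(t-\tau_js)$ and $\phi_{{\rm p},j}=(\phi_{u,j},\phi_{z,j})$, $\phi_{{\rm p},j}(t,s)=(u_{\rm p}(t-\tau_js),z(t-\tau_js))$, a solution is a function $(u,\phi,u_{\rm p},\phi_{\rm p})$ of $t\ge0$ with values in $\mathbb R^{n_u}\times H_1([0,1];\mathbb R^{n_u})^K\times U\times H_1([0,1];U\times\mathbb R^{n_z})^K$, Fréchet differentiable with respect to the norm of this space, that takes the given initial value at $t=0$ and for which there are signals $z,w$ such that for all $t\ge0$: the equations above hold with the delayed values replaced by $\phi_j(t,1)$ and $\phi_{{\rm p},j}(t,1)$; $\partial_t\phi_j=-\tau_j^{-1}\partial_s\phi_j$ and $\partial_t\phi_{{\rm p},j}=-\tau_j^{-1}\partial_s\phi_{{\rm p},j}$; $\phi_j(t,0)=u(t)$ and $\phi_{{\rm p},j}(t,0)=(u_{\rm p}(t),z(t))$;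 $u_{\rm p}(t)$ satisfies the boundary conditions with input $z(t)$, and $\phi_{u,j}(t,s)$ satisfies them with input $\phi_{z,j}(t,s)$ for all $s\in[0,1]$. **PIEs.** Let $Z=\mathbb R^{n_u}\times L_2^{Kn_u}[0,1]\times L_2^{\|n_{\rm p}\|}[a,b]\times\big(L_2^{\|n_{\rm p}\|}([0,1]\times[a,b])\times L_2^{n_z}[0,1]\big)^K$. A solution of the PIE defined by $\{\mathcal T,\mathcal A\}$ with initial condition $\mathbf v_0\in Z$ is a Fréchet differentiable function $\mathbf v:[0,\infty)\to Z$ with $\mathbf v(0)=\mathbf v_0$ and $\mathcal T\mathbf v_t(t)=\mathcal A\mathbf v(t)$ for all $t\ge 0$. PIEs with inputs and outputs have the form $\mathcal T_ww_t+\mathcal T_rr_t+\mathcal Tv_t=\mathcal Av+\mathcal B_ww+\mathcal B_rr$, $z=\mathcal C_zv+\mathcal D_{zw}w+\mathcal D_{zr}r$, $q=\mathcal C_qv+\mathcal D_{qw}w$. The interconnection of such a PIE (subscript 1) with a second PIE $\{\mathcal T_2,\mathcal T_{2q},\mathcal A_2,\mathcal B_{2q},\mathcal C_{r2},\mathcal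 D_{rq}\}$ with input $q$ and output $r$ has $$\mathcal T=\begin{bmatrix}\mathcal T_1+\mathcal T_{1r}\mathcal D_{rq}\mathcal C_{q1}&\mathcal T_{1r}\mathcal C_{r2}\\ \mathcal T_{2q}\mathcal C_{q1}&\mathcal T_2\end{bmatrix},\qquad\mathcal A=\begin{bmatrix}\mathcal A_1+\mathcal B_{1r}\mathcal D_{rq}\mathcal C_{q1}&\mathcal B_{1r}\mathcal C_{r2}\\ \mathcal B_{2q}\mathcal C_{q1}&\mathcal A_2\end{bmatrix},$$ and, for the external signals, $\mathcal T_w=\begin{bmatrix}\mathcal T_{1w}+\mathcal T_{1r}\mathcal D_{rq}\mathcal D_{qw}\\ \mathcal T_{2q}\mathcal D_{qw}\end{bmatrix}$, $\mathcal B_w=\begin{bmatrix}\mathcal B_{1w}+\mathcal B_{1r}\mathcal D_{rq}\mathcal D_{qw}\\ \mathcal B_{2q}\mathcal D_{qw}\end{bmatrix}$, $\mathcal C_z=[\mathcal C_{z1}+\mathcal D_{zr}\mathcal D_{rq}\mathcal C_{q1}\ \ \mathcal D_{zr}\mathcal C_{r2}]$, and $\mathcal D_{zw}+\mathcal D_{zr}\mathcal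 D_{rq}\mathcal D_{qw}$ as the new feedthrough operator. * The *DDE PIE* has state $(u,\psi)$, input $w$, output $z$: with $e_j=u+\int_0^1\psi_j$, $\mathcal T(u,\psi)=(u,(u+\int_0^s\psi_j)_j)$, $\mathcal A(u,\psi)=(Au+\sum_jA_je_j,(-\tau_j^{-1}\psi_j)_j)$, $\mathcal B=(B_w,0)$, $\mathcal C(u,\psi)=C_zu+\sum_jC_{z,j}e_j$, $\mathcal T_w=0$, $\mathcal D=0$. * The *DPDE PIE*, with state $(v,\psi_{\rm p})$, input $z$ and output $w$, is the interconnection of (i) the PIE with state $v$, external input $z$, external output $w$, interconnection input $r=(r_j)_j$ and output $q$, given by $\mathcal T_0v_t+\mathcal T_zz_t=(\mathcal G\mathcal F(v,z)+\sum_j\mathcal G_jr_j)_1$, $w=(\mathcal G\mathcal F(v,z)+\sum_j\mathcal G_jr_j)_2$, $q=\mathcal F(v,z)$, and (ii) the PIE with state $\psi_{\rm p}=(\psi_{u,j},\psi_{z,j})_j$, input $q$ and output $r$, given by $T_qq_t+\int_0^s\mathcal S\partial_t\psi_{{\rm p},j}=-\tau_j^{-1}\mathcal S\psi_{{\rm p},j}$,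 $r_j=q+\int_0^1\mathcal F\psi_{{\rm p},j}\,ds$, for $j=1,\dots,K$, where $\mathcal S(v,z)=(\mathcal T_0v+\mathcal T_zz,z)$ and $T_q(D_{\rm int}u,\Lambda u,z)=(u,z)$. **Statement.** Let $\{\mathcal T,\mathcal A\}$ define the interconnection of the DDE PIE and the DPDE PIE, in which the output $z$ of the first is the input of the second and the output $w$ of the second is the input of the first. Then: 1. $\mathcal T$ and $\mathcal A$ are partial integral (PI) operators on $Z$. That is, up to sorting the components of $Z$ as $Z_1\times Z_2$ with $Z_1=\mathbb R^{n_u}\times L_2^{\|n_{\rm p}\|}[a,b]$ and $Z_2=L_2^{Kn_u+Kn_z}[0,1]\times L_2^{K\|n_{\rm p}\|}([0,1]\times[a,b])$, each is of the form $$(\mathbf u_1,\mathbf u_2)\mapsto\Big(\mathcal B_{11}\mathbf u_1+\int_0^1\mathcal B_{12}\mathbf u_2(\sigma)d\sigma,\ \mathcal B_{21}\mathbf u_1+\mathcal N_0\mathbf u_2(s)+\int_0^s\mathcal N_1\mathbf u_2(\sigma)d\sigma+\int_s^1\mathcal N_2\mathbf u_2(\sigma)d\sigma\Big)$$ with 4-PI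 operators $\mathcal B_{11},\mathcal B_{12},\mathcal B_{21},\mathcal N_0,\mathcal N_1,\mathcal N_2$ in the variable $x\in[a,b]$, i.e. operators $(y_0,y_1)\mapsto\big(B_{00}y_0+\int_a^bB_{01}y_1,\ B_{10}(x)y_0+N_0(x)y_1(x)+\int_a^xN_1(x,\theta)y_1(\theta)d\theta+\int_x^bN_2(x,\theta)y_1(\theta)d\theta\big)$ with a constant matrix $B_{00}$ and matrix-valued $B_{01},B_{10},N_1,N_2\in L_2$, $N_0\in L_\infty$. 2. For every $\mathbf v_0\in Z$ and every $\mathbf v:[0,\infty)\to Z$, $\mathbf v$ is a solution of the PIE $\mathcal T\mathbf v_t=\mathcal A\mathbf v$ with initial condition $\mathbf v_0$ if and only if $\mathcal T\mathbf v$ is a solution of the delayed ODE-PDE system with initial condition $\mathcal T\mathbf v_0$. -/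

import Mathlib

open MeasureTheory Set
open scoped ENNReal

namespace DelayPIE

noncomputable section

/-! ### Function spaces on intervals -/

/-- `ℝⁿ`. -/
abbrev Vec (n : ℕ) : Type := EuclideanSpace ℝ (Fin n)

/-- Lebesgue measure on `[c, d]`. -/
abbrev ivl (c d : ℝ) : Measure ℝ := volume.restrict (Icc c d)

/-- `L₂([c, d]; E)`. For `E = L₂([a, b]; F)` this is the space `L₂([c, d] × [a, b]; F)` of functions
of two variables, read as functions of the first variable with values in functions of the
second one. -/
abbrev L2 (c d : ℝ) (E : Type) [NormedAddCommGroup E] : Type := Lp E 2 (ivl c d)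

section Instances

/-! Instances that Lean finds by itself, recorded to shorten the search. -/

variable (c d : ℝ) (E : Type) [NormedAddCommGroup E] [NormedSpace ℝ E] (n : ℕ)

instance : NormedAddCommGroup (Vec n) := inferInstance
instance : AddCommGroup (Vec n) := inferInstance
instance : AddCommMonoid (Vec n) := inferInstance
instance : TopologicalSpace (Vec n) := inferInstance
instance : NormedSpace ℝ (Vec n) := inferInstance
instance : Module ℝ (Vec n) := inferInstance
instance : NormedAddCommGroup (L2 c d E) := inferInstance
instance : AddCommGroup (L2 c d E) := inferInstance
instance : AddCommMonoid (L2 c d E) := inferInstance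
instance : TopologicalSpace (L2 c d E) := inferInstance
instance : NormedSpace ℝ (L2 c d E) := inferInstance
instance : Module ℝ (L2 c d E) := inferInstance

end Instances

section Calculus

variable {c d : ℝ} {E F : Type} [NormedAddCommGroup E] [NormedSpace ℝ E]
  [NormedAddCommGroup F] [NormedSpace ℝ F]

/-- `g` is the weak derivative of `f` on `(c, d)`. -/
def HasWeakDeriv (c d : ℝ) (f g : L2 c d E) : Prop :=
  ∀ η : ℝ → ℝ, ContDiff ℝ (⊤ : ℕ∞) η → HasCompactSupport η → tsupport η ⊆ Ioo c d →
    ∫ x, deriv η x • f x ∂(ivl c d) = - ∫ x, η x • g x ∂(ivl c d)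

theorem integrable_smul_L2 {η : ℝ → ℝ} (hη : Continuous η) (hc : HasCompactSupport η)
    (f : L2 c d E) : Integrable (fun x => η x • f x) (ivl c d) := by
  have hf : Integrable (fun x => f x) (ivl c d) :=
    (Lp.memLp f).integrable (by norm_num)
  obtain ⟨C, hC⟩ := hη.bounded_above_of_compact_support hc
  exact hf.bdd_smul C hη.aestronglyMeasurable (Filter.Eventually.of_forall hC)

theorem HasWeakDeriv.zero : HasWeakDeriv c d (0 : L2 c d E) 0 := by
  intro η _ _ _
  have h0 := Lp.coeFn_zero E 2 (ivl c d)
  have h1 : ∫ x, deriv η x • (0 : L2 c d E) x ∂(ivl c d) = 0 := by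
    refine integral_eq_zero_of_ae ?_
    filter_upwards [h0] with x hx
    rw [hx]
    exact smul_zero _
  have h2 : ∫ x, η x • (0 : L2 c d E) x ∂(ivl c d) = 0 := by
    refine integral_eq_zero_of_ae ?_
    filter_upwards [h0] with x hx
    rw [hx]
    exact smul_zero _
  rw [h1, h2, neg_zero]

theorem HasWeakDeriv.add {f₁ g₁ f₂ g₂ : L2 c d E} (h₁ : HasWeakDeriv c d f₁ g₁)
    (h₂ : HasWeakDeriv c d f₂ g₂) : HasWeakDeriv c d (f₁ + f₂) (g₁ + g₂) := by
  intro η hη hc hs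
  have key : ∀ (ρ : ℝ → ℝ), Continuous ρ → HasCompactSupport ρ → ∀ u v : L2 c d E,
      ∫ x, ρ x • (u + v) x ∂(ivl c d)
        = ∫ x, ρ x • u x ∂(ivl c d) + ∫ x, ρ x • v x ∂(ivl c d) := by
    intro ρ h1 h2 u v
    rw [← integral_add (integrable_smul_L2 h1 h2 u) (integrable_smul_L2 h1 h2 v)]
    refine integral_congr_ae ?_
    filter_upwards [Lp.coeFn_add u v] with x hx
    rw [hx]
    exact smul_add _ _ _
  rw [key _ (hη.continuous_deriv (by simp)) hc.deriv, key _ hη.continuous hc,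
    h₁ η hη hc hs, h₂ η hη hc hs, neg_add]

theorem HasWeakDeriv.smul {f g : L2 c d E} (r : ℝ) (h : HasWeakDeriv c d f g) :
    HasWeakDeriv c d (r • f) (r • g) := by
  intro η hη hc hs
  have key : ∀ (ρ : ℝ → ℝ) (u : L2 c d E),
      ∫ x, ρ x • (r • u) x ∂(ivl c d) = r • ∫ x, ρ x • u x ∂(ivl c d) := by
    intro ρ u
    rw [← integral_smul]
    refine integral_congr_ae ?_
    filter_upwards [Lp.coeFn_smul r u] with x hx
    rw [hx]
    exact smul_comm _ _ _
  rw [key, key, h η hη hc hs, smul_neg]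

/-- Pairs `(f, f')` of a function in `L₂` and its weak derivative in `L₂`. -/
def H1Graph (c d : ℝ) (E : Type) [NormedAddCommGroup E] [NormedSpace ℝ E] :
    Submodule ℝ (L2 c d E × L2 c d E) where
  carrier := {p | HasWeakDeriv c d p.1 p.2}
  zero_mem' := HasWeakDeriv.zero
  add_mem' h₁ h₂ := h₁.add h₂
  smul_mem' r _ h := h.smul r

/-- Triples `(f, f', f'')` of a function in `L₂` and its weak derivatives in `L₂`. -/
def H2Graph (c d : ℝ) (E : Type) [NormedAddCommGroup E] [NormedSpace ℝ E] :
    Submodule ℝ (L2 c d E × L2 c d E × L2 c d E) where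
  carrier := {p | HasWeakDeriv c d p.1 p.2.1 ∧ HasWeakDeriv c d p.2.1 p.2.2}
  zero_mem' := ⟨HasWeakDeriv.zero, HasWeakDeriv.zero⟩
  add_mem' h₁ h₂ := ⟨h₁.1.add h₂.1, h₁.2.add h₂.2⟩
  smul_mem' r _ h := ⟨h.1.smul r, h.2.smul r⟩

/-- The Sobolev space `H₁([c, d]; E)`, with the norm `max (‖f‖, ‖f'‖)` of `L₂` norms. -/
def H1 (c d : ℝ) (E : Type) [NormedAddCommGroup E] [NormedSpace ℝ E] : Type := H1Graph c d E

/-- The Sobolev space `H₂([c, d]; E)`, with the norm `max (‖f‖, ‖f'‖, ‖f''‖)` of `L₂` norms. -/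
def H2 (c d : ℝ) (E : Type) [NormedAddCommGroup E] [NormedSpace ℝ E] : Type := H2Graph c d E

instance : NormedAddCommGroup (H1 c d E) := inferInstanceAs (NormedAddCommGroup (H1Graph c d E))

instance : NormedSpace ℝ (H1 c d E) := inferInstanceAs (NormedSpace ℝ (H1Graph c d E))

instance : NormedAddCommGroup (H2 c d E) := inferInstanceAs (NormedAddCommGroup (H2Graph c d E))

instance : NormedSpace ℝ (H2 c d E) := inferInstanceAs (NormedSpace ℝ (H2Graph c d E))

/-- The function underlying an element of `H₁`. -/
def H1.fn : H1 c d E →L[ℝ] L2 c d E := (ContinuousLinearMap.fst ℝ _ _) ∘L (H1Graph c d E).subtypeL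

/-- The derivative of an element of `H₁`. -/
def H1.der : H1 c d E →L[ℝ] L2 c d E := (ContinuousLinearMap.snd ℝ _ _) ∘L (H1Graph c d E).subtypeL

/-- The function underlying an element of `H₂`. -/
def H2.fn : H2 c d E →L[ℝ] L2 c d E := (ContinuousLinearMap.fst ℝ _ _) ∘L (H2Graph c d E).subtypeL

/-- The first derivative of an element of `H₂`. -/
def H2.der : H2 c d E →L[ℝ] L2 c d E :=
  (ContinuousLinearMap.fst ℝ _ _) ∘L (ContinuousLinearMap.snd ℝ _ _) ∘L (H2Graph c d E).subtypeL

/-- The second derivative of an element of `H₂`. -/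
def H2.der2 : H2 c d E →L[ℝ] L2 c d E :=
  (ContinuousLinearMap.snd ℝ _ _) ∘L (ContinuousLinearMap.snd ℝ _ _) ∘L (H2Graph c d E).subtypeL

open Classical in
/-- The value at `x` of the representative of `f` that is continuous on `[c, d]` (the zero function
if there is none). -/
def valueAt (f : L2 c d E) (x : ℝ) : E :=
  if h : ∃ f₀ : ℝ → E, ContinuousOn f₀ (Icc c d) ∧ f =ᵐ[ivl c d] f₀ then h.choose x else 0

/-- A constant function. -/
def constFn (c d : ℝ) : E →L[ℝ] L2 c d E := Lp.constL 2 (ivl c d) ℝ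

theorem integrable_L2 {E : Type} [NormedAddCommGroup E] (f : L2 c d E) : Integrable (fun x => f x) (ivl c d) :=
  (Lp.memLp f).integrable (by norm_num)

theorem exists_integral_norm_le (c d : ℝ) (E : Type) [NormedAddCommGroup E] :
    ∃ C : ℝ, 0 ≤ C ∧ ∀ f : L2 c d E, ∫ x, ‖f x‖ ∂(ivl c d) ≤ C * ‖f‖ := by
  refine ⟨((ivl c d) univ ^ (1 / (1 : ℝ≥0∞).toReal - 1 / (2 : ℝ≥0∞).toReal)).toReal,
    ENNReal.toReal_nonneg, fun f => ?_⟩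
  have h := eLpNorm_le_eLpNorm_mul_rpow_measure_univ (μ := ivl c d) (p := 1) (q := 2) (f := f)
    (by norm_num) (Lp.aestronglyMeasurable f)
  have hfin : eLpNorm f 2 (ivl c d)
      * (ivl c d) univ ^ (1 / (1 : ℝ≥0∞).toReal - 1 / (2 : ℝ≥0∞).toReal) ≠ ∞ := by
    refine ENNReal.mul_ne_top (Lp.memLp f).eLpNorm_ne_top ?_
    exact ENNReal.rpow_ne_top_of_nonneg (by norm_num) (measure_ne_top _ _)
  rw [integral_norm_eq_lintegral_enorm (Lp.aestronglyMeasurable f), ← eLpNorm_one_eq_lintegral_enorm]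
  refine (ENNReal.toReal_mono hfin h).trans ?_
  rw [ENNReal.toReal_mul, mul_comm, Lp.norm_def]

/-- `f ↦ ∫_c^d f`. -/
def integralL (c d : ℝ) (E : Type) [NormedAddCommGroup E] [NormedSpace ℝ E] :
    L2 c d E →L[ℝ] E :=
  LinearMap.mkContinuousOfExistsBound
    { toFun := fun f => ∫ x, f x ∂(ivl c d)
      map_add' := fun f g => by
        rw [← integral_add (integrable_L2 f) (integrable_L2 g)]
        exact integral_congr_ae (Lp.coeFn_add f g)
      map_smul' := fun r f => by
        rw [RingHom.id_apply, ← integral_smul]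
        exact integral_congr_ae (Lp.coeFn_smul r f) }
    (by
      obtain ⟨C, -, hC⟩ := exists_integral_norm_le c d E
      exact ⟨C, fun f => (norm_integral_le_integral_norm _).trans (hC f)⟩)

theorem norm_primitive_le (f : L2 c d E) (x : ℝ) :
    ‖∫ θ in c..x, f θ ∂(ivl c d)‖ ≤ ∫ θ, ‖f θ‖ ∂(ivl c d) := by
  refine intervalIntegral.norm_integral_le_integral_norm_uIoc.trans ?_
  exact setIntegral_le_integral (integrable_L2 f).norm
    (Filter.Eventually.of_forall fun _ => norm_nonneg _)

theorem memLp_primitive (f : L2 c d E) :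
    MemLp (fun x => ∫ θ in c..x, f θ ∂(ivl c d)) 2 (ivl c d) := by
  refine MemLp.of_bound ?_ (∫ θ, ‖f θ‖ ∂(ivl c d))
    (Filter.Eventually.of_forall fun x => norm_primitive_le f x)
  exact (intervalIntegral.continuous_primitive
    (fun _ _ => (integrable_L2 f).intervalIntegrable) c).aestronglyMeasurable

/-- The partial integral `(J f)(x) = ∫_c^x f(θ) dθ`. -/
def primitiveL (c d : ℝ) (E : Type) [NormedAddCommGroup E] [NormedSpace ℝ E] :
    L2 c d E →L[ℝ] L2 c d E :=
  LinearMap.mkContinuousOfExistsBound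
    { toFun := fun f => (memLp_primitive f).toLp _
      map_add' := fun f g => by
        rw [← MemLp.toLp_add]
        refine MemLp.toLp_congr _ _ (Filter.Eventually.of_forall fun x => ?_)
        simp only [Pi.add_apply]
        rw [← intervalIntegral.integral_add (integrable_L2 f).intervalIntegrable
          (integrable_L2 g).intervalIntegrable]
        refine intervalIntegral.integral_congr_ae ?_
        filter_upwards [Lp.coeFn_add f g] with θ hθ _
        simpa using hθ
      map_smul' := fun r f => by
        rw [RingHom.id_apply, ← MemLp.toLp_const_smul]
        refine MemLp.toLp_congr _ _ (Filter.Eventually.of_forall fun x => ?_)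
        simp only [Pi.smul_apply]
        rw [← intervalIntegral.integral_smul]
        refine intervalIntegral.integral_congr_ae ?_
        filter_upwards [Lp.coeFn_smul r f] with θ hθ _
        simpa using hθ }
    (by
      obtain ⟨C, hC0, hC⟩ := exists_integral_norm_le c d E
      refine ⟨(measureUnivNNReal (ivl c d) : ℝ) ^ (2 : ℝ≥0∞).toReal⁻¹ * C, fun f => ?_⟩
      have hb : ∀ᵐ x ∂(ivl c d), ‖(memLp_primitive f).toLp _ x‖ ≤ C * ‖f‖ := by
        filter_upwards [(memLp_primitive f).coeFn_toLp] with x hx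
        rw [hx]
        exact (norm_primitive_le f x).trans (hC f)
      have := Lp.norm_le_of_ae_bound (mul_nonneg hC0 (norm_nonneg f)) hb
      exact this.trans_eq (mul_assoc _ _ _).symm)

/-- Pointwise multiplication with a bounded matrix-valued function. -/
def mulL (A : Lp (E →L[ℝ] F) ∞ (ivl c d)) : L2 c d E →L[ℝ] L2 c d F :=
  (ContinuousLinearMap.id ℝ (E →L[ℝ] F)).holderL (ivl c d) ∞ 2 2 A

/-- `ξ ↦ A(·) ξ` for a square-integrable matrix-valued function `A`. -/
def columnL (A : L2 c d (E →L[ℝ] F)) : E →L[ℝ] L2 c d F :=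
  (((ContinuousLinearMap.id ℝ (E →L[ℝ] F)).flip).compLpL₂ 2 (ivl c d)).flip A

/-- `f ↦ ∫_c^d C(x) f(x) dx` for a square-integrable matrix-valued function `C`. -/
def rowL [CompleteSpace F] (C : L2 c d (E →L[ℝ] F)) : L2 c d E →L[ℝ] F :=
  (ContinuousLinearMap.id ℝ (E →L[ℝ] F)).lpPairing (ivl c d) 2 2 C

/-- `L₂([c, d]; E) × L₂([c, d]; F) ≃ L₂([c, d]; E × F)`. -/
def pairL (c d : ℝ) (E F : Type) [NormedAddCommGroup E] [NormedSpace ℝ E]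
    [NormedAddCommGroup F] [NormedSpace ℝ F] : L2 c d E × L2 c d F →L[ℝ] L2 c d (E × F) :=
  ((ContinuousLinearMap.inl ℝ E F).compLpL 2 (ivl c d)).coprod
    ((ContinuousLinearMap.inr ℝ E F).compLpL 2 (ivl c d))

/-- `L₂([c, d]; E)^K ≃ L₂([c, d]; E^K)`. -/
def packL (c d : ℝ) (K : ℕ) (E : Type) [NormedAddCommGroup E] [NormedSpace ℝ E] :
    (Fin K → L2 c d E) →L[ℝ] L2 c d (Fin K → E) :=
  ∑ j, ((ContinuousLinearMap.single ℝ (fun _ : Fin K => E) j).compLpL 2 (ivl c d)) ∘L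
    ContinuousLinearMap.proj j

/-- `L` applied to each of `K` components. -/
def eachL (K : ℕ) (L : E →L[ℝ] F) : (Fin K → E) →L[ℝ] (Fin K → F) :=
  ContinuousLinearMap.pi fun j => L ∘L ContinuousLinearMap.proj j

/-- `L` applied to the values of a function. -/
abbrev onValues (c d : ℝ) (L : E →L[ℝ] F) : L2 c d E →L[ℝ] L2 c d F := L.compLpL 2 (ivl c d)

end Calculus

/-! ### Partial integral operators -/

section PI

variable {E0 E1 E2 E3 F0 F1 F2 F3 : Type}
  [NormedAddCommGroup E0] [NormedSpace ℝ E0] [NormedAddCommGroup E1] [NormedSpace ℝ E1]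
  [NormedAddCommGroup E2] [NormedSpace ℝ E2] [NormedAddCommGroup E3] [NormedSpace ℝ E3]
  [NormedAddCommGroup F0] [NormedSpace ℝ F0] [NormedAddCommGroup F1] [NormedSpace ℝ F1]
  [NormedAddCommGroup F2] [NormedSpace ℝ F2] [NormedAddCommGroup F3] [NormedSpace ℝ F3]

/-- `P` is a 3-PI operator, with parameters `N₀ ∈ L_∞` and `N₁, N₂ ∈ L₂`. -/
def Is3PI (a b : ℝ) (P : L2 a b E1 →L[ℝ] L2 a b F1) : Prop :=
  ∃ (N0 : Lp (E1 →L[ℝ] F1) ∞ (ivl a b)) (N1 N2 : ℝ → ℝ → (E1 →L[ℝ] F1)),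
    MemLp (Function.uncurry N1) 2 ((ivl a b).prod (ivl a b)) ∧
    MemLp (Function.uncurry N2) 2 ((ivl a b).prod (ivl a b)) ∧
    ∀ u : L2 a b E1, ∀ᵐ x ∂(ivl a b),
      P u x = N0 x (u x) + (∫ θ in Icc a x, N1 x θ (u θ)) + ∫ θ in Icc x b, N2 x θ (u θ)

/-- `P` is a 4-PI operator on `E0 × L₂([a, b]; E1)`. -/
def Is4PI (a b : ℝ) (P : E0 × L2 a b E1 →L[ℝ] F0 × L2 a b F1) : Prop :=
  ∃ (B00 : E0 →L[ℝ] F0) (B01 : L2 a b (E1 →L[ℝ] F0)) (B10 : L2 a b (E0 →L[ℝ] F1))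
    (B11 : L2 a b E1 →L[ℝ] L2 a b F1), Is3PI a b B11 ∧
    ∀ (u0 : E0) (u1 : L2 a b E1),
      (P (u0, u1)).1 = B00 u0 + ∫ x, B01 x (u1 x) ∂(ivl a b) ∧
      ∀ᵐ x ∂(ivl a b), (P (u0, u1)).2 x = B10 x u0 + B11 u1 x

/-- The space `Z₁₂ = E0 × L₂([a, b]; E1) × L₂([0, 1]; E2) × L₂([0, 1] × [a, b]; E3)`. -/
abbrev Z12 (a b : ℝ) (E0 E1 E2 E3 : Type) [NormedAddCommGroup E0] [NormedAddCommGroup E1]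
    [NormedAddCommGroup E2] [NormedAddCommGroup E3] : Type :=
  (E0 × L2 a b E1) × L2 0 1 (E2 × L2 a b E3)

/-- `P` is a PI operator (in two dimensions) on `Z₁₂`: it is built from 4-PI operators in the
variable `x ∈ [a, b]`, acting as multipliers or partial integrals in the variable `s ∈ [0, 1]`. -/
def Is12PI (a b : ℝ) (P : Z12 a b E0 E1 E2 E3 →L[ℝ] Z12 a b F0 F1 F2 F3) : Prop :=
  ∃ (B11 : E0 × L2 a b E1 →L[ℝ] F0 × L2 a b F1) (B12 : E2 × L2 a b E3 →L[ℝ] F0 × L2 a b F1)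
    (B21 : E0 × L2 a b E1 →L[ℝ] F2 × L2 a b F3)
    (N0 N1 N2 : E2 × L2 a b E3 →L[ℝ] F2 × L2 a b F3),
    Is4PI a b B11 ∧ Is4PI a b B12 ∧ Is4PI a b B21 ∧ Is4PI a b N0 ∧ Is4PI a b N1 ∧ Is4PI a b N2 ∧
    ∀ (u1 : E0 × L2 a b E1) (u2 : L2 0 1 (E2 × L2 a b E3)),
      (P (u1, u2)).1 = B11 u1 + ∫ s, B12 (u2 s) ∂(ivl 0 1) ∧
      ∀ᵐ s ∂(ivl 0 1), (P (u1, u2)).2 s =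
        B21 u1 + (N0 (u2 s) + (∫ σ in Icc 0 s, N1 (u2 σ)) + ∫ σ in Icc s 1, N2 (u2 σ))

end PI

/-! ### Partial integral equations and their interconnection -/

section PIE

/-- The operators of `T_w w_t + T v_t = A v + B w`, `z = C v + D w`. -/
structure Pie (V W Z : Type) [NormedAddCommGroup V] [NormedSpace ℝ V]
    [NormedAddCommGroup W] [NormedSpace ℝ W] [NormedAddCommGroup Z] [NormedSpace ℝ Z] where
  T : V →L[ℝ] V
  Tw : W →L[ℝ] V
  A : V →L[ℝ] V
  B : W →L[ℝ] V
  C : V →L[ℝ] Z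
  D : W →L[ℝ] Z

/-- The operators of a PIE with an external input `w` and output `z` and an interconnection input `r`
and output `q`, where `r` does not enter `q` directly:
`T_r r_t + T_w w_t + T v_t = A v + B_w w + B_r r`, `z = C_z v + D_zw w + D_zr r`,
`q = C_q v + D_qw w`. -/
structure Pie₂ (V W R Z Q : Type) [NormedAddCommGroup V] [NormedSpace ℝ V]
    [NormedAddCommGroup W] [NormedSpace ℝ W] [NormedAddCommGroup R] [NormedSpace ℝ R]
    [NormedAddCommGroup Z] [NormedSpace ℝ Z] [NormedAddCommGroup Q] [NormedSpace ℝ Q] where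
  T : V →L[ℝ] V
  Tw : W →L[ℝ] V
  Tr : R →L[ℝ] V
  A : V →L[ℝ] V
  Bw : W →L[ℝ] V
  Br : R →L[ℝ] V
  Cz : V →L[ℝ] Z
  Dzw : W →L[ℝ] Z
  Dzr : R →L[ℝ] Z
  Cq : V →L[ℝ] Q
  Dqw : W →L[ℝ] Q

variable {V V₁ V₂ W R Z Q : Type} [NormedAddCommGroup V] [NormedSpace ℝ V]
  [NormedAddCommGroup V₁] [NormedSpace ℝ V₁] [NormedAddCommGroup V₂] [NormedSpace ℝ V₂]
  [NormedAddCommGroup W] [NormedSpace ℝ W] [NormedAddCommGroup R] [NormedSpace ℝ R]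
  [NormedAddCommGroup Z] [NormedSpace ℝ Z] [NormedAddCommGroup Q] [NormedSpace ℝ Q]

/-- The feedback interconnection of two PIEs: the output `q` of the first is the input of the second,
the output `r` of the second is the interconnection input of the first. -/
def interconnect (G₁ : Pie₂ V₁ W R Z Q) (G₂ : Pie V₂ Q R) : Pie (V₁ × V₂) W Z where
  T := ((G₁.T + G₁.Tr ∘L G₂.D ∘L G₁.Cq).coprod (G₁.Tr ∘L G₂.C)).prod
    ((G₂.Tw ∘L G₁.Cq).coprod G₂.T)
  Tw := (G₁.Tw + G₁.Tr ∘L G₂.D ∘L G₁.Dqw).prod (G₂.Tw ∘L G₁.Dqw)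
  A := ((G₁.A + G₁.Br ∘L G₂.D ∘L G₁.Cq).coprod (G₁.Br ∘L G₂.C)).prod
    ((G₂.B ∘L G₁.Cq).coprod G₂.A)
  B := (G₁.Bw + G₁.Br ∘L G₂.D ∘L G₁.Dqw).prod (G₂.B ∘L G₁.Dqw)
  C := (G₁.Cz + G₁.Dzr ∘L G₂.D ∘L G₁.Cq).coprod (G₁.Dzr ∘L G₂.C)
  D := G₁.Dzw + G₁.Dzr ∘L G₂.D ∘L G₁.Dqw

/-- A PIE without direct feedthrough, with its input and output read as interconnection signals, and
no external ones. -/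
def Pie.asFeedback (G : Pie V R Q) : Pie₂ V (Vec 0) R (Vec 0) Q where
  T := G.T
  Tw := 0
  Tr := G.Tw
  A := G.A
  Bw := 0
  Br := G.B
  Cz := 0
  Dzw := 0
  Dzr := 0
  Cq := G.C
  Dqw := 0

/-- `v` solves the autonomous PIE `T v_t = A v` for `t ≥ 0`, with initial condition `v₀`. The
derivative is that of a function on `[0, ∞)` with values in the normed space `V`. -/
def IsPieSolution (T A : V →L[ℝ] V) (v₀ : V) (v : ℝ → V) : Prop :=
  v 0 = v₀ ∧ ∀ t, 0 ≤ t → ∃ v' : V, HasDerivWithinAt v v' (Ici 0) t ∧ T v' = A (v t)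

end PIE

/-! ### The delayed ODE -/

section DDE

/-- Parameters of the delayed ODE
`u̇(t) = A u(t) + B_w w(t) + ∑ⱼ Aⱼ u(t - τⱼ)`, `z(t) = C_z u(t) + ∑ⱼ C_{z,j} u(t - τⱼ)`. -/
structure DdeParams (nu nw nz K : ℕ) where
  A : Vec nu →L[ℝ] Vec nu
  Bw : Vec nw →L[ℝ] Vec nu
  Cz : Vec nu →L[ℝ] Vec nz
  Ad : Fin K → (Vec nu →L[ℝ] Vec nu)
  Czd : Fin K → (Vec nu →L[ℝ] Vec nz)

variable {nu nw nz K : ℕ}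

/-- `[A₁ … A_K]`. -/
def DdeParams.Arow (G : DdeParams nu nw nz K) : (Fin K → Vec nu) →L[ℝ] Vec nu :=
  ∑ j, G.Ad j ∘L ContinuousLinearMap.proj j

/-- `[C_{z,1} … C_{z,K}]`. -/
def DdeParams.Czrow (G : DdeParams nu nw nz K) : (Fin K → Vec nu) →L[ℝ] Vec nz :=
  ∑ j, G.Czd j ∘L ContinuousLinearMap.proj j

/-- `ℝ^{nu} × L₂([0, 1]; ℝ^{nu})^K`. -/
abbrev DdeState (nu K : ℕ) : Type := Vec nu × L2 0 1 (Fin K → Vec nu)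

/-- `ξ ↦ (-ξⱼ / τⱼ)ⱼ`. -/
def delayScale {E : Type} [NormedAddCommGroup E] [NormedSpace ℝ E] (τ : Fin K → ℝ) :
    (Fin K → E) →L[ℝ] (Fin K → E) :=
  ContinuousLinearMap.pi fun j => (-(1 / τ j)) • ContinuousLinearMap.proj j

/-- `(x, z)` solves the delayed ODE with input `w` and initial condition `x₀`. Here `x = (u, φ)` with
delayed states `φⱼ(t, s) = u(t - τⱼ s)`, `s ∈ [0, 1]`, described by transport equations;
`(u(t), φ(t))` lies in `ℝ^{nu} × H₁`, and is differentiable in `t` as a function with values in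
this space. -/
def IsDdeSolution (G : DdeParams nu nw nz K) (τ : Fin K → ℝ) (x₀ : DdeState nu K)
    (w : ℝ → Vec nw) (x : ℝ → DdeState nu K) (z : ℝ → Vec nz) : Prop :=
  x 0 = x₀ ∧
  ∃ (u : ℝ → Vec nu) (φ : ℝ → H1 0 1 (Fin K → Vec nu)), ∀ t, 0 ≤ t →
    x t = (u t, H1.fn (φ t)) ∧
    (∀ j, valueAt (H1.fn (φ t)) 0 j = u t) ∧
    ∃ (u' : Vec nu) (φ' : H1 0 1 (Fin K → Vec nu)),
      HasDerivWithinAt u u' (Ici 0) t ∧ HasDerivWithinAt φ φ' (Ici 0) t ∧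
      u' = G.A (u t) + G.Arow (valueAt (H1.fn (φ t)) 1) + G.Bw (w t) ∧
      z t = G.Cz (u t) + G.Czrow (valueAt (H1.fn (φ t)) 1) ∧
      ∀ᵐ s ∂(ivl 0 1), ∀ j, H1.fn φ' s j = (-(1 / τ j)) • H1.der (φ t) s j

/-- `(u, ψ) ↦ (φⱼ(1))ⱼ` with `φⱼ(1) = u + ∫₀¹ ψⱼ`. -/
def ddeEnd (nu K : ℕ) : DdeState nu K →L[ℝ] (Fin K → Vec nu) :=
  (ContinuousLinearMap.pi fun _ => ContinuousLinearMap.id ℝ (Vec nu)).coprod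
    (integralL 0 1 (Fin K → Vec nu))

/-- The PIE of the delayed ODE, with state `(u, ψ)`, `ψ = ∂_s φ`. -/
def ddePie (G : DdeParams nu nw nz K) (τ : Fin K → ℝ) :
    Pie (DdeState nu K) (Vec nw) (Vec nz) where
  T := (ContinuousLinearMap.fst ℝ _ _).prod
    ((constFn 0 1 ∘L ContinuousLinearMap.pi fun _ => ContinuousLinearMap.id ℝ (Vec nu)).coprod
      (primitiveL 0 1 (Fin K → Vec nu)))
  Tw := 0
  A := (G.A ∘L ContinuousLinearMap.fst ℝ _ _ + G.Arow ∘L ddeEnd nu K).prod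
    (onValues 0 1 (delayScale τ) ∘L ContinuousLinearMap.snd ℝ _ _)
  B := G.Bw.prod 0
  C := G.Cz ∘L ContinuousLinearMap.fst ℝ _ _ + G.Czrow ∘L ddeEnd nu K
  D := 0

end DDE

/-! ### The delayed PDE -/

section DPDE

/-- `ℝ^{n₁} × ℝ^{n₂} × ℝ^{n₃}`, for `n = (n₁, n₂, n₃)`. -/
abbrev EP (n : ℕ × ℕ × ℕ) : Type := Vec n.1 × Vec n.2.1 × Vec n.2.2

/-- The values of `D_int u = (u₁, u₂, u₃, ∂u₂, ∂u₃, ∂²u₃)`. -/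
abbrev EInt (n : ℕ × ℕ × ℕ) : Type :=
  Vec n.1 × Vec n.2.1 × Vec n.2.2 × Vec n.2.1 × Vec n.2.2 × Vec n.2.2

/-- The values of `D_bc u = (u₂, u₃, ∂u₃)` at one point. -/
abbrev EBc (n : ℕ × ℕ × ℕ) : Type := Vec n.2.1 × Vec n.2.2 × Vec n.2.2

/-- `L₂([a, b]; ℝ^{n₁ + n₂ + n₃})`. -/
abbrev XP (a b : ℝ) (n : ℕ × ℕ × ℕ) : Type := L2 a b (EP n)

/-- The Sobolev space `L₂^{n₁} × H₁^{n₂} × H₂^{n₃}` on `[a, b]`. -/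
abbrev USpace (a b : ℝ) (n : ℕ × ℕ × ℕ) : Type :=
  L2 a b (Vec n.1) × H1 a b (Vec n.2.1) × H2 a b (Vec n.2.2)

/-- The signals `(D_int u, Λ_bf u, z)`, where `Λ_bf u` is the pair of the values of `D_bc u` at
`a` and at `b`. -/
abbrev Sig (a b : ℝ) (n : ℕ × ℕ × ℕ) (nz : ℕ) : Type :=
  L2 a b (EInt n) × (EBc n × EBc n) × Vec nz

variable {a b : ℝ} {n : ℕ × ℕ × ℕ} {nw nz K : ℕ}

/-- The inclusion of `L₂^{n₁} × H₁^{n₂} × H₂^{n₃}` in `L₂`. -/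
def USpace.incl (a b : ℝ) (n : ℕ × ℕ × ℕ) : USpace a b n →L[ℝ] XP a b n :=
  pairL a b _ _ ∘L (ContinuousLinearMap.id ℝ _).prodMap
    (pairL a b _ _ ∘L H1.fn.prodMap H2.fn)

/-- `D_int u = (u₁, u₂, u₃, ∂u₂, ∂u₃, ∂²u₃)`. -/
def Dint (u : USpace a b n) : L2 a b (EInt n) :=
  pairL a b _ _ (u.1, pairL a b _ _ (H1.fn u.2.1, pairL a b _ _ (H2.fn u.2.2,
    pairL a b _ _ (H1.der u.2.1, pairL a b _ _ (H2.der u.2.2, H2.der2 u.2.2)))))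

/-- The value of `D_bc u = (u₂, u₃, ∂u₃)` at `x`. -/
def Dbc (u : USpace a b n) (x : ℝ) : EBc n :=
  (valueAt (H1.fn u.2.1) x, valueAt (H2.fn u.2.2) x, valueAt (H2.der u.2.2) x)

/-- `(D_int u, Λ_bf u, z)`. -/
def sig (u : USpace a b n) (z : Vec nz) : Sig a b n nz := (Dint u, (Dbc u a, Dbc u b), z)

/-- `T_q (D_int u, Λ_bf u, z) = (u, z)`. -/
def Tq (a b : ℝ) (n : ℕ × ℕ × ℕ) (nz : ℕ) : Sig a b n nz →L[ℝ] XP a b n × Vec nz :=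
  (onValues a b ((ContinuousLinearMap.fst ℝ _ _).prod
      (((ContinuousLinearMap.fst ℝ _ _) ∘L ContinuousLinearMap.snd ℝ _ _).prod
        ((ContinuousLinearMap.fst ℝ _ _) ∘L (ContinuousLinearMap.snd ℝ _ _) ∘L
          ContinuousLinearMap.snd ℝ _ _)))).prodMap (ContinuousLinearMap.snd ℝ _ _)

/-- Coefficients of the map `(D_int u, Λ_bf u, z) ↦
(A_p D_int u + A_b Λ_bf u + B_z z, ∫ C_wp D_int u + C_wb Λ_bf u + D_wz z)`. -/
structure PdeCoeff (a b : ℝ) (n : ℕ × ℕ × ℕ) (nw nz : ℕ) where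
  Ap : Lp (EInt n →L[ℝ] EP n) ∞ (ivl a b)
  Ab : L2 a b (EBc n × EBc n →L[ℝ] EP n)
  Bz : L2 a b (Vec nz →L[ℝ] EP n)
  Cwp : L2 a b (EInt n →L[ℝ] Vec nw)
  Cwb : EBc n × EBc n →L[ℝ] Vec nw
  Dwz : Vec nz →L[ℝ] Vec nw

/-- The map described by the coefficients. -/
def PdeCoeff.op (G : PdeCoeff a b n nw nz) : Sig a b n nz →L[ℝ] XP a b n × Vec nw :=
  ((mulL G.Ap).coprod ((columnL G.Ab).coprod (columnL G.Bz))).prod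
    ((rowL G.Cwp).coprod (G.Cwb.coprod G.Dwz))

/-- Parameters of the delayed PDE: coefficients of the undelayed terms, and of the terms with
delay `τⱼ`. -/
structure PddeParams (a b : ℝ) (n : ℕ × ℕ × ℕ) (nw nz K : ℕ) where
  now : PdeCoeff a b n nw nz
  del : Fin K → PdeCoeff a b n nw nz

/-- `[B_r; D_wr]`: the delayed terms. -/
def PddeParams.delOp (G : PddeParams a b n nw nz K) :
    (Fin K → Sig a b n nz) →L[ℝ] XP a b n × Vec nw :=
  ∑ j, (G.del j).op ∘L ContinuousLinearMap.proj j

/-- Parameters of the boundary conditions `∫ E_p D_int u + E_b Λ_bf u + E_z z = 0`; there are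
`n₂ + 2 n₃` of them. -/
structure BcParams (a b : ℝ) (n : ℕ × ℕ × ℕ) (nz : ℕ) where
  Ep : L2 a b (EInt n →L[ℝ] Vec (n.2.1 + 2 * n.2.2))
  Eb : EBc n × EBc n →L[ℝ] Vec (n.2.1 + 2 * n.2.2)
  Ez : Vec nz →L[ℝ] Vec (n.2.1 + 2 * n.2.2)

/-- The left-hand side of the boundary conditions. -/
def BcParams.op (E : BcParams a b n nz) : Sig a b n nz →L[ℝ] Vec (n.2.1 + 2 * n.2.2) :=
  (rowL E.Ep).coprod (E.Eb.coprod E.Ez)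

/-- The delayed states `φⱼ = (φ_{u,j}, φ_{z,j})`, `j = 1, …, K`, as an element of
`H₁([0, 1]; L₂^{n₁} × H₁^{n₂} × H₂^{n₃})^K × H₁([0, 1]; ℝ^{nz})^K`. -/
abbrev DelaySpace (a b : ℝ) (n : ℕ × ℕ × ℕ) (nz K : ℕ) : Type :=
  H1 0 1 (Fin K → USpace a b n × Vec nz)

/-- `L₂([a, b]; ℝ^{‖n‖}) × (L₂([0, 1] × [a, b]; ℝ^{‖n‖}) × L₂([0, 1]; ℝ^{nz}))^K`. -/
abbrev DpdeState (a b : ℝ) (n : ℕ × ℕ × ℕ) (nz K : ℕ) : Type :=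
  XP a b n × L2 0 1 (Fin K → XP a b n × Vec nz)

/-- The inclusion of the delayed states in `L₂`. -/
def DelaySpace.incl (φ : DelaySpace a b n nz K) : L2 0 1 (Fin K → XP a b n × Vec nz) :=
  onValues 0 1 (eachL K ((USpace.incl a b n).prodMap (ContinuousLinearMap.id ℝ (Vec nz))))
    (H1.fn φ)

/-- The state `φⱼ(s)` at the point `s ∈ [0, 1]`, for all `j`. -/
def DelaySpace.at (φ : DelaySpace a b n nz K) (s : ℝ) : Fin K → USpace a b n × Vec nz :=
  valueAt (H1.fn φ) s

/-- `(x, w)` solves the delayed PDE with input `z` and initial condition `x₀`. Here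
`x = (u, φ)` with delayed states `φⱼ(t, s) = (u(t - τⱼ s), z(t - τⱼ s))`, `s ∈ [0, 1]`, described by
transport equations; `u(t)` and `φ(t)` lie in Sobolev spaces and satisfy the boundary conditions, and
`(u, φ)` is differentiable in `t` as a function with values in these Sobolev spaces. -/
def IsDpdeSolution (G : PddeParams a b n nw nz K) (E : BcParams a b n nz) (τ : Fin K → ℝ)
    (x₀ : DpdeState a b n nz K) (z : ℝ → Vec nz) (x : ℝ → DpdeState a b n nz K)
    (w : ℝ → Vec nw) : Prop :=
  x 0 = x₀ ∧
  ∃ (u : ℝ → USpace a b n) (φ : ℝ → DelaySpace a b n nz K)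
    (q : ℝ → Sig a b n nz) (r : ℝ → Fin K → Sig a b n nz), ∀ t, 0 ≤ t →
    x t = (USpace.incl a b n (u t), (φ t).incl) ∧
    q t = sig (u t) (z t) ∧
    (∀ j, r t j = sig ((φ t).at 1 j).1 ((φ t).at 1 j).2) ∧
    E.op (sig (u t) (z t)) = 0 ∧
    (∀ j, (USpace.incl a b n ((φ t).at 0 j).1, ((φ t).at 0 j).2) = Tq a b n nz (q t)) ∧
    (∀ s ∈ Icc (0 : ℝ) 1, ∀ j, E.op (sig ((φ t).at s j).1 ((φ t).at s j).2) = 0) ∧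
    ∃ (u' : USpace a b n) (φ' : DelaySpace a b n nz K),
      HasDerivWithinAt u u' (Ici 0) t ∧ HasDerivWithinAt φ φ' (Ici 0) t ∧
      (USpace.incl a b n u', w t) = G.now.op (q t) + G.delOp (r t) ∧
      ∀ᵐ s ∂(ivl 0 1), ∀ j, H1.fn φ' s j = (-(1 / τ j)) • H1.der (φ t) s j

/-! #### Reconstruction of the PDE state from its fundamental state `v = (u₁, ∂u₂, ∂²u₃)` -/

/-- `D_int u` for the function `u` with `(u₁, ∂u₂, ∂²u₃) = v` and `(u₂, u₃, ∂u₃)(a) = c`: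
`u₂ = c₂ + ∫_a^x v₂`, `∂u₃ = c₃' + ∫_a^x v₃`, `u₃ = c₃ + ∫_a^x ∂u₃`. -/
def recInt (a b : ℝ) (n : ℕ × ℕ × ℕ) : EBc n × XP a b n →L[ℝ] L2 a b (EInt n) :=
  let c := ContinuousLinearMap.fst ℝ (EBc n) (XP a b n)
  let v := ContinuousLinearMap.snd ℝ (EBc n) (XP a b n)
  let c2 := ContinuousLinearMap.fst ℝ _ _ ∘L c
  let c3 := ContinuousLinearMap.fst ℝ _ _ ∘L ContinuousLinearMap.snd ℝ _ _ ∘L c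
  let c3' := ContinuousLinearMap.snd ℝ _ _ ∘L ContinuousLinearMap.snd ℝ _ _ ∘L c
  let v1 := onValues a b (ContinuousLinearMap.fst ℝ _ _) ∘L v
  let v2 := onValues a b (ContinuousLinearMap.fst ℝ _ _ ∘L ContinuousLinearMap.snd ℝ _ _) ∘L v
  let v3 := onValues a b (ContinuousLinearMap.snd ℝ _ _ ∘L ContinuousLinearMap.snd ℝ _ _) ∘L v
  let u2 := constFn a b ∘L c2 + primitiveL a b (Vec n.2.1) ∘L v2
  let du3 := constFn a b ∘L c3' + primitiveL a b (Vec n.2.2) ∘L v3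
  let u3 := constFn a b ∘L c3 + primitiveL a b (Vec n.2.2) ∘L du3
  pairL a b _ _ ∘L v1.prod (pairL a b _ _ ∘L u2.prod (pairL a b _ _ ∘L u3.prod
    (pairL a b _ _ ∘L v2.prod (pairL a b _ _ ∘L du3.prod v3))))

/-- `Λ_bf u` for the same function `u`:
`u₂(b) = c₂ + ∫_a^b v₂`, `u₃(b) = c₃ + ∫_a^b ∂u₃`, `∂u₃(b) = c₃' + ∫_a^b v₃`. -/
def recBf (a b : ℝ) (n : ℕ × ℕ × ℕ) : EBc n × XP a b n →L[ℝ] EBc n × EBc n :=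
  let c := ContinuousLinearMap.fst ℝ (EBc n) (XP a b n)
  let v := ContinuousLinearMap.snd ℝ (EBc n) (XP a b n)
  let c2 := ContinuousLinearMap.fst ℝ _ _ ∘L c
  let c3 := ContinuousLinearMap.fst ℝ _ _ ∘L ContinuousLinearMap.snd ℝ _ _ ∘L c
  let c3' := ContinuousLinearMap.snd ℝ _ _ ∘L ContinuousLinearMap.snd ℝ _ _ ∘L c
  let v2 := onValues a b (ContinuousLinearMap.fst ℝ _ _ ∘L ContinuousLinearMap.snd ℝ _ _) ∘L v
  let v3 := onValues a b (ContinuousLinearMap.snd ℝ _ _ ∘L ContinuousLinearMap.snd ℝ _ _) ∘L v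
  let du3 := constFn a b ∘L c3' + primitiveL a b (Vec n.2.2) ∘L v3
  c.prod ((c2 + integralL a b (Vec n.2.1) ∘L v2).prod
    ((c3 + integralL a b (Vec n.2.2) ∘L du3).prod (c3' + integralL a b (Vec n.2.2) ∘L v3)))

/-- `(D_int u, Λ_bf u, z)` for the same function `u`. -/
def recSig (a b : ℝ) (n : ℕ × ℕ × ℕ) (nz : ℕ) :
    EBc n × (XP a b n × Vec nz) →L[ℝ] Sig a b n nz :=
  let c := ContinuousLinearMap.fst ℝ (EBc n) (XP a b n × Vec nz)
  let v := ContinuousLinearMap.fst ℝ _ _ ∘L ContinuousLinearMap.snd ℝ (EBc n) (XP a b n × Vec nz)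
  let z := ContinuousLinearMap.snd ℝ _ _ ∘L ContinuousLinearMap.snd ℝ (EBc n) (XP a b n × Vec nz)
  (recInt a b n ∘L c.prod v).prod ((recBf a b n ∘L c.prod v).prod z)

/-- The matrix of the boundary conditions in terms of `c = (u₂, u₃, ∂u₃)(a)`, for functions `u` with
`(u₁, ∂u₂, ∂²u₃) = 0` and for `z = 0`. -/
def BcParams.matrix (E : BcParams a b n nz) : EBc n →L[ℝ] Vec (n.2.1 + 2 * n.2.2) :=
  E.op ∘L recSig a b n nz ∘L ContinuousLinearMap.inl ℝ _ _

/-- The boundary conditions are well-posed. -/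
def BcParams.WellPosed (E : BcParams a b n nz) : Prop := E.matrix.IsInvertible

/-- The value `c = (u₂, u₃, ∂u₃)(a)` of the function `u` with `(u₁, ∂u₂, ∂²u₃) = v` that satisfies the
boundary conditions with input `z`. -/
def BcParams.core (E : BcParams a b n nz) : XP a b n × Vec nz →L[ℝ] EBc n :=
  - (E.matrix.inverse ∘L E.op ∘L recSig a b n nz ∘L ContinuousLinearMap.inr ℝ _ _)

/-- `(v, z) ↦ (D_int u, Λ_bf u, z)` for the function `u = 𝒯 v + 𝒯_z z` with
`(u₁, ∂u₂, ∂²u₃) = v` that satisfies the boundary conditions with input `z`. -/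
def BcParams.full (E : BcParams a b n nz) : XP a b n × Vec nz →L[ℝ] Sig a b n nz :=
  recSig a b n nz ∘L E.core.prod (ContinuousLinearMap.id ℝ _)

/-- `(v, z) ↦ (𝒯 v + 𝒯_z z, z)`. -/
def BcParams.state (E : BcParams a b n nz) : XP a b n × Vec nz →L[ℝ] XP a b n × Vec nz :=
  Tq a b n nz ∘L E.full

/-- The PIE of the PDE without transport equations, with external input `z` and output `w`, and with
interconnection input `r` (the delayed signals) and output `q = (D_int u, Λ_bf u, z)`. -/
def pdePie (G : PddeParams a b n nw nz K) (E : BcParams a b n nz) :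
    Pie₂ (XP a b n) (Vec nz) (Fin K → Sig a b n nz) (Vec nw) (Sig a b n nz) where
  T := ContinuousLinearMap.fst ℝ _ _ ∘L E.state ∘L ContinuousLinearMap.inl ℝ _ _
  Tw := ContinuousLinearMap.fst ℝ _ _ ∘L E.state ∘L ContinuousLinearMap.inr ℝ _ _
  Tr := 0
  A := ContinuousLinearMap.fst ℝ _ _ ∘L G.now.op ∘L E.full ∘L ContinuousLinearMap.inl ℝ _ _
  Bw := ContinuousLinearMap.fst ℝ _ _ ∘L G.now.op ∘L E.full ∘L ContinuousLinearMap.inr ℝ _ _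
  Br := ContinuousLinearMap.fst ℝ _ _ ∘L G.delOp
  Cz := ContinuousLinearMap.snd ℝ _ _ ∘L G.now.op ∘L E.full ∘L ContinuousLinearMap.inl ℝ _ _
  Dzw := ContinuousLinearMap.snd ℝ _ _ ∘L G.now.op ∘L E.full ∘L ContinuousLinearMap.inr ℝ _ _
  Dzr := ContinuousLinearMap.snd ℝ _ _ ∘L G.delOp
  Cq := E.full ∘L ContinuousLinearMap.inl ℝ _ _
  Dqw := E.full ∘L ContinuousLinearMap.inr ℝ _ _

/-- The PIE of the transport equations, with states `ψⱼ = (∂_s 𝒟 φ_{u,j}, ∂_s φ_{z,j})`,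
`𝒟 u = (u₁, ∂u₂, ∂²u₃)`, input `q`, and output `r`. -/
def transportPie (E : BcParams a b n nz) (τ : Fin K → ℝ) :
    Pie (L2 0 1 (Fin K → XP a b n × Vec nz)) (Sig a b n nz) (Fin K → Sig a b n nz) where
  T := primitiveL 0 1 _ ∘L onValues 0 1 (eachL K E.state)
  Tw := constFn 0 1 ∘L ContinuousLinearMap.pi fun _ => Tq a b n nz
  A := onValues 0 1 (delayScale τ) ∘L onValues 0 1 (eachL K E.state)
  B := 0
  C := integralL 0 1 _ ∘L onValues 0 1 (eachL K E.full)
  D := ContinuousLinearMap.pi fun _ => ContinuousLinearMap.id ℝ _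

/-- The PIE of the delayed PDE. -/
def dpdePie (G : PddeParams a b n nw nz K) (E : BcParams a b n nz) (τ : Fin K → ℝ) :
    Pie (DpdeState a b n nz K) (Vec nz) (Vec nw) :=
  interconnect (pdePie G E) (transportPie E τ)

end DPDE

/-! ### The delayed ODE-PDE system -/

section Coupled

variable {a b : ℝ} {n : ℕ × ℕ × ℕ} {nu nw nz K : ℕ}

/-- The states of the coupled system. -/
abbrev CoupledState (a b : ℝ) (n : ℕ × ℕ × ℕ) (nu nz K : ℕ) : Type :=
  DdeState nu K × DpdeState a b n nz K

/-- `x` solves the delayed ODE-PDE system with initial condition `x₀`. -/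
def IsCoupledSolution (G : DdeParams nu nw nz K) (P : PddeParams a b n nw nz K)
    (E : BcParams a b n nz) (τ : Fin K → ℝ) (x₀ : CoupledState a b n nu nz K)
    (x : ℝ → CoupledState a b n nu nz K) : Prop :=
  ∃ (z : ℝ → Vec nz) (w : ℝ → Vec nw),
    IsDdeSolution G τ x₀.1 w (fun t => (x t).1) z ∧
    IsDpdeSolution P E τ x₀.2 z (fun t => (x t).2) w

/-- The interconnection of the PIE of the delayed ODE and the PIE of the delayed PDE. -/
def coupledPie (G : DdeParams nu nw nz K) (P : PddeParams a b n nw nz K)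
    (E : BcParams a b n nz) (τ : Fin K → ℝ) :
    Pie (CoupledState a b n nu nz K) (Vec 0) (Vec 0) :=
  interconnect (ddePie G τ).asFeedback (dpdePie P E τ)

/-- Sorting the components of a state, as an isomorphism of
`(ℝ^{nu} × L₂[0, 1]^{K nu}) × (L₂[a, b]^{‖n‖} × (L₂([0, 1] × [a, b])^{‖n‖} × L₂[0, 1]^{nz})^K)` with
`Z₁₂ = ℝ^{nu} × L₂[a, b]^{‖n‖} × L₂[0, 1]^{K nu + K nz} × L₂([0, 1] × [a, b])^{K ‖n‖}`. -/
def toZ12 (a b : ℝ) (n : ℕ × ℕ × ℕ) (nu nz K : ℕ) : CoupledState a b n nu nz K →L[ℝ]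
    Z12 a b (Vec nu) (EP n) ((Fin K → Vec nu) × (Fin K → Vec nz)) (Fin K → EP n) :=
  let fromODE : (Fin K → Vec nu) →L[ℝ]
      ((Fin K → Vec nu) × (Fin K → Vec nz)) × L2 a b (Fin K → EP n) :=
    ContinuousLinearMap.inl ℝ _ _ ∘L ContinuousLinearMap.inl ℝ _ _
  let fromPDE : (Fin K → XP a b n × Vec nz) →L[ℝ]
      ((Fin K → Vec nu) × (Fin K → Vec nz)) × L2 a b (Fin K → EP n) :=
    (ContinuousLinearMap.inr ℝ _ _ ∘L eachL K (ContinuousLinearMap.snd ℝ _ _)).prod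
      (packL a b K (EP n) ∘L eachL K (ContinuousLinearMap.fst ℝ _ _))
  ((ContinuousLinearMap.fst ℝ _ _).prodMap (ContinuousLinearMap.fst ℝ _ _)).prod
    (((onValues 0 1 fromODE).coprod (onValues 0 1 fromPDE)) ∘L
      ((ContinuousLinearMap.snd ℝ _ _).prodMap (ContinuousLinearMap.snd ℝ _ _)))

/-- `P` is a PI operator on the states of the coupled system. -/
def IsPI (P : CoupledState a b n nu nz K →L[ℝ] CoupledState a b n nu nz K) : Prop :=
  ∃ P' : Z12 a b (Vec nu) (EP n) ((Fin K → Vec nu) × (Fin K → Vec nz)) (Fin K → EP n) →L[ℝ]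
      Z12 a b (Vec nu) (EP n) ((Fin K → Vec nu) × (Fin K → Vec nz)) (Fin K → EP n),
    Is12PI a b P' ∧ ∀ v, toZ12 a b n nu nz K (P v) = P' (toZ12 a b n nu nz K v)

end Coupled

end

end DelayPIE

/-! Equivalence of solutions. A Sobolev function is recovered from its highest derivatives by
integrating from the left endpoint. The missing values at `a` are fixed by the boundary conditions,
a square invertible linear system, and the missing values at `s = 0` by the undelayed state. This
gives bounded operators: a lift from fundamental states (and the input `z`) to Sobolev states, the
inclusion of Sobolev states in `L₂`, and the map `fund` that takes the highest derivatives. Three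
facts carry the proof. The inclusion after the lift is `T` for the ODE and `T + T_w z` for the PDE
(`ddePie_T_apply`, `dpdePie_T_add_Tw`); `fund` after the lift returns the fundamental state
(`ddeFund_ddeLift`, `dpdeFund_dpdeLift`); the inclusion is injective, because weak derivatives are
unique (`ddeIncl_injective`, `dpdeIncl_injective`).

If `v` solves the PIE, its lift is differentiable in the Sobolev norm, since the lift is bounded,
and its traces and delayed values are the ones built into `A`. Conversely, if `T v` solves the
delayed system, injectivity of the inclusion forces the Sobolev state to be the lift of `v`. So `v`
is `fund` of a differentiable function, and computing the derivative of `T v` in two ways yields the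
PIE. In the coupled system `z` is a bounded function of the ODE state, hence differentiable, which
gives meaning to the term `T_z z_t`. Well-posedness enters through `BcParams.op_full`: lifted
functions satisfy the boundary conditions.

The PI property. Bounded operators between a finite-dimensional space and `L₂` are represented by
`L₂` functions (`exists_columnL_eq`, `exists_rowL_eq`, the latter by Riesz). Hence a bounded
operator is 4-PI as soon as its block from functions to functions is 3-PI (`Is3PI.is4PI`). Those
blocks are built from bounded multipliers, primitives, one double primitive and finite-rank
operators. In the variable `s`, both `T` and `A` are made of constants, multipliers, primitives and
integrals over `[0, 1]`; splitting the last at `s` gives the required form (`is12PI_z12Op`). -/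

namespace DelayPIE

noncomputable section

/-! ### Primitives, weak derivatives and Sobolev spaces of vector-valued functions. -/

section CalculusLemmas

variable {c d : ℝ} {E F : Type} [NormedAddCommGroup E] [NormedSpace ℝ E]
  [NormedAddCommGroup F] [NormedSpace ℝ F]

theorem ae_mem_ivl (c d : ℝ) : ∀ᵐ x ∂(ivl c d), x ∈ Icc c d :=
  ae_restrict_mem measurableSet_Icc

theorem primitiveL_ae (f : L2 c d E) :
    primitiveL c d E f =ᵐ[ivl c d] fun x => ∫ θ in c..x, f θ ∂(ivl c d) :=
  (memLp_primitive f).coeFn_toLp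

theorem constFn_ae (c d : ℝ) (e : E) : constFn c d e =ᵐ[ivl c d] fun _ => e :=
  Lp.coeFn_const _ _ e

/-- Moves the variable endpoint from the domain into the integrand, the form in which Fubini
applies. -/
theorem primitive_eq_indicator {f : ℝ → E} {x : ℝ} (hx : x ∈ Icc c d) :
    ∫ θ in c..x, f θ ∂(ivl c d) = ∫ θ, (Iic x).indicator f θ ∂(ivl c d) := by
  rw [intervalIntegral.integral_of_le hx.1, integral_indicator measurableSet_Iic,
    Measure.restrict_restrict measurableSet_Ioc, Measure.restrict_restrict measurableSet_Iic]
  refine setIntegral_congr_set ?_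
  have h1 : Ioc c x ∩ Icc c d = Ioc c x := by
    ext y; simp only [mem_inter_iff, mem_Ioc, mem_Icc]; constructor
    · exact fun h => h.1
    · exact fun h => ⟨h, h.1.le, h.2.trans hx.2⟩
  have h2 : Iic x ∩ Icc c d = Icc c x := by
    ext y; simp only [mem_inter_iff, mem_Iic, mem_Icc]; constructor
    · exact fun h => ⟨h.2.1, h.1⟩
    · exact fun h => ⟨h.2, h.1, h.2.trans hx.2⟩
  rw [h1, h2]
  exact Ioc_ae_eq_Icc

theorem primitive_eq_setIntegral {f : ℝ → E} {x : ℝ} (hx : x ∈ Icc c d) :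
    ∫ θ in c..x, f θ ∂(ivl c d) = ∫ θ in Icc c x, f θ := by
  rw [primitive_eq_indicator hx, integral_indicator measurableSet_Iic,
    Measure.restrict_restrict measurableSet_Iic]
  congr 2
  ext y; simp only [mem_inter_iff, mem_Iic, mem_Icc]; constructor
  · exact fun h => ⟨h.2.1, h.1⟩
  · exact fun h => ⟨h.2, h.1, h.2.trans hx.2⟩

theorem primitive_right {f : ℝ → E} (hcd : c ≤ d) :
    ∫ θ in c..d, f θ ∂(ivl c d) = ∫ θ, f θ ∂(ivl c d) :=
  primitive_eq_setIntegral (right_mem_Icc.2 hcd)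

/-- Exchange of the order of integration over a triangle. -/
theorem integral_smul_indicator_swap [CompleteSpace E] {μ : Measure ℝ} [SFinite μ] {h : ℝ → ℝ}
    {f : ℝ → E} (hh : Integrable h μ) (hf : Integrable f μ) :
    ∫ y, h y • (∫ θ, (Iic y).indicator f θ ∂μ) ∂μ
      = ∫ θ, (∫ y, (Ici θ).indicator h y ∂μ) • f θ ∂μ := by
  -- Both sides are iterated integrals of `h y • f θ` over the triangle `θ ≤ y`; the product is
  -- integrable, so is its restriction.
  have hm : MeasurableSet {p : ℝ × ℝ | p.2 ≤ p.1} := measurableSet_le measurable_snd measurable_fst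
  have hi : Integrable (Function.uncurry fun y θ =>
      {p : ℝ × ℝ | p.2 ≤ p.1}.indicator (fun p => h p.1 • f p.2) (y, θ)) (μ.prod μ) :=
    (hh.smul_prod hf).indicator hm
  have key := integral_integral_swap hi
  calc _ = ∫ y, ∫ θ, {p : ℝ × ℝ | p.2 ≤ p.1}.indicator (fun p => h p.1 • f p.2) (y, θ) ∂μ ∂μ := by
        refine integral_congr_ae (Filter.Eventually.of_forall fun y => ?_)
        simp only
        rw [← integral_smul]
        refine integral_congr_ae (Filter.Eventually.of_forall fun θ => ?_)
        by_cases hθ : θ ≤ y <;> simp [indicator, hθ]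
    _ = _ := key
    _ = _ := by
        refine integral_congr_ae (Filter.Eventually.of_forall fun θ => ?_)
        simp only
        rw [← integral_smul_const]
        refine integral_congr_ae (Filter.Eventually.of_forall fun y => ?_)
        by_cases hθ : θ ≤ y <;> simp [indicator, hθ]

/-- Serves twice: with `h` the derivative of a test function it is integration by parts, with `h =
1` it gives the kernel of a double primitive. -/
theorem integral_smul_primitive [CompleteSpace E] {h : ℝ → ℝ} {f : ℝ → E}
    (hh : Integrable h (ivl c d)) (hf : Integrable f (ivl c d)) :
    ∫ y, h y • (∫ θ in c..y, f θ ∂(ivl c d)) ∂(ivl c d)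
      = ∫ θ, (∫ y in Icc θ d, h y) • f θ ∂(ivl c d) := by
  calc _ = ∫ y, h y • (∫ θ, (Iic y).indicator f θ ∂(ivl c d)) ∂(ivl c d) := by
        refine integral_congr_ae ?_
        filter_upwards [ae_mem_ivl c d] with y hy
        rw [primitive_eq_indicator hy]
    _ = _ := integral_smul_indicator_swap hh hf
    _ = _ := by
        refine integral_congr_ae ?_
        filter_upwards [ae_mem_ivl c d] with θ hθ
        rw [integral_indicator measurableSet_Ici, Measure.restrict_restrict measurableSet_Ici]
        congr 3
        ext y; simp only [mem_inter_iff, mem_Ici, mem_Icc]; constructor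
        · exact fun h => ⟨h.1, h.2.2⟩
        · exact fun h => ⟨h.1, hθ.1.trans h.1, h.2⟩

/-- After the exchange of integrals the inner one is `η d - η θ`, and `η d = 0`. -/
theorem hasWeakDeriv_primitiveL [CompleteSpace E] (f : L2 c d E) :
    HasWeakDeriv c d (primitiveL c d E f) f := by
  intro η hη hc hs
  have hd : Continuous (deriv η) := hη.continuous_deriv (by simp)
  have hdi : Integrable (deriv η) (ivl c d) := hd.integrableOn_Icc
  have hηd : η d = 0 := by
    by_contra h
    exact absurd (hs (subset_tsupport _ h)).2 (lt_irrefl _)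
  calc _ = ∫ y, deriv η y • (∫ θ in c..y, f θ ∂(ivl c d)) ∂(ivl c d) := by
        refine integral_congr_ae ?_
        filter_upwards [primitiveL_ae f] with y hy
        rw [hy]
    _ = _ := integral_smul_primitive hdi (integrable_L2 f)
    _ = ∫ θ, -(η θ • f θ) ∂(ivl c d) := by
        refine integral_congr_ae ?_
        filter_upwards [ae_mem_ivl c d] with θ hθ
        rw [integral_Icc_eq_integral_Ioc, ← intervalIntegral.integral_of_le hθ.2,
          intervalIntegral.integral_deriv_eq_sub
            (fun x _ => (hη.differentiable (by simp)).differentiableAt) (hd.intervalIntegrable _ _),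
          hηd, zero_sub, neg_smul]
    _ = _ := integral_neg _

/-- The integral of `η'` is `η d - η c = 0`; if `d < c` the measure itself is zero. -/
theorem hasWeakDeriv_constFn [CompleteSpace E] (e : E) :
    HasWeakDeriv c d (constFn c d e) 0 := by
  intro η hη hc hs
  have hd : Continuous (deriv η) := hη.continuous_deriv (by simp)
  have h1 : ∫ x, deriv η x • constFn c d e x ∂(ivl c d) = (∫ x, deriv η x ∂(ivl c d)) • e := by
    rw [← integral_smul_const]
    refine integral_congr_ae ?_
    filter_upwards [constFn_ae c d e] with x hx
    rw [hx]
  have h2 : ∫ x, η x • (0 : L2 c d E) x ∂(ivl c d) = 0 := by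
    refine integral_eq_zero_of_ae ?_
    filter_upwards [Lp.coeFn_zero E 2 (ivl c d)] with x hx
    rw [hx]
    exact smul_zero _
  rw [h1, h2, neg_zero]
  rcases le_or_gt c d with hcd | hcd
  · have hηd : η d = 0 := by
      by_contra h
      exact absurd (hs (subset_tsupport _ h)).2 (lt_irrefl _)
    have hηc : η c = 0 := by
      by_contra h
      exact absurd (hs (subset_tsupport _ h)).1 (lt_irrefl _)
    rw [integral_Icc_eq_integral_Ioc, ← intervalIntegral.integral_of_le hcd,
      intervalIntegral.integral_deriv_eq_sub
        (fun x _ => (hη.differentiable (by simp)).differentiableAt) (hd.intervalIntegrable _ _),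
      hηc, hηd, sub_zero, zero_smul]
  · simp [ivl, Icc_eq_empty_of_lt hcd]

theorem hasWeakDeriv_constFn_add_primitiveL [CompleteSpace E] (e : E) (f : L2 c d E) :
    HasWeakDeriv c d (constFn c d e + primitiveL c d E f) f := by
  simpa using (hasWeakDeriv_constFn e).add (hasWeakDeriv_primitiveL f)

/-- Uniqueness of weak derivatives, by the fundamental lemma of the calculus of variations. -/
theorem HasWeakDeriv.eq_zero [CompleteSpace E] {g : L2 c d E} (h : HasWeakDeriv c d 0 g) :
    g = 0 := by
  have h1 : ∀ᵐ x ∂(ivl c d), x ∈ Ioo c d → g x = 0 := by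
    refine isOpen_Ioo.ae_eq_zero_of_integral_contDiff_smul_eq_zero
      ((integrable_L2 g).locallyIntegrable.locallyIntegrableOn _) fun η hη hc hs => ?_
    have := h η hη hc hs
    have h0 : ∫ x, deriv η x • (0 : L2 c d E) x ∂(ivl c d) = 0 := by
      refine integral_eq_zero_of_ae ?_
      filter_upwards [Lp.coeFn_zero E 2 (ivl c d)] with x hx
      rw [hx]
      exact smul_zero _
    rw [h0] at this
    exact neg_eq_zero.1 this.symm
  rw [Lp.eq_zero_iff_ae_eq_zero]
  -- Test functions only see the open interval; the endpoints form a null set.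
  have h2 : ∀ᵐ x ∂(ivl c d), x ∈ Ioo c d := by
    rw [ivl, ← Measure.restrict_congr_set Ioo_ae_eq_Icc]
    exact ae_restrict_mem measurableSet_Ioo
  filter_upwards [h1, h2] with x hx hx2 using hx hx2

/-- Elements are pairs of function and derivative, so this needs the derivative to be determined by
the function. -/
theorem H1.fn_injective [CompleteSpace E] : Function.Injective (H1.fn : H1 c d E →L[ℝ] L2 c d E) := by
  rw [injective_iff_map_eq_zero]
  intro f hf
  have hf' : f.1.1 = 0 := hf
  have h : HasWeakDeriv c d f.1.1 f.1.2 := f.2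
  rw [hf'] at h
  exact Subtype.ext (Prod.ext hf' h.eq_zero)

theorem H2.fn_injective [CompleteSpace E] : Function.Injective (H2.fn : H2 c d E →L[ℝ] L2 c d E) := by
  rw [injective_iff_map_eq_zero]
  intro f hf
  have hf' : f.1.1 = 0 := hf
  have h : HasWeakDeriv c d f.1.1 f.1.2.1 := f.2.1
  have h' : HasWeakDeriv c d f.1.2.1 f.1.2.2 := f.2.2
  rw [hf'] at h
  have h2 := h.eq_zero
  rw [h2] at h'
  exact Subtype.ext (Prod.ext hf' (Prod.ext h2 h'.eq_zero))

/-! #### Completeness of Sobolev spaces -/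

theorem continuous_integral_smul {η : ℝ → ℝ} (hη : Continuous η) (hc : HasCompactSupport η) :
    Continuous fun f : L2 c d E => ∫ x, η x • f x ∂(ivl c d) := by
  obtain ⟨C, hC⟩ := hη.bounded_above_of_compact_support hc
  obtain ⟨D, hD0, hD⟩ := exists_integral_norm_le c d E
  have hC0 : 0 ≤ C := (norm_nonneg _).trans (hC 0)
  let T : L2 c d E →ₗ[ℝ] E :=
    { toFun := fun f => ∫ x, η x • f x ∂(ivl c d)
      map_add' := fun f g => by
        rw [← integral_add (integrable_smul_L2 hη hc f) (integrable_smul_L2 hη hc g)]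
        refine integral_congr_ae ?_
        filter_upwards [Lp.coeFn_add f g] with x hx
        rw [hx]
        exact smul_add _ _ _
      map_smul' := fun r f => by
        rw [RingHom.id_apply, ← integral_smul]
        refine integral_congr_ae ?_
        filter_upwards [Lp.coeFn_smul r f] with x hx
        rw [hx]
        exact smul_comm _ _ _ }
  refine (T.mkContinuousOfExistsBound ⟨C * D, fun f => ?_⟩).continuous
  calc _ ≤ ∫ x, C * ‖f x‖ ∂(ivl c d) := by
        refine norm_integral_le_of_norm_le ((integrable_L2 f).norm.const_mul C)
          (Filter.Eventually.of_forall fun x => ?_)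
        rw [norm_smul]
        gcongr
        exact hC x
    _ = C * ∫ x, ‖f x‖ ∂(ivl c d) := integral_const_mul _ _
    _ ≤ C * (D * ‖f‖) := by gcongr; exact hD f
    _ = _ := (mul_assoc _ _ _).symm

/-- Being a weak derivative is an intersection of equations, one per test function, between
continuous functions of the pair. -/
theorem isClosed_hasWeakDeriv {X : Type} [TopologicalSpace X] {f g : X → L2 c d E}
    (hf : Continuous f) (hg : Continuous g) : IsClosed {x | HasWeakDeriv c d (f x) (g x)} := by
  have h : {x | HasWeakDeriv c d (f x) (g x)} = ⋂ (η : ℝ → ℝ) (_ : ContDiff ℝ (⊤ : ℕ∞) η)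
      (_ : HasCompactSupport η) (_ : tsupport η ⊆ Ioo c d),
      {x | ∫ y, deriv η y • f x y ∂(ivl c d) = - ∫ y, η y • g x y ∂(ivl c d)} := by
    ext x; simp [HasWeakDeriv]
  rw [h]
  refine isClosed_iInter fun η => isClosed_iInter fun hη => isClosed_iInter fun hc =>
    isClosed_iInter fun _ => isClosed_eq ?_ ?_
  · exact (continuous_integral_smul (hη.continuous_deriv (by simp)) hc.deriv).comp hf
  · exact ((continuous_integral_smul hη.continuous hc).comp hg).neg

/-- The delayed PDE states are functions of `s` with values in Sobolev spaces; Bochner integration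
of such functions needs completeness. -/
instance [CompleteSpace E] : CompleteSpace (H1 c d E) := by
  have : IsClosed (H1Graph c d E : Set (L2 c d E × L2 c d E)) :=
    isClosed_hasWeakDeriv continuous_fst continuous_snd
  exact this.completeSpace_coe

instance [CompleteSpace E] : CompleteSpace (H2 c d E) := by
  have : IsClosed (H2Graph c d E : Set (L2 c d E × L2 c d E × L2 c d E)) :=
    (isClosed_hasWeakDeriv continuous_fst (continuous_fst.comp continuous_snd)).inter
      (isClosed_hasWeakDeriv (continuous_fst.comp continuous_snd)
        (continuous_snd.comp continuous_snd))
  exact this.completeSpace_coe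

/-! #### Functions with given derivative -/

/-- `(e, f) ↦ e + ∫_c^x f`, as an element of `L₂`. -/
def primL (c d : ℝ) (E : Type) [NormedAddCommGroup E] [NormedSpace ℝ E] :
    E × L2 c d E →L[ℝ] L2 c d E := (constFn c d).coprod (primitiveL c d E)

theorem primL_ae (p : E × L2 c d E) :
    primL c d E p =ᵐ[ivl c d] fun x => p.1 + ∫ θ in c..x, p.2 θ ∂(ivl c d) := by
  filter_upwards [Lp.coeFn_add (constFn c d p.1) (primitiveL c d E p.2), constFn_ae c d p.1,
    primitiveL_ae p.2] with x h1 h2 h3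
  rw [← h3, ← h2]
  exact h1

theorem hasWeakDeriv_primL [CompleteSpace E] (p : E × L2 c d E) :
    HasWeakDeriv c d (primL c d E p) p.2 :=
  hasWeakDeriv_constFn_add_primitiveL p.1 p.2

/-- The function in `H₁` with given value at `c` and given derivative. -/
def H1.lift (c d : ℝ) (E : Type) [NormedAddCommGroup E] [NormedSpace ℝ E] [CompleteSpace E] :
    E × L2 c d E →L[ℝ] H1 c d E :=
  ((primL c d E).prod (ContinuousLinearMap.snd ℝ _ _)).codRestrict (H1Graph c d E)
    hasWeakDeriv_primL

/-- The function in `H₂` with given value and derivative at `c` and given second derivative. -/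
def H2.lift (c d : ℝ) (E : Type) [NormedAddCommGroup E] [NormedSpace ℝ E] [CompleteSpace E] :
    E × (E × L2 c d E) →L[ℝ] H2 c d E :=
  ((primL c d E ∘L (ContinuousLinearMap.id ℝ E).prodMap (primL c d E)).prod
    ((primL c d E ∘L ContinuousLinearMap.snd ℝ _ _).prod
      (ContinuousLinearMap.snd ℝ _ _ ∘L ContinuousLinearMap.snd ℝ _ _))).codRestrict
        (H2Graph c d E) fun p => ⟨hasWeakDeriv_primL (p.1, primL c d E p.2),
          hasWeakDeriv_primL p.2⟩

/-- Two continuous functions that agree almost everywhere on a nondegenerate interval agree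
everywhere, so the chosen representative does not matter. -/
theorem valueAt_eq {E : Type} [NormedAddCommGroup E] (hcd : c < d) {f : L2 c d E} {f₀ : ℝ → E} (hc : ContinuousOn f₀ (Icc c d))
    (hf : f =ᵐ[ivl c d] f₀) {x : ℝ} (hx : x ∈ Icc c d) : valueAt f x = f₀ x := by
  have h : ∃ f₀ : ℝ → E, ContinuousOn f₀ (Icc c d) ∧ f =ᵐ[ivl c d] f₀ := ⟨f₀, hc, hf⟩
  rw [valueAt, dif_pos h]
  exact Measure.eqOn_Icc_of_ae_eq volume hcd.ne (h.choose_spec.2.symm.trans hf)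
    h.choose_spec.1 hc hx

theorem valueAt_primL (hcd : c < d) (p : E × L2 c d E) {x : ℝ} (hx : x ∈ Icc c d) :
    valueAt (primL c d E p) x = p.1 + ∫ θ in c..x, p.2 θ ∂(ivl c d) :=
  valueAt_eq hcd (continuous_const.add (intervalIntegral.continuous_primitive
    (fun _ _ => (integrable_L2 p.2).intervalIntegrable) c)).continuousOn (primL_ae p) hx

theorem valueAt_primL_left (hcd : c < d) (p : E × L2 c d E) :
    valueAt (primL c d E p) c = p.1 := by
  rw [valueAt_primL hcd p (left_mem_Icc.2 hcd.le), intervalIntegral.integral_same, add_zero]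

theorem valueAt_primL_right (hcd : c < d) (p : E × L2 c d E) :
    valueAt (primL c d E p) d = p.1 + integralL c d E p.2 := by
  rw [valueAt_primL hcd p (right_mem_Icc.2 hcd.le), primitive_right hcd.le]
  rfl

/-- Bounded operators commute with partial integrals. -/
theorem onValues_primL [CompleteSpace E] [CompleteSpace F] (L : E →L[ℝ] F) (p : E × L2 c d E) :
    onValues c d L (primL c d E p) = primL c d F (L p.1, onValues c d L p.2) := by
  refine Lp.ext ?_
  filter_upwards [L.coeFn_compLpL (primL c d E p), primL_ae p,
    primL_ae (L p.1, onValues c d L p.2)] with x h1 h2 h3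
  rw [h3]
  refine h1.trans ?_
  rw [h2, map_add, ← L.intervalIntegral_comp_comm (integrable_L2 p.2).intervalIntegrable]
  congr 1
  refine intervalIntegral.integral_congr_ae ?_
  filter_upwards [L.coeFn_compLpL p.2] with θ hθ _
  exact hθ.symm

theorem onValues_injective (L : E →L[ℝ] F) (hL : Function.Injective L) :
    Function.Injective (onValues c d L) := by
  intro f g hfg
  refine Lp.ext ?_
  have h := L.coeFn_compLpL (p := 2) (μ := ivl c d) g
  have h' : (onValues c d L f : ℝ → F) =ᵐ[ivl c d] fun x => L (g x) := by rw [hfg]; exact h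
  filter_upwards [L.coeFn_compLpL (p := 2) (μ := ivl c d) f, h'] with x h1 h2
  exact hL (h1.symm.trans h2)

theorem onValues_comp_apply {G : Type} [NormedAddCommGroup G] [NormedSpace ℝ G] (L : F →L[ℝ] G)
    (M : E →L[ℝ] F) (f : L2 c d E) : onValues c d L (onValues c d M f) = onValues c d (L ∘L M) f := by
  refine Lp.ext ?_
  filter_upwards [L.coeFn_compLpL (p := 2) (μ := ivl c d) (onValues c d M f),
    M.coeFn_compLpL (p := 2) (μ := ivl c d) f, (L ∘L M).coeFn_compLpL (p := 2) (μ := ivl c d) f]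
    with x h1 h2 h3
  exact h1.trans ((congrArg L h2).trans h3.symm)

theorem onValues_id_apply (f : L2 c d E) : onValues c d (ContinuousLinearMap.id ℝ E) f = f :=
  Lp.ext ((ContinuousLinearMap.id ℝ E).coeFn_compLpL (p := 2) (μ := ivl c d) f)

/-- The primitive of a primitive. -/
theorem primitiveL_primitiveL_ae [CompleteSpace E] (f : L2 c d E) :
    ∀ᵐ x ∂(ivl c d), primitiveL c d E (primitiveL c d E f) x = ∫ θ in Icc c x, (x - θ) • f θ := by
  filter_upwards [primitiveL_ae (primitiveL c d E f), ae_mem_ivl c d] with x h1 hx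
  rw [h1, primitive_eq_setIntegral hx]
  have hsub : Icc c x ⊆ Icc c d := Icc_subset_Icc_right hx.2
  -- The exchange of integrals is applied on the shorter interval `[c, x]` with weight 1; the inner
  -- integral is then the length `x - θ`.
  have hf : Integrable f (ivl c x) := IntegrableOn.mono_set (integrable_L2 f) hsub
  calc _ = ∫ y, (1 : ℝ) • (∫ θ in c..y, f θ ∂(ivl c x)) ∂(ivl c x) := by
        refine integral_congr_ae ?_
        filter_upwards [ae_restrict_of_ae_restrict_of_subset hsub (primitiveL_ae f),
          ae_mem_ivl c x] with y hy hyx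
        rw [hy, one_smul, primitive_eq_setIntegral hyx, primitive_eq_setIntegral (hsub hyx)]
    _ = ∫ θ, (∫ y in Icc θ x, (1 : ℝ)) • f θ ∂(ivl c x) :=
        integral_smul_primitive (integrable_const _) hf
    _ = _ := by
        refine integral_congr_ae ?_
        filter_upwards [ae_mem_ivl c x] with θ hθ
        simp [hθ.2]

end CalculusLemmas

/-! ### Pairing of functions, and operators acting on values. -/

section Values

variable {c d : ℝ} {E F : Type} [NormedAddCommGroup E] [NormedSpace ℝ E]
  [NormedAddCommGroup F] [NormedSpace ℝ F]

theorem onValues_zero_apply (f : L2 c d E) : onValues c d (0 : E →L[ℝ] F) f = 0 := by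
  refine Lp.ext ?_
  filter_upwards [(0 : E →L[ℝ] F).coeFn_compLpL (p := 2) (μ := ivl c d) f,
    Lp.coeFn_zero F 2 (ivl c d)] with x h1 h2
  exact h1.trans h2.symm

theorem onValues_fst_pairL (p : L2 c d E × L2 c d F) :
    onValues c d (ContinuousLinearMap.fst ℝ E F) (pairL c d E F p) = p.1 := by
  have h : pairL c d E F p = onValues c d (ContinuousLinearMap.inl ℝ E F) p.1
    + onValues c d (ContinuousLinearMap.inr ℝ E F) p.2 := rfl
  rw [h, map_add, onValues_comp_apply, onValues_comp_apply, ContinuousLinearMap.fst_comp_inl,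
    ContinuousLinearMap.fst_comp_inr, onValues_id_apply, onValues_zero_apply, add_zero]

theorem onValues_snd_pairL (p : L2 c d E × L2 c d F) :
    onValues c d (ContinuousLinearMap.snd ℝ E F) (pairL c d E F p) = p.2 := by
  have h : pairL c d E F p = onValues c d (ContinuousLinearMap.inl ℝ E F) p.1
    + onValues c d (ContinuousLinearMap.inr ℝ E F) p.2 := rfl
  rw [h, map_add, onValues_comp_apply, onValues_comp_apply, ContinuousLinearMap.snd_comp_inl,
    ContinuousLinearMap.snd_comp_inr, onValues_id_apply, onValues_zero_apply, zero_add]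

theorem pairL_injective : Function.Injective (pairL c d E F) := fun p q h =>
  Prod.ext (by rw [← onValues_fst_pairL p, h, onValues_fst_pairL])
    (by rw [← onValues_snd_pairL p, h, onValues_snd_pairL])

/-- With the two projection lemmas this makes `pairL` an isomorphism, so functions with product
values can be compared by components. -/
theorem pairL_onValues (f : L2 c d (E × F)) :
    pairL c d E F (onValues c d (ContinuousLinearMap.fst ℝ E F) f,
      onValues c d (ContinuousLinearMap.snd ℝ E F) f) = f := by
  have h : ∀ p, pairL c d E F p = onValues c d (ContinuousLinearMap.inl ℝ E F) p.1
    + onValues c d (ContinuousLinearMap.inr ℝ E F) p.2 := fun _ => rfl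
  rw [h, onValues_comp_apply, onValues_comp_apply]
  refine Lp.ext ?_
  filter_upwards [Lp.coeFn_add
      (onValues c d (ContinuousLinearMap.inl ℝ E F ∘L ContinuousLinearMap.fst ℝ E F) f)
      (onValues c d (ContinuousLinearMap.inr ℝ E F ∘L ContinuousLinearMap.snd ℝ E F) f),
    (ContinuousLinearMap.inl ℝ E F ∘L ContinuousLinearMap.fst ℝ E F).coeFn_compLpL
      (p := 2) (μ := ivl c d) f,
    (ContinuousLinearMap.inr ℝ E F ∘L ContinuousLinearMap.snd ℝ E F).coeFn_compLpL
      (p := 2) (μ := ivl c d) f] with x h1 h2 h3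
  refine h1.trans ?_
  rw [Pi.add_apply]
  refine (congrArg₂ (· + ·) h2 h3).trans ?_
  simp

theorem integralL_onValues [CompleteSpace E] [CompleteSpace F] (L : E →L[ℝ] F) (f : L2 c d E) :
    integralL c d F (onValues c d L f) = L (integralL c d E f) := by
  refine (integral_congr_ae (L.coeFn_compLpL (p := 2) (μ := ivl c d) f)).trans ?_
  exact L.integral_comp_comm (integrable_L2 f)

end Values

/-! ### Reconstruction of the PDE state from its fundamental state. -/

section Reconstruction

variable {a b : ℝ} {n : ℕ × ℕ × ℕ} {nz K : ℕ}

/-- The function `u` with `(u₁, ∂u₂, ∂²u₃) = v` and `(u₂, u₃, ∂u₃)(a) = c`. -/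
def uLift (a b : ℝ) (n : ℕ × ℕ × ℕ) : EBc n × XP a b n →L[ℝ] USpace a b n :=
  let c := ContinuousLinearMap.fst ℝ (EBc n) (XP a b n)
  let v := ContinuousLinearMap.snd ℝ (EBc n) (XP a b n)
  (onValues a b (ContinuousLinearMap.fst ℝ _ _) ∘L v).prod
    ((H1.lift a b (Vec n.2.1) ∘L (ContinuousLinearMap.fst ℝ _ _ ∘L c).prod
      (onValues a b (ContinuousLinearMap.fst ℝ _ _ ∘L ContinuousLinearMap.snd ℝ _ _) ∘L v)).prod
    (H2.lift a b (Vec n.2.2) ∘L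
      (ContinuousLinearMap.fst ℝ _ _ ∘L ContinuousLinearMap.snd ℝ _ _ ∘L c).prod
      ((ContinuousLinearMap.snd ℝ _ _ ∘L ContinuousLinearMap.snd ℝ _ _ ∘L c).prod
      (onValues a b (ContinuousLinearMap.snd ℝ _ _ ∘L ContinuousLinearMap.snd ℝ _ _) ∘L v))))

/-- `u ↦ (u₁, ∂u₂, ∂²u₃)`. -/
def USpace.fund (a b : ℝ) (n : ℕ × ℕ × ℕ) : USpace a b n →L[ℝ] XP a b n :=
  pairL a b _ _ ∘L (ContinuousLinearMap.id ℝ _).prodMap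
    (pairL a b _ _ ∘L H1.der.prodMap H2.der2)

theorem USpace.fund_uLift (p : EBc n × XP a b n) : USpace.fund a b n (uLift a b n p) = p.2 := by
  have h : USpace.fund a b n (uLift a b n p) = pairL a b _ _
      (onValues a b (ContinuousLinearMap.fst ℝ _ _) p.2, pairL a b _ _
        (onValues a b (ContinuousLinearMap.fst ℝ _ _ ∘L ContinuousLinearMap.snd ℝ _ _) p.2,
         onValues a b (ContinuousLinearMap.snd ℝ _ _ ∘L ContinuousLinearMap.snd ℝ _ _) p.2)) := rfl
  rw [h, ← onValues_comp_apply, ← onValues_comp_apply, pairL_onValues, pairL_onValues]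

theorem Dint_uLift (p : EBc n × XP a b n) : Dint (uLift a b n p) = recInt a b n p := rfl

/-- Every component subject to boundary evaluation is of the form `e + ∫_a^x f`, whose continuous
representative is explicit. -/
theorem Dbc_uLift (hab : a < b) (p : EBc n × XP a b n) :
    (Dbc (uLift a b n p) a, Dbc (uLift a b n p) b) = recBf a b n p := by
  refine Prod.ext (Prod.ext ?_ (Prod.ext ?_ ?_)) (Prod.ext ?_ (Prod.ext ?_ ?_))
  · exact valueAt_primL_left hab _
  · exact valueAt_primL_left hab _
  · exact valueAt_primL_left hab _
  · exact valueAt_primL_right hab _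
  · exact valueAt_primL_right hab _
  · exact valueAt_primL_right hab _

/-- Point evaluation through representatives is thereby replaced by the bounded operator `recSig`.
-/
theorem sig_uLift (hab : a < b) (c : EBc n) (v : XP a b n) (z : Vec nz) :
    sig (uLift a b n (c, v)) z = recSig a b n nz (c, (v, z)) := by
  have h : recSig a b n nz (c, (v, z)) = (recInt a b n (c, v), recBf a b n (c, v), z) := rfl
  rw [h, ← Dbc_uLift hab, ← Dint_uLift]
  rfl

theorem USpace.incl_injective : Function.Injective (USpace.incl a b n) := by
  intro u v h
  have h1 := pairL_injective h
  have h2 := pairL_injective (Prod.ext_iff.1 h1).2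
  exact Prod.ext (Prod.ext_iff.1 h1).1
    (Prod.ext (H1.fn_injective (Prod.ext_iff.1 h2).1) (H2.fn_injective (Prod.ext_iff.1 h2).2))

/-- The function component is rebuilt from its first three parts, which are then read off the nested
pairing that defines `Dint`. -/
theorem Tq_sig (u : USpace a b n) (z : Vec nz) :
    Tq a b n nz (sig u z) = (USpace.incl a b n u, z) := by
  refine Prod.ext ?_ rfl
  change onValues a b _ (Dint u) = _
  rw [← pairL_onValues (onValues a b _ (Dint u)), onValues_comp_apply, onValues_comp_apply,
    ← pairL_onValues (onValues a b (ContinuousLinearMap.snd ℝ _ _ ∘L _) (Dint u)),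
    onValues_comp_apply, onValues_comp_apply]
  change pairL a b _ _ (onValues a b (ContinuousLinearMap.fst ℝ _ _) (Dint u),
    pairL a b _ _
     (onValues a b (ContinuousLinearMap.fst ℝ _ _ ∘L ContinuousLinearMap.snd ℝ _ _) (Dint u),
      onValues a b (ContinuousLinearMap.fst ℝ _ _ ∘L (ContinuousLinearMap.snd ℝ _ _ ∘L
        ContinuousLinearMap.snd ℝ _ _)) (Dint u))) = _
  rw [← onValues_comp_apply, ← onValues_comp_apply, ← onValues_comp_apply, Dint,
    onValues_fst_pairL, onValues_snd_pairL, onValues_fst_pairL, onValues_snd_pairL,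
    onValues_fst_pairL]
  rfl

/-- `(v, z) ↦ (𝒯 v + 𝒯_z z, z)`, with values in the Sobolev space. -/
def BcParams.lift (E : BcParams a b n nz) : XP a b n × Vec nz →L[ℝ] USpace a b n × Vec nz :=
  (uLift a b n ∘L E.core.prod (ContinuousLinearMap.fst ℝ _ _)).prod (ContinuousLinearMap.snd ℝ _ _)

theorem BcParams.sig_lift (E : BcParams a b n nz) (hab : a < b) (p : XP a b n × Vec nz) :
    sig (E.lift p).1 (E.lift p).2 = E.full p :=
  sig_uLift hab _ _ _

/-- The inclusion `(u, z) ↦ (u, z)` of Sobolev functions in `L₂`. -/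
abbrev inclZ (a b : ℝ) (n : ℕ × ℕ × ℕ) (nz : ℕ) : USpace a b n × Vec nz →L[ℝ] XP a b n × Vec nz :=
  (USpace.incl a b n).prodMap (ContinuousLinearMap.id ℝ (Vec nz))

/-- `(u, z) ↦ ((u₁, ∂u₂, ∂²u₃), z)`. -/
abbrev fundZ (a b : ℝ) (n : ℕ × ℕ × ℕ) (nz : ℕ) : USpace a b n × Vec nz →L[ℝ] XP a b n × Vec nz :=
  (USpace.fund a b n).prodMap (ContinuousLinearMap.id ℝ (Vec nz))

theorem BcParams.incl_lift (E : BcParams a b n nz) (hab : a < b) (p : XP a b n × Vec nz) :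
    inclZ a b n nz (E.lift p) = E.state p := by
  have h : E.state p = Tq a b n nz (E.full p) := rfl
  rw [h, ← E.sig_lift hab, Tq_sig]
  rfl

theorem BcParams.fund_lift (E : BcParams a b n nz) (p : XP a b n × Vec nz) :
    fundZ a b n nz (E.lift p) = p :=
  Prod.ext (USpace.fund_uLift _) rfl

/-- The boundary residual splits into the part due to `c` and the part due to `(v, z)`; `core` is
the value of `c` for which the two cancel. -/
theorem BcParams.op_full {E : BcParams a b n nz} (hE : E.WellPosed) (p : XP a b n × Vec nz) :
    E.op (E.full p) = 0 := by
  have h1 : E.full p = recSig a b n nz (ContinuousLinearMap.inl ℝ _ _ (E.core p)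
      + ContinuousLinearMap.inr ℝ _ _ p) := by
    simp [BcParams.full]
  have h2 : E.op (recSig a b n nz (ContinuousLinearMap.inl ℝ _ _ (E.core p)))
      = E.matrix (E.core p) := rfl
  have h3 : E.core p
      = - E.matrix.inverse (E.op (recSig a b n nz (ContinuousLinearMap.inr ℝ _ _ p))) := rfl
  rw [h1, map_add, map_add, h2, h3, map_neg]
  -- Without invertibility `inverse` would take its default value 0 and nothing would cancel.
  obtain ⟨e, he⟩ := hE
  rw [← he, ContinuousLinearMap.inverse_equiv]
  simp

theorem inclZ_injective : Function.Injective (inclZ a b n nz) :=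
  USpace.incl_injective.prodMap Function.injective_id

theorem eachL_injective {E F : Type} [NormedAddCommGroup E] [NormedSpace ℝ E]
    [NormedAddCommGroup F] [NormedSpace ℝ F] (L : E →L[ℝ] F) (hL : Function.Injective L) :
    Function.Injective (eachL K L) :=
  fun _ _ h => funext fun j => hL (congrFun h j)

end Reconstruction

/-! ### The transport equations in the delay variable. -/

section Transport

variable {c d : ℝ} {E F : Type} [NormedAddCommGroup E] [NormedSpace ℝ E]
  [NormedAddCommGroup F] [NormedSpace ℝ F] {K : ℕ}

/-- A bounded operator applied to a continuous representative is again a continuous representative.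
-/
theorem valueAt_onValues_primL (hcd : c < d) (L : E →L[ℝ] F) (p : E × L2 c d E) {x : ℝ}
    (hx : x ∈ Icc c d) : valueAt (onValues c d L (primL c d E p)) x
      = L (p.1 + ∫ θ in c..x, p.2 θ ∂(ivl c d)) := by
  refine valueAt_eq hcd (f₀ := fun x => L (p.1 + ∫ θ in c..x, p.2 θ ∂(ivl c d))) ?_ ?_ hx
  · exact (L.continuous.comp (continuous_const.add (intervalIntegral.continuous_primitive
      (fun _ _ => (integrable_L2 p.2).intervalIntegrable) c))).continuousOn
  · filter_upwards [L.coeFn_compLpL (p := 2) (μ := ivl c d) (primL c d E p), primL_ae p]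
      with x h1 h2
    exact h1.trans (congrArg L h2)

/-- Passes between the transport equations as one equation in `L₂` (the PIE) and as pointwise
equations (the delayed system). -/
theorem eq_delayScale_iff (τ : Fin K → ℝ) (f g : L2 c d (Fin K → E)) :
    g = onValues c d (delayScale τ) f ↔
      ∀ᵐ s ∂(ivl c d), ∀ j, g s j = (-(1 / τ j)) • f s j := by
  have h := (delayScale (E := E) τ).coeFn_compLpL (p := 2) (μ := ivl c d) f
  constructor
  · intro hg
    rw [hg]
    filter_upwards [h] with s hs j
    exact congrFun hs j
  · intro hg
    refine Lp.ext ?_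
    filter_upwards [h, hg] with s hs hg
    exact (funext hg).trans hs.symm

theorem delayScale_comp_eachL (τ : Fin K → ℝ) (L : E →L[ℝ] F) :
    delayScale τ ∘L eachL K L = eachL K L ∘L delayScale τ := by
  ext f j
  simp [delayScale, eachL]

end Transport

/-! ### Solutions of the delayed ODE and of its PIE. -/

section DdeSolution

variable {nu nw nz K : ℕ}

/-- `(u, ψ) ↦ (u, u + ∫₀^s ψ)`, with values in the Sobolev space. -/
def ddeLift (nu K : ℕ) : DdeState nu K →L[ℝ] Vec nu × H1 0 1 (Fin K → Vec nu) :=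
  (ContinuousLinearMap.fst ℝ _ _).prod (H1.lift 0 1 (Fin K → Vec nu) ∘L
    ((ContinuousLinearMap.pi fun _ => ContinuousLinearMap.fst ℝ _ _).prod
      (ContinuousLinearMap.snd ℝ _ _)))

/-- The inclusion `(u, φ) ↦ (u, φ)` of `ℝⁿ × H₁` in `ℝⁿ × L₂`. -/
def ddeIncl (nu K : ℕ) : Vec nu × H1 0 1 (Fin K → Vec nu) →L[ℝ] DdeState nu K :=
  (ContinuousLinearMap.id ℝ _).prodMap H1.fn

/-- `(u, φ) ↦ (u, ∂_s φ)`. -/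
def ddeFund (nu K : ℕ) : Vec nu × H1 0 1 (Fin K → Vec nu) →L[ℝ] DdeState nu K :=
  (ContinuousLinearMap.id ℝ _).prodMap H1.der

theorem ddeFund_ddeLift (y : DdeState nu K) : ddeFund nu K (ddeLift nu K y) = y := rfl

/-- The factorization through the Sobolev space: differentiability passes from `y` to the delayed
state along the lift, and back along `ddeFund`. -/
theorem ddePie_T_apply (G : DdeParams nu nw nz K) (τ : Fin K → ℝ) (y : DdeState nu K) :
    (ddePie G τ).T y = ddeIncl nu K (ddeLift nu K y) := rfl

theorem ddeIncl_injective : Function.Injective (ddeIncl nu K) :=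
  Function.injective_id.prodMap H1.fn_injective

theorem valueAt_ddeLift_zero (y : DdeState nu K) (j : Fin K) :
    valueAt (H1.fn (ddeLift nu K y).2) 0 j = y.1 :=
  congrFun (valueAt_primL_left (c := 0) (d := 1) zero_lt_one _) j

theorem valueAt_ddeLift_one (y : DdeState nu K) :
    valueAt (H1.fn (ddeLift nu K y).2) 1 = ddeEnd nu K y :=
  valueAt_primL_right (c := 0) (d := 1) zero_lt_one _

theorem ddePie_A_add_B (G : DdeParams nu nw nz K) (τ : Fin K → ℝ) (y : DdeState nu K)
    (w : Vec nw) : (ddePie G τ).A y + (ddePie G τ).B w =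
      (G.A y.1 + G.Arow (ddeEnd nu K y) + G.Bw w, onValues 0 1 (delayScale τ) y.2) :=
  Prod.ext rfl (add_zero _)

/-- The lift of `y` is the required Sobolev state. It is bounded, so its derivative is the lift of
`y'`, and the two components of the PIE are the ODE and the transport equations. -/
theorem isDdeSolution_of_pie {G : DdeParams nu nw nz K} {τ : Fin K → ℝ} {w : ℝ → Vec nw}
    {y : ℝ → DdeState nu K}
    (h : ∀ t, 0 ≤ t → ∃ y', HasDerivWithinAt y y' (Ici 0) t ∧
      (ddePie G τ).T y' = (ddePie G τ).A (y t) + (ddePie G τ).B (w t)) :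
    IsDdeSolution G τ ((ddePie G τ).T (y 0)) w (fun t => (ddePie G τ).T (y t))
      (fun t => (ddePie G τ).C (y t)) := by
  refine ⟨rfl, fun t => (ddeLift nu K (y t)).1, fun t => (ddeLift nu K (y t)).2, fun t ht => ?_⟩
  obtain ⟨y', hy', he⟩ := h t ht
  have hd := (ddeLift nu K).hasFDerivAt.comp_hasDerivWithinAt t hy'
  rw [ddePie_A_add_B] at he
  refine ⟨rfl, valueAt_ddeLift_zero _, (ddeLift nu K y').1, (ddeLift nu K y').2,
    hd.fst, hd.snd, ?_, ?_, ?_⟩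
  · rw [valueAt_ddeLift_one]
    exact (Prod.ext_iff.1 he).1
  · rw [valueAt_ddeLift_one]
    rfl
  · exact (eq_delayScale_iff τ _ _).1 (Prod.ext_iff.1 he).2

theorem pie_of_isDdeSolution {G : DdeParams nu nw nz K} {τ : Fin K → ℝ} {w : ℝ → Vec nw}
    {y : ℝ → DdeState nu K} {x₀ : DdeState nu K} {z : ℝ → Vec nz}
    (h : IsDdeSolution G τ x₀ w (fun t => (ddePie G τ).T (y t)) z) :
    (ddePie G τ).T (y 0) = x₀ ∧ ∀ t, 0 ≤ t → z t = (ddePie G τ).C (y t) ∧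
      ∃ y', HasDerivWithinAt y y' (Ici 0) t ∧
        (ddePie G τ).T y' = (ddePie G τ).A (y t) + (ddePie G τ).B (w t) := by
  obtain ⟨h0, u, φ, h⟩ := h
  -- Both sides have the same image `T (y t)` in `L₂`.
  have hl : ∀ t, 0 ≤ t → (u t, φ t) = ddeLift nu K (y t) := fun t ht =>
    ddeIncl_injective (h t ht).1.symm
  refine ⟨h0, fun t ht => ?_⟩
  obtain ⟨hx, -, u', φ', hu, hφ, e1, e2, e3⟩ := h t ht
  have hφt : φ t = (ddeLift nu K (y t)).2 := congrArg Prod.snd (hl t ht)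
  have hut : u t = (y t).1 := congrArg Prod.fst (hl t ht)
  rw [hφt, valueAt_ddeLift_one, hut] at e1 e2
  have hprod : HasDerivWithinAt (fun t => (u t, φ t)) (u', φ') (Ici 0) t := hu.prodMk hφ
  -- On `[0, ∞)` the function `y` is `ddeFund` of the Sobolev state, hence differentiable in `L₂`.
  have hy : HasDerivWithinAt y (ddeFund nu K (u', φ')) (Ici 0) t := by
    refine ((ddeFund nu K).hasFDerivAt.comp_hasDerivWithinAt t hprod).congr
      (fun s hs => ?_) ?_
    · simp only [Function.comp_apply]
      rw [hl s hs, ddeFund_ddeLift]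
    · simp only [Function.comp_apply]
      rw [hl t ht, ddeFund_ddeLift]
  refine ⟨e2, _, hy, ?_⟩
  have hT : HasDerivWithinAt (fun t => (ddePie G τ).T (y t)) (ddeIncl nu K (u', φ')) (Ici 0) t :=
    ((ddeIncl nu K).hasFDerivAt.comp_hasDerivWithinAt t hprod).congr
      (fun s hs => by rw [Function.comp_apply, hl s hs, ddePie_T_apply])
      (by rw [Function.comp_apply, hl t ht, ddePie_T_apply])
  -- The derivative of `T y` is computed once through `y` and once through the Sobolev state;
  -- derivatives within `[0, ∞)` are unique.
  rw [(uniqueDiffOn_Ici (0 : ℝ) t ht).eq_deriv _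
    ((ddePie G τ).T.hasFDerivAt.comp_hasDerivWithinAt t hy) hT, ddePie_A_add_B]
  refine Prod.ext e1 ?_
  rw [hφt] at e3
  exact (eq_delayScale_iff τ _ _).2 e3

end DdeSolution

/-! ### Solutions of the delayed PDE and of its PIE. -/

section DpdeSolution

variable {a b : ℝ} {n : ℕ × ℕ × ℕ} {nw nz K : ℕ}

/-- The states `(u, φ)` of the delayed PDE with fundamental state `(v, ψ)` and input `z`, with values
in Sobolev spaces. -/
def dpdeLift (E : BcParams a b n nz) (K : ℕ) :
    DpdeState a b n nz K × Vec nz →L[ℝ] USpace a b n × DelaySpace a b n nz K :=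
  let vz := (ContinuousLinearMap.fst ℝ (XP a b n) _ ∘L
    ContinuousLinearMap.fst ℝ (DpdeState a b n nz K) (Vec nz)).prod (ContinuousLinearMap.snd ℝ _ _)
  (ContinuousLinearMap.fst ℝ _ _ ∘L E.lift ∘L vz).prod
    (H1.lift 0 1 (Fin K → USpace a b n × Vec nz) ∘L
      (ContinuousLinearMap.pi fun _ => E.lift ∘L vz).prod
      (onValues 0 1 (eachL K E.lift) ∘L ContinuousLinearMap.snd ℝ _ _ ∘L
        ContinuousLinearMap.fst ℝ _ _))

/-- The inclusion of the states of the delayed PDE in `L₂`. -/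
def dpdeIncl (a b : ℝ) (n : ℕ × ℕ × ℕ) (nz K : ℕ) :
    USpace a b n × DelaySpace a b n nz K →L[ℝ] DpdeState a b n nz K :=
  (USpace.incl a b n).prodMap (onValues 0 1 (eachL K (inclZ a b n nz)) ∘L H1.fn)

/-- The fundamental state of a state of the delayed PDE. -/
def dpdeFund (a b : ℝ) (n : ℕ × ℕ × ℕ) (nz K : ℕ) :
    USpace a b n × DelaySpace a b n nz K →L[ℝ] DpdeState a b n nz K :=
  (USpace.fund a b n).prodMap (onValues 0 1 (eachL K (fundZ a b n nz)) ∘L H1.der)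

theorem onValues_eachL_injective {E F : Type} [NormedAddCommGroup E] [NormedSpace ℝ E]
    [NormedAddCommGroup F] [NormedSpace ℝ F] {c d : ℝ} {L : E →L[ℝ] F}
    (hL : Function.Injective L) : Function.Injective (onValues c d (eachL K L)) :=
  onValues_injective _ (eachL_injective L hL)

theorem dpdeIncl_injective : Function.Injective (dpdeIncl a b n nz K) :=
  USpace.incl_injective.prodMap
    ((onValues_eachL_injective inclZ_injective).comp H1.fn_injective)

theorem BcParams.eachL_fund_lift (E : BcParams a b n nz) :
    eachL K (fundZ a b n nz) ∘L eachL K E.lift = ContinuousLinearMap.id ℝ _ :=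
  ContinuousLinearMap.ext fun f => funext fun j => E.fund_lift (f j)

theorem BcParams.eachL_incl_lift (E : BcParams a b n nz) (hab : a < b) :
    eachL K (inclZ a b n nz) ∘L eachL K E.lift = eachL K E.state :=
  ContinuousLinearMap.ext fun f => funext fun j => E.incl_lift hab (f j)

theorem dpdeFund_dpdeLift (E : BcParams a b n nz) (p : DpdeState a b n nz K × Vec nz) :
    dpdeFund a b n nz K (dpdeLift E K p) = p.1 := by
  refine Prod.ext (USpace.fund_uLift _) ?_
  change onValues 0 1 (eachL K (fundZ a b n nz)) (onValues 0 1 (eachL K E.lift) p.1.2) = p.1.2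
  rw [onValues_comp_apply, E.eachL_fund_lift, onValues_id_apply]

/-- The delayed values `rⱼ`. -/
def dpdeEnd (E : BcParams a b n nz) (K : ℕ) (x : DpdeState a b n nz K) (z : Vec nz) :
    Fin K → Sig a b n nz :=
  fun j => E.full ((x.1, z) + integralL 0 1 (Fin K → XP a b n × Vec nz) x.2 j)

/-- The PDE counterpart of the factorization `ddePie_T_apply`. The input takes part in it, because
the reconstruction depends on `z` through the boundary conditions. -/
theorem dpdePie_T_add_Tw (P : PddeParams a b n nw nz K) (E : BcParams a b n nz) (hab : a < b)
    (τ : Fin K → ℝ) (x : DpdeState a b n nz K) (z : Vec nz) :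
    (dpdePie P E τ).T x + (dpdePie P E τ).Tw z
      = dpdeIncl a b n nz K (dpdeLift E K (x, z)) := by
  obtain ⟨v, ψ⟩ := x
  -- The operators with and without subscript are the restrictions of one operator on pairs `(v, z)`
  -- to its two summands.
  have hvz : ((v, z) : XP a b n × Vec nz) = (v, 0) + (0, z) := by simp
  refine Prod.ext ?_ ?_
  · have h1 : (dpdeIncl a b n nz K (dpdeLift E K ((v, ψ), z))).1 = (E.state (v, z)).1 :=
      congrArg Prod.fst (E.incl_lift hab (v, z))
    rw [h1, hvz, map_add]
    change ((E.state (v, 0)).1 + 0 + 0) + ((E.state (0, z)).1 + 0) = _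
    rw [add_zero, add_zero, add_zero]
    rfl
  -- The delayed state starts at the lift of `(v, z)`, and the inclusion commutes with integration
  -- in `s`.
  · change _ = onValues 0 1 (eachL K (inclZ a b n nz)) (primL 0 1 _ (fun _ => E.lift (v, z),
      onValues 0 1 (eachL K E.lift) ψ))
    rw [onValues_primL, onValues_comp_apply, E.eachL_incl_lift hab]
    have h1 : eachL K (inclZ a b n nz) (fun _ => E.lift (v, z)) = fun _ => E.state (v, z) :=
      funext fun _ => E.incl_lift hab (v, z)
    rw [h1, hvz, map_add]
    change (constFn 0 1 (fun _ => E.state (v, 0))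
      + primitiveL 0 1 _ (onValues 0 1 (eachL K E.state) ψ)) + constFn 0 1 (fun _ => E.state (0, z))
      = constFn 0 1 ((fun _ => E.state (v, 0)) + fun _ => E.state (0, z))
        + primitiveL 0 1 _ (onValues 0 1 (eachL K E.state) ψ)
    rw [map_add, add_right_comm]

theorem dpdeEnd_eq (E : BcParams a b n nz) (x : DpdeState a b n nz K) (z : Vec nz) :
    dpdeEnd E K x z = (fun _ => E.full (x.1, z))
      + integralL 0 1 _ (onValues 0 1 (eachL K E.full) x.2) := by
  rw [integralL_onValues (eachL K E.full) x.2]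
  funext j
  exact map_add E.full _ _

/-- The feedthrough of the transport PIE adds `q` to every delayed signal; regrouping by linearity
collects `v`, `z` and the integral of `ψ` into `dpdeEnd`. -/
theorem dpdePie_fst_A_add_B (P : PddeParams a b n nw nz K) (E : BcParams a b n nz)
    (τ : Fin K → ℝ) (x : DpdeState a b n nz K) (z : Vec nz) :
    (dpdePie P E τ).A x + (dpdePie P E τ).B z
      = ((P.now.op (E.full (x.1, z)) + P.delOp (dpdeEnd E K x z)).1,
        onValues 0 1 (delayScale τ) (onValues 0 1 (eachL K E.state) x.2)) := by
  obtain ⟨v, ψ⟩ := x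
  have hvz : ((v, z) : XP a b n × Vec nz) = (v, 0) + (0, z) := by simp
  refine Prod.ext ?_ ?_
  · rw [dpdeEnd_eq, hvz, map_add]
    have h2 : (fun _ : Fin K => E.full (v, 0) + E.full (0, z))
      = (fun _ => E.full (v, 0)) + fun _ => E.full (0, z) := rfl
    rw [h2, map_add, map_add, map_add]
    change (P.now.op (E.full (v, 0))).1 + (P.delOp (fun _ => E.full (v, 0))).1
        + (P.delOp (integralL 0 1 _ (onValues 0 1 (eachL K E.full) ψ))).1
      + ((P.now.op (E.full (0, z))).1 + (P.delOp (fun _ => E.full (0, z))).1)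
      = ((P.now.op (E.full (v, 0))).1 + (P.now.op (E.full (0, z))).1)
        + ((P.delOp (fun _ => E.full (v, 0))).1 + (P.delOp (fun _ => E.full (0, z))).1
          + (P.delOp (integralL 0 1 _ (onValues 0 1 (eachL K E.full) ψ))).1)
    abel
  · change (0 + onValues 0 1 (delayScale τ) (onValues 0 1 (eachL K E.state) ψ)) + 0 = _
    rw [zero_add, add_zero]

theorem dpdePie_C_add_D (P : PddeParams a b n nw nz K) (E : BcParams a b n nz)
    (τ : Fin K → ℝ) (x : DpdeState a b n nz K) (z : Vec nz) :
    (dpdePie P E τ).C x + (dpdePie P E τ).D z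
      = (P.now.op (E.full (x.1, z)) + P.delOp (dpdeEnd E K x z)).2 := by
  obtain ⟨v, ψ⟩ := x
  have hvz : ((v, z) : XP a b n × Vec nz) = (v, 0) + (0, z) := by simp
  rw [dpdeEnd_eq, hvz, map_add]
  have h2 : (fun _ : Fin K => E.full (v, 0) + E.full (0, z))
    = (fun _ => E.full (v, 0)) + fun _ => E.full (0, z) := rfl
  rw [h2, map_add, map_add, map_add]
  change (P.now.op (E.full (v, 0))).2 + (P.delOp (fun _ => E.full (v, 0))).2
      + (P.delOp (integralL 0 1 _ (onValues 0 1 (eachL K E.full) ψ))).2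
    + ((P.now.op (E.full (0, z))).2 + (P.delOp (fun _ => E.full (0, z))).2)
    = ((P.now.op (E.full (v, 0))).2 + (P.now.op (E.full (0, z))).2)
      + ((P.delOp (fun _ => E.full (v, 0))).2 + (P.delOp (fun _ => E.full (0, z))).2
        + (P.delOp (integralL 0 1 _ (onValues 0 1 (eachL K E.full) ψ))).2)
  abel

/-- Pulling the reconstruction out of the integral in `s` shows that the delayed state at each `s`
is itself a reconstructed function. Its traces and boundary conditions are therefore known for every
`s`. -/
theorem fn_dpdeLift (E : BcParams a b n nz) (x : DpdeState a b n nz K) (z : Vec nz) :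
    H1.fn (dpdeLift E K (x, z)).2
      = onValues 0 1 (eachL K E.lift) (primL 0 1 _ (fun _ => (x.1, z), x.2)) := by
  rw [onValues_primL]
  rfl

theorem at_dpdeLift (E : BcParams a b n nz) (x : DpdeState a b n nz K) (z : Vec nz) {s : ℝ}
    (hs : s ∈ Icc (0 : ℝ) 1) (j : Fin K) : (dpdeLift E K (x, z)).2.at s j
      = E.lift ((x.1, z) + (∫ θ in (0 : ℝ)..s, x.2 θ ∂(ivl 0 1)) j) := by
  rw [DelaySpace.at, fn_dpdeLift, valueAt_onValues_primL zero_lt_one _ _ hs]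
  rfl

theorem at_dpdeLift_zero (E : BcParams a b n nz) (x : DpdeState a b n nz K) (z : Vec nz)
    (j : Fin K) : (dpdeLift E K (x, z)).2.at 0 j = E.lift (x.1, z) := by
  rw [at_dpdeLift E x z ⟨le_rfl, zero_le_one⟩, intervalIntegral.integral_same,
    Pi.zero_apply, add_zero]

theorem sig_at_dpdeLift_one (E : BcParams a b n nz) (hab : a < b) (x : DpdeState a b n nz K)
    (z : Vec nz) (j : Fin K) : sig ((dpdeLift E K (x, z)).2.at 1 j).1
      ((dpdeLift E K (x, z)).2.at 1 j).2 = dpdeEnd E K x z j := by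
  rw [at_dpdeLift E x z ⟨zero_le_one, le_rfl⟩, E.sig_lift hab, primitive_right zero_le_one]
  rfl

theorem op_sig_at_dpdeLift {E : BcParams a b n nz} (hE : E.WellPosed) (hab : a < b)
    (x : DpdeState a b n nz K) (z : Vec nz) {s : ℝ} (hs : s ∈ Icc (0 : ℝ) 1) (j : Fin K) :
    E.op (sig ((dpdeLift E K (x, z)).2.at s j).1 ((dpdeLift E K (x, z)).2.at s j).2) = 0 := by
  rw [at_dpdeLift E x z hs, E.sig_lift hab, BcParams.op_full hE]

/-- The transport equation of the PIE is the image of the one in the Sobolev space under the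
inclusion, which commutes with the scaling and is injective. -/
theorem delayScale_state_iff (E : BcParams a b n nz) (hab : a < b) (τ : Fin K → ℝ)
    (x : DpdeState a b n nz K) (z : Vec nz) (g : L2 0 1 (Fin K → USpace a b n × Vec nz)) :
    onValues 0 1 (eachL K (inclZ a b n nz)) g
        = onValues 0 1 (delayScale τ) (onValues 0 1 (eachL K E.state) x.2) ↔
      ∀ᵐ s ∂(ivl 0 1), ∀ j, g s j
        = (-(1 / τ j)) • H1.der (dpdeLift E K (x, z)).2 s j := by
  have h : H1.der (dpdeLift E K (x, z)).2 = onValues 0 1 (eachL K E.lift) x.2 := rfl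
  rw [h, ← eq_delayScale_iff, ← E.eachL_incl_lift hab, ← onValues_comp_apply (eachL K (inclZ a b n nz)),
    onValues_comp_apply (delayScale τ) (eachL K (inclZ a b n nz)), delayScale_comp_eachL,
    ← onValues_comp_apply (eachL K (inclZ a b n nz)) (delayScale τ),
    (onValues_eachL_injective inclZ_injective).eq_iff]

/-- As for the ODE, except that the lift takes `(x, z)`; the input must be differentiable along with
the state. -/
theorem isDpdeSolution_of_pie {P : PddeParams a b n nw nz K} {E : BcParams a b n nz}
    (hE : E.WellPosed) (hab : a < b) {τ : Fin K → ℝ} {z : ℝ → Vec nz}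
    {x : ℝ → DpdeState a b n nz K}
    (h : ∀ t, 0 ≤ t → ∃ x' z', HasDerivWithinAt x x' (Ici 0) t ∧ HasDerivWithinAt z z' (Ici 0) t ∧
      (dpdePie P E τ).T x' + (dpdePie P E τ).Tw z'
        = (dpdePie P E τ).A (x t) + (dpdePie P E τ).B (z t)) :
    IsDpdeSolution P E τ ((dpdePie P E τ).T (x 0) + (dpdePie P E τ).Tw (z 0)) z
      (fun t => (dpdePie P E τ).T (x t) + (dpdePie P E τ).Tw (z t))
      (fun t => (dpdePie P E τ).C (x t) + (dpdePie P E τ).D (z t)) := by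
  refine ⟨rfl, fun t => (dpdeLift E K (x t, z t)).1, fun t => (dpdeLift E K (x t, z t)).2,
    fun t => E.full ((x t).1, z t), fun t => dpdeEnd E K (x t) (z t), fun t ht => ?_⟩
  obtain ⟨x', z', hx', hz', he⟩ := h t ht
  have hd : HasDerivWithinAt (fun t => dpdeLift E K (x t, z t)) (dpdeLift E K (x', z'))
      (Ici 0) t :=
    (dpdeLift E K).hasFDerivAt.comp_hasDerivWithinAt t (hx'.prodMk hz')
  rw [dpdePie_fst_A_add_B, dpdePie_T_add_Tw P E hab] at he
  have hsig : sig (dpdeLift E K (x t, z t)).1 (z t) = E.full ((x t).1, z t) :=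
    E.sig_lift hab ((x t).1, z t)
  refine ⟨dpdePie_T_add_Tw P E hab τ _ _, hsig.symm,
    fun j => (sig_at_dpdeLift_one E hab _ _ j).symm, ?_, fun j => ?_,
    fun s hs j => op_sig_at_dpdeLift hE hab _ _ hs j,
    (dpdeLift E K (x', z')).1, (dpdeLift E K (x', z')).2, hd.fst, hd.snd, ?_, ?_⟩
  · rw [hsig, BcParams.op_full hE]
  · rw [at_dpdeLift_zero]
    exact E.incl_lift hab _
  · exact Prod.ext (Prod.ext_iff.1 he).1 (dpdePie_C_add_D P E τ (x t) (z t))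
  · exact (delayScale_state_iff E hab τ _ _ _).1 (Prod.ext_iff.1 he).2

/-- `dpdeFund` recovers `x` without knowledge of `z`, so `x` is differentiable unconditionally. The
derivative of `z` is needed only to split that of `T x + T_z z`; in the coupled system it is
supplied by the ODE. -/
theorem pie_of_isDpdeSolution {P : PddeParams a b n nw nz K} {E : BcParams a b n nz}
    (hab : a < b) {τ : Fin K → ℝ} {z : ℝ → Vec nz} {w : ℝ → Vec nw}
    {x : ℝ → DpdeState a b n nz K} {x₀ : DpdeState a b n nz K}
    (h : IsDpdeSolution P E τ x₀ z
      (fun t => (dpdePie P E τ).T (x t) + (dpdePie P E τ).Tw (z t)) w) :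
    (dpdePie P E τ).T (x 0) + (dpdePie P E τ).Tw (z 0) = x₀ ∧ ∀ t, 0 ≤ t →
      w t = (dpdePie P E τ).C (x t) + (dpdePie P E τ).D (z t) ∧
      ∀ z', HasDerivWithinAt z z' (Ici 0) t → ∃ x', HasDerivWithinAt x x' (Ici 0) t ∧
        (dpdePie P E τ).T x' + (dpdePie P E τ).Tw z'
          = (dpdePie P E τ).A (x t) + (dpdePie P E τ).B (z t) := by
  obtain ⟨h0, u, φ, q, r, h⟩ := h
  -- The Sobolev state and the lift have the same image in `L₂`, so traces and delayed values are
  -- given by the bounded operators.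
  have hl : ∀ t, 0 ≤ t → (u t, φ t) = dpdeLift E K (x t, z t) := fun t ht =>
    dpdeIncl_injective ((h t ht).1.symm.trans (dpdePie_T_add_Tw P E hab τ (x t) (z t)))
  refine ⟨h0, fun t ht => ?_⟩
  obtain ⟨hx, hq, hr, -, -, -, u', φ', hu, hφ, e1, e2⟩ := h t ht
  have hφt : φ t = (dpdeLift E K (x t, z t)).2 := congrArg Prod.snd (hl t ht)
  have hut : u t = (dpdeLift E K (x t, z t)).1 := congrArg Prod.fst (hl t ht)
  have hq' : q t = E.full ((x t).1, z t) := by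
    rw [hq, hut]
    exact E.sig_lift hab ((x t).1, z t)
  have hr' : r t = dpdeEnd E K (x t) (z t) := by
    funext j
    rw [hr j, hφt, sig_at_dpdeLift_one E hab]
  rw [hq', hr'] at e1
  rw [hφt] at e2
  refine ⟨?_, fun z' hz' => ?_⟩
  · rw [dpdePie_C_add_D]
    exact congrArg Prod.snd e1
  have hprod : HasDerivWithinAt (fun t => (u t, φ t)) (u', φ') (Ici 0) t := hu.prodMk hφ
  have hx' : HasDerivWithinAt x (dpdeFund a b n nz K (u', φ')) (Ici 0) t := by
    refine ((dpdeFund a b n nz K).hasFDerivAt.comp_hasDerivWithinAt t hprod).congr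
      (fun s hs => ?_) ?_
    · simp only [Function.comp_apply]
      rw [hl s hs, dpdeFund_dpdeLift]
    · simp only [Function.comp_apply]
      rw [hl t ht, dpdeFund_dpdeLift]
  refine ⟨_, hx', ?_⟩
  have hT : HasDerivWithinAt (fun t => (dpdePie P E τ).T (x t) + (dpdePie P E τ).Tw (z t))
      (dpdeIncl a b n nz K (u', φ')) (Ici 0) t :=
    ((dpdeIncl a b n nz K).hasFDerivAt.comp_hasDerivWithinAt t hprod).congr
      (fun s hs => by rw [Function.comp_apply, hl s hs, dpdePie_T_add_Tw P E hab])
      (by rw [Function.comp_apply, hl t ht, dpdePie_T_add_Tw P E hab])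
  have hT' := ((dpdePie P E τ).T.hasFDerivAt.comp_hasDerivWithinAt t hx').add
    ((dpdePie P E τ).Tw.hasFDerivAt.comp_hasDerivWithinAt t hz')
  rw [(uniqueDiffOn_Ici (0 : ℝ) t ht).eq_deriv _ hT' hT, dpdePie_fst_A_add_B]
  exact Prod.ext (congrArg (fun p => p.1) e1) ((delayScale_state_iff E hab τ _ _ _).2 e2)

end DpdeSolution

/-! ### The coupled system: both directions of the equivalence. -/

section CoupledSolution

variable {a b : ℝ} {n : ℕ × ℕ × ℕ} {nu nw nz K : ℕ}

/-- The ODE PIE has `T_w = 0`, which makes the coupled `T` block triangular: the PDE state enters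
only the second row. -/
theorem coupledPie_T_apply (G : DdeParams nu nw nz K) (P : PddeParams a b n nw nz K)
    (E : BcParams a b n nz) (τ : Fin K → ℝ) (v : CoupledState a b n nu nz K) :
    (coupledPie G P E τ).T v = ((ddePie G τ).T v.1,
      (dpdePie P E τ).T v.2 + (dpdePie P E τ).Tw ((ddePie G τ).C v.1)) := by
  refine Prod.ext ?_ (add_comm _ _)
  change (ddePie G τ).T v.1 + 0 + 0 = _
  rw [add_zero, add_zero]

theorem coupledPie_A_apply (G : DdeParams nu nw nz K) (P : PddeParams a b n nw nz K)
    (E : BcParams a b n nz) (τ : Fin K → ℝ) (v : CoupledState a b n nu nz K) :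
    (coupledPie G P E τ).A v = ((ddePie G τ).A v.1
      + (ddePie G τ).B ((dpdePie P E τ).C v.2 + (dpdePie P E τ).D ((ddePie G τ).C v.1)),
      (dpdePie P E τ).A v.2 + (dpdePie P E τ).B ((ddePie G τ).C v.1)) := by
  refine Prod.ext ?_ (add_comm _ _)
  rw [map_add, add_comm ((ddePie G τ).B _), ← add_assoc]
  rfl

theorem dpdePie_T_add_Tw_injective {P : PddeParams a b n nw nz K} {E : BcParams a b n nz}
    (hab : a < b) {τ : Fin K → ℝ} {x y : DpdeState a b n nz K} {z : Vec nz}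
    (h : (dpdePie P E τ).T x + (dpdePie P E τ).Tw z
      = (dpdePie P E τ).T y + (dpdePie P E τ).Tw z) : x = y := by
  rw [dpdePie_T_add_Tw P E hab, dpdePie_T_add_Tw P E hab] at h
  have := congrArg (dpdeFund a b n nz K) (dpdeIncl_injective h)
  rwa [dpdeFund_dpdeLift, dpdeFund_dpdeLift] at this

/-- By block triangularity the ODE part is recovered first; it fixes `z`, and the PDE part follows.
Needed to read off the initial condition of `v` from that of `T v`. -/
theorem coupledPie_T_injective (G : DdeParams nu nw nz K) (P : PddeParams a b n nw nz K)
    (E : BcParams a b n nz) (hab : a < b) (τ : Fin K → ℝ) :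
    Function.Injective (coupledPie G P E τ).T := by
  intro v v' h
  rw [coupledPie_T_apply, coupledPie_T_apply] at h
  have h1 : v.1 = v'.1 := by
    have h1 := congrArg Prod.fst h
    simp only [ddePie_T_apply] at h1
    have := congrArg (ddeFund nu K) (ddeIncl_injective h1)
    rwa [ddeFund_ddeLift, ddeFund_ddeLift] at this
  have h2 := congrArg Prod.snd h
  simp only [h1] at h2
  exact Prod.ext h1 (dpdePie_T_add_Tw_injective hab h2)

theorem isPieSolution_iff_isCoupledSolution (hab : a < b) (G : DdeParams nu nw nz K)
    (P : PddeParams a b n nw nz K) (E : BcParams a b n nz) (hE : E.WellPosed) (τ : Fin K → ℝ)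
    (v₀ : CoupledState a b n nu nz K) (v : ℝ → CoupledState a b n nu nz K) :
    IsPieSolution (coupledPie G P E τ).T (coupledPie G P E τ).A v₀ v ↔
      IsCoupledSolution G P E τ ((coupledPie G P E τ).T v₀)
        (fun t => (coupledPie G P E τ).T (v t)) := by
  have hT : (fun t => (coupledPie G P E τ).T (v t)) = fun t => ((ddePie G τ).T (v t).1,
      (dpdePie P E τ).T (v t).2 + (dpdePie P E τ).Tw ((ddePie G τ).C (v t).1)) :=
    funext fun t => coupledPie_T_apply G P E τ (v t)
  constructor
  · rintro ⟨rfl, h⟩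
    -- The interconnection signals are the outputs of the two PIEs.
    refine ⟨fun t => (ddePie G τ).C (v t).1, fun t => (dpdePie P E τ).C (v t).2
      + (dpdePie P E τ).D ((ddePie G τ).C (v t).1), ?_, ?_⟩
    · rw [hT, coupledPie_T_apply]
      refine isDdeSolution_of_pie (G := G) (τ := τ) (y := fun t => (v t).1) fun t ht => ?_
      obtain ⟨v', hv', he⟩ := h t ht
      rw [coupledPie_T_apply, coupledPie_A_apply] at he
      exact ⟨v'.1, hv'.fst, congrArg Prod.fst he⟩
    · rw [hT, coupledPie_T_apply]
      refine isDpdeSolution_of_pie (P := P) (τ := τ) (z := fun t => (ddePie G τ).C (v t).1)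
        (x := fun t => (v t).2) hE hab fun t ht => ?_
      obtain ⟨v', hv', he⟩ := h t ht
      rw [coupledPie_T_apply, coupledPie_A_apply] at he
      exact ⟨v'.2, (ddePie G τ).C v'.1, hv'.snd,
        (ddePie G τ).C.hasFDerivAt.comp_hasDerivWithinAt t hv'.fst, congrArg Prod.snd he⟩
  · rintro ⟨z, w, h1, h2⟩
    refine ⟨coupledPie_T_injective G P E hab τ (Prod.ext h1.1 h2.1), fun t ht => ?_⟩
    rw [hT] at h1 h2
    have k1 := (pie_of_isDdeSolution h1).2
    -- The given `z` is known to be the ODE output only for `t ≥ 0`, so it is replaced pointwise,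
    -- under the quantifier over `t`.
    have h2' : IsDpdeSolution P E τ ((coupledPie G P E τ).T v₀).2
        (fun t => (ddePie G τ).C (v t).1) (fun t => (dpdePie P E τ).T (v t).2
          + (dpdePie P E τ).Tw ((ddePie G τ).C (v t).1)) w := by
      obtain ⟨h0, u, φ, q, r, h2⟩ := h2
      refine ⟨h0, u, φ, q, r, fun t ht => ?_⟩
      have := h2 t ht
      rw [(k1 t ht).1] at this
      exact this
    obtain ⟨-, y', hy', ey⟩ := k1 t ht
    obtain ⟨hw, k2⟩ := (pie_of_isDpdeSolution hab h2').2 t ht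
    -- The derivative of `z` is `C` applied to the derivative of the ODE state just obtained.
    obtain ⟨x', hx', ex⟩ := k2 _ ((ddePie G τ).C.hasFDerivAt.comp_hasDerivWithinAt t hy')
    refine ⟨(y', x'), hy'.prodMk hx', ?_⟩
    rw [coupledPie_T_apply, coupledPie_A_apply, ← hw]
    exact Prod.ext ey ex

end CoupledSolution

/-! ### Representation of operators to and from finite-dimensional spaces by `L₂` functions. -/

section Coefficients

variable {c d : ℝ} {E F G X : Type} [NormedAddCommGroup E] [NormedSpace ℝ E]
  [NormedAddCommGroup F] [NormedSpace ℝ F] [NormedAddCommGroup G] [NormedSpace ℝ G]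
  [NormedAddCommGroup X] [NormedSpace ℝ X]

theorem onValues_ae (L : E →L[ℝ] F) (f : L2 c d E) :
    onValues c d L f =ᵐ[ivl c d] fun x => L (f x) :=
  L.coeFn_compLpL (p := 2) (μ := ivl c d) f

theorem mulL_ae (A : Lp (E →L[ℝ] F) ∞ (ivl c d)) (f : L2 c d E) :
    mulL A f =ᵐ[ivl c d] fun x => A x (f x) :=
  (ContinuousLinearMap.id ℝ (E →L[ℝ] F)).coeFn_holder (r := 2) A f

theorem columnL_ae (A : L2 c d (E →L[ℝ] F)) (ξ : E) :
    columnL A ξ =ᵐ[ivl c d] fun x => A x ξ :=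
  (((ContinuousLinearMap.id ℝ (E →L[ℝ] F)).flip) ξ).coeFn_compLpL (p := 2) (μ := ivl c d) A

theorem rowL_apply [CompleteSpace F] (C : L2 c d (E →L[ℝ] F)) (f : L2 c d E) :
    rowL C f = ∫ x, C x (f x) ∂(ivl c d) :=
  (ContinuousLinearMap.id ℝ (E →L[ℝ] F)).lpPairing_eq_integral C f

theorem columnL_onValues (N : F →L[ℝ] (E →L[ℝ] G)) (f : L2 c d F) (ξ : E) :
    columnL (onValues c d N f) ξ = onValues c d (N.flip ξ) f := by
  refine Lp.ext ?_
  filter_upwards [columnL_ae (onValues c d N f) ξ, onValues_ae N f, onValues_ae (N.flip ξ) f]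
    with x h1 h2 h3
  rw [h1, h2, h3, ContinuousLinearMap.flip_apply]

theorem onValues_smul_id (r : ℝ) (f : L2 c d E) :
    onValues c d (r • ContinuousLinearMap.id ℝ E) f = r • f := by
  refine Lp.ext ?_
  filter_upwards [onValues_ae (r • ContinuousLinearMap.id ℝ E) f, Lp.coeFn_smul r f] with x h1 h2
  rw [h1]
  exact h2.symm

/-- Bounded operators from a finite-dimensional space to `L₂` are given by `L₂` functions. -/
theorem exists_columnL_eq [FiniteDimensional ℝ X] (Q : X →L[ℝ] L2 c d F) :
    ∃ C : L2 c d (X →L[ℝ] F), columnL C = Q := by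
  let e := Module.finBasis ℝ X
  let co := fun i => LinearMap.toContinuousLinearMap (e.coord i)
  -- The columns of the matrix function are the images of a basis.
  refine ⟨∑ i, onValues c d (ContinuousLinearMap.smulRightL ℝ X F (co i)) (Q (e i)), ?_⟩
  ext1 ξ
  have h1 : columnL (∑ i, onValues c d (ContinuousLinearMap.smulRightL ℝ X F (co i)) (Q (e i))) ξ
      = ∑ i, columnL (onValues c d (ContinuousLinearMap.smulRightL ℝ X F (co i)) (Q (e i))) ξ :=
    map_sum (onValues c d ((ContinuousLinearMap.id ℝ (X →L[ℝ] F)).flip ξ)) _ _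
  rw [h1]
  conv_rhs => rw [← e.sum_repr ξ, map_sum]
  refine Finset.sum_congr rfl fun i _ => ?_
  rw [columnL_onValues, map_smul]
  have h2 : (ContinuousLinearMap.smulRightL ℝ X F (co i)).flip ξ
      = (e.repr ξ i) • ContinuousLinearMap.id ℝ F := by
    ext f
    simp [co]
  rw [h2, onValues_smul_id]

theorem rowL_onValues [CompleteSpace F] (M : G →L[ℝ] (E →L[ℝ] F)) (k : L2 c d G) (u : L2 c d E) :
    rowL (onValues c d M k) u = ∫ x, M (k x) (u x) ∂(ivl c d) := by
  rw [rowL_apply]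
  refine integral_congr_ae ?_
  filter_upwards [onValues_ae M k] with x hx
  rw [hx]

/-- Riesz representation. The norm of `E` need not come from an inner product, so the functional is
first transported to functions with values in a Euclidean space. -/
theorem exists_rowL_eq_real [FiniteDimensional ℝ E] (ℓ : L2 c d E →L[ℝ] ℝ) :
    ∃ B : L2 c d (E →L[ℝ] ℝ), rowL B = ℓ := by
  let e : E ≃L[ℝ] EuclideanSpace ℝ (Fin (Module.finrank ℝ E)) := toEuclidean
  let eL : E →L[ℝ] EuclideanSpace ℝ (Fin (Module.finrank ℝ E)) := e
  let ℓ' := ℓ ∘L onValues c d (e.symm : EuclideanSpace ℝ (Fin (Module.finrank ℝ E)) →L[ℝ] E)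
  let k := (InnerProductSpace.toDual ℝ (L2 c d (EuclideanSpace ℝ (Fin (Module.finrank ℝ E))))).symm ℓ'
  have hk : ∀ f, inner ℝ k f = ℓ' f := fun f => InnerProductSpace.toDual_symm_apply
  let M : EuclideanSpace ℝ (Fin (Module.finrank ℝ E)) →L[ℝ] (E →L[ℝ] ℝ) :=
    (ContinuousLinearMap.compL ℝ E _ ℝ).flip eL ∘L innerSL ℝ
  refine ⟨onValues c d M k, ?_⟩
  ext1 u
  have hu : ℓ u = ℓ' (onValues c d eL u) := by
    change ℓ u = ℓ (onValues c d _ (onValues c d _ u))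
    rw [onValues_comp_apply, e.coe_symm_comp_coe, onValues_id_apply]
  rw [rowL_onValues, hu, ← hk, L2.inner_def]
  refine integral_congr_ae ?_
  filter_upwards [onValues_ae eL u] with x hx
  rw [hx]
  rfl

/-- Bounded operators from `L₂` to a finite-dimensional space are given by `L₂` functions. -/
theorem exists_rowL_eq [FiniteDimensional ℝ E] [FiniteDimensional ℝ X] [CompleteSpace X]
    (L : L2 c d E →L[ℝ] X) : ∃ B : L2 c d (E →L[ℝ] X), rowL B = L := by
  let e := Module.finBasis ℝ X
  let co := fun i => LinearMap.toContinuousLinearMap (e.coord i)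
  -- Each coordinate of the operator is a scalar functional.
  choose B hB using fun i => exists_rowL_eq_real (co i ∘L L)
  let M := fun i => (ContinuousLinearMap.smulRightL ℝ E X).flip (e i)
  refine ⟨∑ i, onValues c d (M i) (B i), ?_⟩
  ext1 u
  have h1 : rowL (∑ i, onValues c d (M i) (B i)) u = ∑ i, rowL (onValues c d (M i) (B i)) u :=
    map_sum (((ContinuousLinearMap.id ℝ (E →L[ℝ] X)).lpPairing (ivl c d) 2 2).flip u) _ _
  rw [h1, ← e.sum_repr (L u)]
  refine Finset.sum_congr rfl fun i _ => ?_
  have h2 : rowL (B i) u = e.repr (L u) i := by rw [hB]; rfl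
  rw [rowL_onValues, ← h2, rowL_apply, ← integral_smul_const]
  rfl

end Coefficients

/-! ### Building blocks of 3-PI operators. -/

section ThreePI

variable {a b : ℝ} {E F G X : Type} [NormedAddCommGroup E] [NormedSpace ℝ E]
  [NormedAddCommGroup F] [NormedSpace ℝ F] [NormedAddCommGroup G] [NormedSpace ℝ G]
  [NormedAddCommGroup X] [NormedSpace ℝ X]

/-- Almost every slice of a square-integrable kernel is square-integrable by Fubini, and Hölder does
the rest. Without it, integrals could not be split or commuted with operators. -/
theorem ae_integrable_kernel {N : ℝ → ℝ → (E →L[ℝ] F)}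
    (hN : MemLp (Function.uncurry N) 2 ((ivl a b).prod (ivl a b))) (u : L2 a b E) :
    ∀ᵐ x ∂(ivl a b), Integrable (fun θ => N x θ (u θ)) (ivl a b) := by
  have h1 := ((memLp_two_iff_integrable_sq_norm hN.1).1 hN).prod_right_ae
  have h2 := hN.1.prodMk_left
  filter_upwards [h1, h2] with x hx1 hx2
  have hx : MemLp (fun θ => N x θ) 2 (ivl a b) := (memLp_two_iff_integrable_sq_norm hx2).2 hx1
  exact memLp_one_iff_integrable.1
    ((ContinuousLinearMap.id ℝ (E →L[ℝ] F)).memLp_of_bilin 1 hx (Lp.memLp u))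

theorem integrableOn_left {F : Type} [NormedAddCommGroup F] {f : ℝ → F} (hf : Integrable f (ivl a b)) {x : ℝ} (hx : x ∈ Icc a b) :
    IntegrableOn f (Icc a x) :=
  IntegrableOn.mono_set hf (Icc_subset_Icc_right hx.2)

theorem integrableOn_right {F : Type} [NormedAddCommGroup F] {f : ℝ → F} (hf : Integrable f (ivl a b)) {x : ℝ} (hx : x ∈ Icc a b) :
    IntegrableOn f (Icc x b) :=
  IntegrableOn.mono_set hf (Icc_subset_Icc_left hx.1)

theorem integral_ivl_eq_add {f : ℝ → F} (hf : Integrable f (ivl a b)) {x : ℝ}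
    (hx : x ∈ Icc a b) : ∫ θ, f θ ∂(ivl a b) = (∫ θ in Icc a x, f θ) + ∫ θ in Icc x b, f θ := by
  have h1 := integrableOn_left hf hx
  have h2 := integrableOn_right hf hx
  rw [integral_Icc_eq_integral_Ioc, integral_Icc_eq_integral_Ioc, integral_Icc_eq_integral_Ioc,
    ← intervalIntegral.integral_of_le hx.1, ← intervalIntegral.integral_of_le hx.2,
    ← intervalIntegral.integral_of_le (hx.1.trans hx.2)]
  refine (intervalIntegral.integral_add_adjacent_intervals ?_ ?_).symm
  · exact (intervalIntegrable_iff_integrableOn_Icc_of_le hx.1).2 h1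
  · exact (intervalIntegrable_iff_integrableOn_Icc_of_le hx.2).2 h2

theorem setIntegral_congr_left {f g : ℝ → F} (h : f =ᵐ[ivl a b] g) {x : ℝ} (hx : x ∈ Icc a b) :
    ∫ θ in Icc a x, f θ = ∫ θ in Icc a x, g θ :=
  integral_congr_ae (ae_restrict_of_ae_restrict_of_subset (Icc_subset_Icc_right hx.2) h)

theorem setIntegral_congr_right {f g : ℝ → F} (h : f =ᵐ[ivl a b] g) {x : ℝ} (hx : x ∈ Icc a b) :
    ∫ θ in Icc x b, f θ = ∫ θ in Icc x b, g θ :=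
  integral_congr_ae (ae_restrict_of_ae_restrict_of_subset (Icc_subset_Icc_left hx.1) h)

theorem Is3PI.zero : Is3PI a b (0 : L2 a b E →L[ℝ] L2 a b F) := by
  refine ⟨0, fun _ _ => 0, fun _ _ => 0, memLp_const _, memLp_const _, fun u => ?_⟩
  filter_upwards [Lp.coeFn_zero F 2 (ivl a b), Lp.coeFn_zero (E →L[ℝ] F) ∞ (ivl a b)] with x h1 h2
  rw [h2]
  simpa using h1

theorem memLp_uncurry_add {Y : Type} [NormedAddCommGroup Y] {μ : Measure (ℝ × ℝ)}
    {N M : ℝ → ℝ → Y} (hN : MemLp (Function.uncurry N) 2 μ) (hM : MemLp (Function.uncurry M) 2 μ) :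
    MemLp (Function.uncurry fun x θ => N x θ + M x θ) 2 μ :=
  hN.add hM

theorem Is3PI.add {P Q : L2 a b E →L[ℝ] L2 a b F} (hP : Is3PI a b P) (hQ : Is3PI a b Q) :
    Is3PI a b (P + Q) := by
  obtain ⟨N0, N1, N2, h1, h2, hP⟩ := hP
  obtain ⟨M0, M1, M2, k1, k2, hQ⟩ := hQ
  refine ⟨N0 + M0, _, _, memLp_uncurry_add h1 k1, memLp_uncurry_add h2 k2, fun u => ?_⟩
  have hPQ : (P + Q) u = P u + Q u := rfl
  rw [hPQ]
  filter_upwards [hP u, hQ u, Lp.coeFn_add (P u) (Q u), Lp.coeFn_add N0 M0,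
    ae_integrable_kernel h1 u, ae_integrable_kernel h2 u, ae_integrable_kernel k1 u,
    ae_integrable_kernel k2 u, ae_mem_ivl a b] with x e1 e2 e3 e4 i1 i2 j1 j2 hx
  rw [e3, Pi.add_apply, e1, e2, e4, Pi.add_apply]
  simp only [add_apply]
  rw [integral_add (integrableOn_left i1 hx) (integrableOn_left j1 hx),
    integral_add (integrableOn_right i2 hx) (integrableOn_right j2 hx)]
  abel

theorem Is3PI.sum {ι : Type} (s : Finset ι) {P : ι → L2 a b E →L[ℝ] L2 a b F}
    (hP : ∀ i ∈ s, Is3PI a b (P i)) : Is3PI a b (∑ i ∈ s, P i) :=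
  Finset.sum_induction P (Is3PI a b) (fun _ _ => Is3PI.add) Is3PI.zero hP

/-- `A x` passes under the integrals in `θ`, and a bounded factor keeps the kernels in `L₂`. -/
theorem Is3PI.mulL_comp [CompleteSpace F] [CompleteSpace G] (A : Lp (F →L[ℝ] G) ∞ (ivl a b))
    {P : L2 a b E →L[ℝ] L2 a b F} (hP : Is3PI a b P) : Is3PI a b (mulL A ∘L P) := by
  obtain ⟨N0, N1, N2, h1, h2, hP⟩ := hP
  have hA : MemLp (fun p : ℝ × ℝ => A p.1) ∞ ((ivl a b).prod (ivl a b)) :=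
    (Lp.memLp A).comp_fst (ivl a b)
  refine ⟨(ContinuousLinearMap.compL ℝ E F G).holder ∞ A N0, fun x θ => A x ∘L N1 x θ,
    fun x θ => A x ∘L N2 x θ, (ContinuousLinearMap.compL ℝ E F G).memLp_of_bilin 2 hA h1,
    (ContinuousLinearMap.compL ℝ E F G).memLp_of_bilin 2 hA h2, fun u => ?_⟩
  filter_upwards [hP u, mulL_ae A (P u), (ContinuousLinearMap.compL ℝ E F G).coeFn_holder (r := ∞) A N0,
    ae_integrable_kernel h1 u, ae_integrable_kernel h2 u, ae_mem_ivl a b] with x e1 e2 e3 i1 i2 hx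
  refine e2.trans ?_
  rw [e1, e3, map_add, map_add, ← (A x).integral_comp_comm (integrableOn_left i1 hx),
    ← (A x).integral_comp_comm (integrableOn_right i2 hx)]
  rfl

theorem onValues_eq_mulL (B : F →L[ℝ] G) :
    onValues a b B = mulL (Lp.const ∞ (ivl a b) B) := by
  ext1 f
  refine Lp.ext ?_
  filter_upwards [onValues_ae B f, mulL_ae (Lp.const ∞ (ivl a b) B) f,
    Lp.coeFn_const (p := ∞) (ivl a b) B] with x h1 h2 h3
  rw [h1, h2, h3]
  rfl

theorem Is3PI.onValues_comp [CompleteSpace F] [CompleteSpace G] (B : F →L[ℝ] G)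
    {P : L2 a b E →L[ℝ] L2 a b F} (hP : Is3PI a b P) : Is3PI a b (onValues a b B ∘L P) := by
  rw [onValues_eq_mulL]
  exact hP.mulL_comp _

theorem Is3PI.smul [CompleteSpace F] (r : ℝ) {P : L2 a b E →L[ℝ] L2 a b F} (hP : Is3PI a b P) :
    Is3PI a b (r • P) := by
  have h : r • P = onValues a b (r • ContinuousLinearMap.id ℝ F) ∘L P :=
    ContinuousLinearMap.ext fun f => (onValues_smul_id r (P f)).symm
  rw [h]
  exact hP.onValues_comp _

theorem Is3PI.comp_onValues (B : E →L[ℝ] F) {P : L2 a b F →L[ℝ] L2 a b G} (hP : Is3PI a b P) :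
    Is3PI a b (P ∘L onValues a b B) := by
  obtain ⟨N0, N1, N2, h1, h2, hP⟩ := hP
  let M := (ContinuousLinearMap.compL ℝ E F G).flip B
  refine ⟨M.compLp N0, fun x θ => N1 x θ ∘L B, fun x θ => N2 x θ ∘L B, M.comp_memLp' h1,
    M.comp_memLp' h2, fun u => ?_⟩
  filter_upwards [hP (onValues a b B u), M.coeFn_compLp N0, onValues_ae B u, ae_mem_ivl a b]
    with x e1 e2 e3 hx
  refine e1.trans ?_
  rw [e2, e3, setIntegral_congr_left (f := fun θ => N1 x θ (onValues a b B u θ))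
    (g := fun θ => N1 x θ (B (u θ))) ?_ hx, setIntegral_congr_right
    (f := fun θ => N2 x θ (onValues a b B u θ)) (g := fun θ => N2 x θ (B (u θ))) ?_ hx]
  · rfl
  · filter_upwards [onValues_ae B u] with θ hθ
    rw [hθ]
  · filter_upwards [onValues_ae B u] with θ hθ
    rw [hθ]

theorem Is3PI.id : Is3PI a b (ContinuousLinearMap.id ℝ (L2 a b E)) := by
  refine ⟨Lp.const ∞ (ivl a b) (ContinuousLinearMap.id ℝ E), fun _ _ => 0, fun _ _ => 0,
    memLp_const _, memLp_const _,
    fun u => ?_⟩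
  filter_upwards [Lp.coeFn_const (p := ∞) (ivl a b) (ContinuousLinearMap.id ℝ E)] with x h
  rw [h]
  simp

theorem Is3PI.onValues [CompleteSpace E] [CompleteSpace F] (B : E →L[ℝ] F) :
    Is3PI a b (onValues a b B) :=
  Is3PI.id.onValues_comp B

theorem Is3PI.of_volterra {P : L2 a b E →L[ℝ] L2 a b E} (k : ℝ → ℝ → ℝ)
    (hk : MemLp (Function.uncurry k) 2 ((ivl a b).prod (ivl a b)))
    (hP : ∀ u, ∀ᵐ x ∂(ivl a b), P u x = ∫ θ in Icc a x, k x θ • u θ) : Is3PI a b P := by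
  refine ⟨0, fun x θ => k x θ • ContinuousLinearMap.id ℝ E, fun _ _ => 0,
    (ContinuousLinearMap.toSpanSingleton ℝ (ContinuousLinearMap.id ℝ E)).comp_memLp' hk,
    memLp_const _, fun u => ?_⟩
  filter_upwards [hP u, Lp.coeFn_zero (E →L[ℝ] E) ∞ (ivl a b)] with x h1 h2
  rw [h1, h2]
  simp

theorem Is3PI.primitiveL : Is3PI a b (primitiveL a b E) := by
  refine Is3PI.of_volterra (fun _ _ => 1) (memLp_const _) fun u => ?_
  filter_upwards [primitiveL_ae u, ae_mem_ivl a b] with x h1 hx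
  rw [h1, primitive_eq_setIntegral hx]
  simp

/-- The only composition of two integral operators that the reconstruction needs, from `∂²u₃` to
`u₃`; its kernel is `x - θ`. -/
theorem Is3PI.primitiveL_primitiveL [CompleteSpace E] :
    Is3PI a b (DelayPIE.primitiveL a b E ∘L DelayPIE.primitiveL a b E) := by
  have hx : MemLp (fun x : ℝ => x) 2 (ivl a b) := by
    refine MemLp.of_bound measurable_id.aestronglyMeasurable (max |a| |b|) ?_
    filter_upwards [ae_mem_ivl a b] with x hx
    exact abs_le_max_abs_abs hx.1 hx.2
  refine Is3PI.of_volterra (fun x θ => x - θ) ?_ primitiveL_primitiveL_ae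
  exact (hx.comp_fst (ivl a b)).sub (hx.comp_snd (ivl a b))

/-- Operators that factor through a finite-dimensional space are 3-PI operators. -/
theorem Is3PI.finiteRank [FiniteDimensional ℝ E] [FiniteDimensional ℝ X] [CompleteSpace X]
    [CompleteSpace F] (Q : X →L[ℝ] L2 a b F) (L : L2 a b E →L[ℝ] X) : Is3PI a b (Q ∘L L) := by
  obtain ⟨C, rfl⟩ := exists_columnL_eq Q
  obtain ⟨B, rfl⟩ := exists_rowL_eq L
  -- The kernel is dominated by the product of a function of `x` and a function of `θ`, both
  -- square-integrable.
  have hN : MemLp (Function.uncurry fun x θ => C x ∘L B θ) 2 ((ivl a b).prod (ivl a b)) := by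
    have hm : AEStronglyMeasurable (Function.uncurry fun x θ => C x ∘L B θ)
        ((ivl a b).prod (ivl a b)) :=
      (ContinuousLinearMap.compL ℝ E X F).aestronglyMeasurable_comp₂
        (Lp.aestronglyMeasurable C).comp_fst (Lp.aestronglyMeasurable B).comp_snd
    refine (memLp_two_iff_integrable_sq_norm hm).2 ?_
    refine Integrable.mono' (((memLp_two_iff_integrable_sq_norm (Lp.aestronglyMeasurable C)).1
      (Lp.memLp C)).mul_prod ((memLp_two_iff_integrable_sq_norm (Lp.aestronglyMeasurable B)).1
      (Lp.memLp B))) (hm.norm.pow 2) (Filter.Eventually.of_forall fun p => ?_)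
    rw [Real.norm_of_nonneg (by positivity), ← mul_pow]
    gcongr
    exact ContinuousLinearMap.opNorm_comp_le _ _
  -- The integral over all of `[a, b]` is split at `x`, so the same kernel serves on both sides.
  refine ⟨0, _, _, hN, hN, fun u => ?_⟩
  have hB : Integrable (fun θ => B θ (u θ)) (ivl a b) :=
    memLp_one_iff_integrable.1
      ((ContinuousLinearMap.id ℝ (E →L[ℝ] X)).memLp_of_bilin 1 (Lp.memLp B) (Lp.memLp u))
  filter_upwards [columnL_ae C (rowL B u), Lp.coeFn_zero (E →L[ℝ] F) ∞ (ivl a b),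
    ae_mem_ivl a b] with x h1 h2 hx
  refine h1.trans ?_
  rw [h2, rowL_apply, ← (C x).integral_comp_comm hB,
    integral_ivl_eq_add ((C x).integrable_comp hB) hx, Pi.zero_apply,
    zero_apply, zero_add]
  rfl

theorem Is3PI.pairL_comp [CompleteSpace F] [CompleteSpace G] {P : L2 a b E →L[ℝ] L2 a b F}
    {Q : L2 a b E →L[ℝ] L2 a b G} (hP : Is3PI a b P) (hQ : Is3PI a b Q) :
    Is3PI a b (pairL a b F G ∘L P.prod Q) := by
  have h : pairL a b F G ∘L P.prod Q
      = DelayPIE.onValues a b (ContinuousLinearMap.inl ℝ F G) ∘L P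
        + DelayPIE.onValues a b (ContinuousLinearMap.inr ℝ F G) ∘L Q := by
    ext1 f
    rfl
  rw [h]
  exact (hP.onValues_comp (ContinuousLinearMap.inl ℝ F G)).add
    (hQ.onValues_comp (ContinuousLinearMap.inr ℝ F G))

theorem Is3PI.packL_comp [CompleteSpace F] {K : ℕ} {P : Fin K → L2 a b E →L[ℝ] L2 a b F}
    (hP : ∀ j, Is3PI a b (P j)) : Is3PI a b (packL a b K F ∘L ContinuousLinearMap.pi P) := by
  have h : packL a b K F ∘L ContinuousLinearMap.pi P = ∑ j,
      DelayPIE.onValues a b (ContinuousLinearMap.single ℝ (fun _ : Fin K => F) j) ∘L P j := by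
    ext1 f
    simp [packL]
  rw [h]
  exact Is3PI.sum _ fun j _ => (hP j).onValues_comp _

end ThreePI

/-! ### From 3-PI blocks to 4-PI operators, and to PI operators in two variables. -/

section FourPI

variable {a b : ℝ} {E0 E1 E2 E3 F0 F1 F2 F3 : Type}
  [NormedAddCommGroup E0] [NormedSpace ℝ E0] [NormedAddCommGroup E1] [NormedSpace ℝ E1]
  [NormedAddCommGroup E2] [NormedSpace ℝ E2] [NormedAddCommGroup E3] [NormedSpace ℝ E3]
  [NormedAddCommGroup F0] [NormedSpace ℝ F0] [NormedAddCommGroup F1] [NormedSpace ℝ F1]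
  [NormedAddCommGroup F2] [NormedSpace ℝ F2] [NormedAddCommGroup F3] [NormedSpace ℝ F3]

/-- A bounded operator is a 4-PI operator if its part that maps functions to functions is a 3-PI
operator. -/
theorem Is3PI.is4PI [FiniteDimensional ℝ E0] [FiniteDimensional ℝ E1] [FiniteDimensional ℝ F0]
    [CompleteSpace F0] {P : E0 × L2 a b E1 →L[ℝ] F0 × L2 a b F1}
    (hP : Is3PI a b (ContinuousLinearMap.snd ℝ _ _ ∘L P ∘L ContinuousLinearMap.inr ℝ _ _)) :
    Is4PI a b P := by
  obtain ⟨B, hB⟩ := exists_rowL_eq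
    (ContinuousLinearMap.fst ℝ _ _ ∘L P ∘L ContinuousLinearMap.inr ℝ E0 (L2 a b E1))
  obtain ⟨C, hC⟩ := exists_columnL_eq
    (ContinuousLinearMap.snd ℝ _ _ ∘L P ∘L ContinuousLinearMap.inl ℝ E0 (L2 a b E1))
  refine ⟨ContinuousLinearMap.fst ℝ _ _ ∘L P ∘L ContinuousLinearMap.inl ℝ _ _, B, C, _, hP,
    fun u0 u1 => ?_⟩
  have hu : ((u0, u1) : E0 × L2 a b E1) = (u0, 0) + (0, u1) := by simp
  have h1 : ∫ x, B x (u1 x) ∂(ivl a b) = (P (0, u1)).1 := by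
    rw [← rowL_apply, hB]
    rfl
  have h2 : columnL C u0 = (P (u0, 0)).2 := by
    rw [hC]
    rfl
  have h3 := columnL_ae C u0
  rw [h2] at h3
  rw [hu, map_add, h1]
  refine ⟨rfl, ?_⟩
  filter_upwards [h3, Lp.coeFn_add (P (u0, 0)).2 (P (0, u1)).2] with x e1 e2
  rw [← e1]
  exact e2

/-- The operator on `Z₁₂` with given coefficients. -/
def z12Op (B11 : E0 × L2 a b E1 →L[ℝ] F0 × L2 a b F1) (B12 : E2 × L2 a b E3 →L[ℝ] F0 × L2 a b F1)
    (B21 : E0 × L2 a b E1 →L[ℝ] F2 × L2 a b F3)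
    (M N0 N : E2 × L2 a b E3 →L[ℝ] F2 × L2 a b F3) :
    Z12 a b E0 E1 E2 E3 →L[ℝ] Z12 a b F0 F1 F2 F3 :=
  let I := integralL 0 1 (E2 × L2 a b E3)
  (B11.coprod (B12 ∘L I)).prod ((constFn 0 1 ∘L B21).coprod
    (onValues 0 1 N0 + primL 0 1 _ ∘L (M ∘L I).prod (onValues 0 1 N)))

/-- `M` is integrated over `[0, 1]` and `N` over `[0, s]`. Splitting the former at `s` gives the
kernel `M + N` below `s` and `M` above it. -/
theorem is12PI_z12Op [CompleteSpace E2] [CompleteSpace E3] [CompleteSpace F0] [CompleteSpace F1]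
    [CompleteSpace F2] [CompleteSpace F3]
    {B11 : E0 × L2 a b E1 →L[ℝ] F0 × L2 a b F1} {B12 : E2 × L2 a b E3 →L[ℝ] F0 × L2 a b F1}
    {B21 : E0 × L2 a b E1 →L[ℝ] F2 × L2 a b F3}
    {M N0 N : E2 × L2 a b E3 →L[ℝ] F2 × L2 a b F3} (h11 : Is4PI a b B11) (h12 : Is4PI a b B12)
    (h21 : Is4PI a b B21) (h0 : Is4PI a b N0) (h1 : Is4PI a b (M + N)) (h2 : Is4PI a b M) :
    Is12PI a b (z12Op B11 B12 B21 M N0 N) := by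
  refine ⟨B11, B12, B21, N0, M + N, M, h11, h12, h21, h0, h1, h2, fun u1 u2 => ⟨?_, ?_⟩⟩
  · exact congrArg (B11 u1 + ·) (B12.integral_comp_comm (integrable_L2 u2)).symm
  · have hs : (z12Op B11 B12 B21 M N0 N (u1, u2)).2 = constFn 0 1 (B21 u1)
        + (onValues 0 1 N0 u2 + primL 0 1 _ (M (integralL 0 1 _ u2), onValues 0 1 N u2)) := rfl
    rw [hs]
    filter_upwards [Lp.coeFn_add (constFn 0 1 (B21 u1))
      (onValues 0 1 N0 u2 + primL 0 1 _ (M (integralL 0 1 _ u2), onValues 0 1 N u2)),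
      Lp.coeFn_add (onValues 0 1 N0 u2)
        (primL 0 1 _ (M (integralL 0 1 _ u2), onValues 0 1 N u2)),
      constFn_ae 0 1 (B21 u1), onValues_ae N0 u2,
      primL_ae (M (integralL 0 1 _ u2), onValues 0 1 N u2), ae_mem_ivl 0 1]
      with s e1 e2 e3 e4 e5 hs
    rw [e1, Pi.add_apply, e2, Pi.add_apply, e3, e4, e5, primitive_eq_setIntegral hs,
      setIntegral_congr_left (onValues_ae N u2) hs]
    have hM : M (integralL 0 1 _ u2) = (∫ σ in Icc 0 s, M (u2 σ)) + ∫ σ in Icc s 1, M (u2 σ) :=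
      (M.integral_comp_comm (integrable_L2 u2)).symm.trans
        (integral_ivl_eq_add (M.integrable_comp (integrable_L2 u2)) hs)
    have hN : ∫ σ in Icc 0 s, (M + N) (u2 σ)
        = (∫ σ in Icc 0 s, M (u2 σ)) + ∫ σ in Icc 0 s, N (u2 σ) :=
      integral_add (integrableOn_left (M.integrable_comp (integrable_L2 u2)) hs)
        (integrableOn_left (N.integrable_comp (integrable_L2 u2)) hs)
    rw [hM, hN]
    abel

end FourPI

/-! ### The 3-PI operators of the PDE. -/

section PdePI

variable {a b : ℝ} {n : ℕ × ℕ × ℕ} {nw nz K : ℕ}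

/-- The boundary values depend boundedly on `v` and lie in a finite-dimensional space, so they
contribute finite-rank terms; what remains consists of components of `v`, their primitives and one
double primitive. -/
theorem is3PI_recInt (c : XP a b n →L[ℝ] EBc n) :
    Is3PI a b (recInt a b n ∘L c.prod (ContinuousLinearMap.id ℝ _)) := by
  let c2 := ContinuousLinearMap.fst ℝ _ _ ∘L c
  let c3 := ContinuousLinearMap.fst ℝ _ _ ∘L ContinuousLinearMap.snd ℝ _ _ ∘L c
  let c3' := ContinuousLinearMap.snd ℝ _ _ ∘L ContinuousLinearMap.snd ℝ _ _ ∘L c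
  let v1 : XP a b n →L[ℝ] _ := onValues a b (ContinuousLinearMap.fst ℝ _ _)
  let v2 : XP a b n →L[ℝ] _ :=
    onValues a b (ContinuousLinearMap.fst ℝ _ _ ∘L ContinuousLinearMap.snd ℝ _ _)
  let v3 : XP a b n →L[ℝ] _ :=
    onValues a b (ContinuousLinearMap.snd ℝ _ _ ∘L ContinuousLinearMap.snd ℝ _ _)
  let u2 := constFn a b ∘L c2 + primitiveL a b (Vec n.2.1) ∘L v2
  let du3 := constFn a b ∘L c3' + primitiveL a b (Vec n.2.2) ∘L v3
  -- The primitive of `∂u₃` is expanded to separate a finite-rank term from the double primitive.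
  let u3 := constFn a b ∘L c3 + ((primitiveL a b (Vec n.2.2) ∘L constFn a b) ∘L c3'
    + (primitiveL a b (Vec n.2.2) ∘L primitiveL a b (Vec n.2.2)) ∘L v3)
  have h : recInt a b n ∘L c.prod (ContinuousLinearMap.id ℝ _)
      = pairL a b _ _ ∘L v1.prod (pairL a b _ _ ∘L u2.prod (pairL a b _ _ ∘L u3.prod
        (pairL a b _ _ ∘L v2.prod (pairL a b _ _ ∘L du3.prod v3)))) := by
    ext1 v
    have h3 : u3 v = constFn a b (c3 v) + primitiveL a b (Vec n.2.2) (du3 v) := by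
      change _ = _ + primitiveL a b (Vec n.2.2) (constFn a b (c3' v)
        + primitiveL a b (Vec n.2.2) (v3 v))
      rw [map_add]
      rfl
    change _ = pairL a b _ _ (v1 v, pairL a b _ _ (u2 v, pairL a b _ _ (u3 v,
        pairL a b _ _ (v2 v, pairL a b _ _ (du3 v, v3 v)))))
    rw [h3]
    rfl
  have hv2 : Is3PI a b v2 := Is3PI.onValues _
  have hv3 : Is3PI a b v3 := Is3PI.onValues _
  have hdu3 : Is3PI a b du3 :=
    (Is3PI.finiteRank (constFn a b) c3').add (Is3PI.primitiveL.comp_onValues _)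
  have hu3 : Is3PI a b u3 :=
    (Is3PI.finiteRank (constFn a b) c3).add ((Is3PI.finiteRank _ c3').add
      (Is3PI.primitiveL_primitiveL.comp_onValues _))
  have hu2 : Is3PI a b u2 :=
    (Is3PI.finiteRank (constFn a b) c2).add (Is3PI.primitiveL.comp_onValues _)
  rw [h]
  exact (Is3PI.onValues _).pairL_comp (hu2.pairL_comp (hu3.pairL_comp (hv2.pairL_comp
    (hdu3.pairL_comp hv3))))

/-- `v ↦ 𝒯₀ v`. -/
def BcParams.T0 (E : BcParams a b n nz) : XP a b n →L[ℝ] XP a b n :=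
  ContinuousLinearMap.fst ℝ _ _ ∘L E.state ∘L ContinuousLinearMap.inl ℝ _ _

theorem BcParams.is3PI_T0 (E : BcParams a b n nz) : Is3PI a b E.T0 := by
  have h : E.T0 = onValues a b ((ContinuousLinearMap.fst ℝ _ _).prod
      (((ContinuousLinearMap.fst ℝ _ _) ∘L ContinuousLinearMap.snd ℝ _ _).prod
        ((ContinuousLinearMap.fst ℝ _ _) ∘L (ContinuousLinearMap.snd ℝ _ _) ∘L
          ContinuousLinearMap.snd ℝ _ _))) ∘L (recInt a b n ∘L
        (E.core ∘L ContinuousLinearMap.inl ℝ _ _).prod (ContinuousLinearMap.id ℝ _)) :=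
    ContinuousLinearMap.ext fun _ => rfl
  rw [h]
  exact (is3PI_recInt _).onValues_comp _

/-- `v ↦ (𝒢 ℱ(v, 0))₁`. -/
def PdeCoeff.fundOp (G : PdeCoeff a b n nw nz) (E : BcParams a b n nz) :
    XP a b n →L[ℝ] XP a b n :=
  ContinuousLinearMap.fst ℝ _ _ ∘L G.op ∘L E.full ∘L ContinuousLinearMap.inl ℝ _ _

/-- `A_p` multiplies the reconstructed function; the terms with `A_b` and `B_z` factor through
boundary values and `z`, so they have finite rank. -/
theorem PdeCoeff.is3PI_fundOp (G : PdeCoeff a b n nw nz) (E : BcParams a b n nz) :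
    Is3PI a b (G.fundOp E) := by
  have h : G.fundOp E = mulL G.Ap ∘L (recInt a b n ∘L
        (E.core ∘L ContinuousLinearMap.inl ℝ _ _).prod (ContinuousLinearMap.id ℝ _))
      + ((columnL G.Ab).coprod (columnL G.Bz)) ∘L (ContinuousLinearMap.snd ℝ _ _ ∘L E.full ∘L
        ContinuousLinearMap.inl ℝ _ _) := by
    ext1 v
    rfl
  rw [h]
  exact ((is3PI_recInt _).mulL_comp G.Ap).add (Is3PI.finiteRank _ _)

end PdePI

/-! ### Sorting the components of a state, and conjugation of operators by it. -/

section Sorting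

variable {a b : ℝ} {n : ℕ × ℕ × ℕ} {nu nw nz K : ℕ}

/-- The values in `s` of the distributed delayed states. -/
abbrev DelayVal (a b : ℝ) (n : ℕ × ℕ × ℕ) (nu nz K : ℕ) : Type :=
  (Fin K → Vec nu) × (Fin K → XP a b n × Vec nz)

/-- The sorted values in `s` of the distributed delayed states. -/
abbrev DelaySorted (a b : ℝ) (n : ℕ × ℕ × ℕ) (nu nz K : ℕ) : Type :=
  ((Fin K → Vec nu) × (Fin K → Vec nz)) × L2 a b (Fin K → EP n)

/-- Sorting the components of the delayed states of the ODE. -/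
def sortODE (a b : ℝ) (n : ℕ × ℕ × ℕ) (nu nz K : ℕ) :
    (Fin K → Vec nu) →L[ℝ] DelaySorted a b n nu nz K :=
  ContinuousLinearMap.inl ℝ _ _ ∘L ContinuousLinearMap.inl ℝ _ _

/-- Sorting the components of the delayed states of the PDE. -/
def sortPDE (a b : ℝ) (n : ℕ × ℕ × ℕ) (nu nz K : ℕ) :
    (Fin K → XP a b n × Vec nz) →L[ℝ] DelaySorted a b n nu nz K :=
  (ContinuousLinearMap.inr ℝ _ _ ∘L eachL K (ContinuousLinearMap.snd ℝ _ _)).prod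
    (packL a b K (EP n) ∘L eachL K (ContinuousLinearMap.fst ℝ _ _))

/-- Sorting the components of the delayed states. -/
def sortVal (a b : ℝ) (n : ℕ × ℕ × ℕ) (nu nz K : ℕ) :
    DelayVal a b n nu nz K →L[ℝ] DelaySorted a b n nu nz K :=
  (sortODE a b n nu nz K).coprod (sortPDE a b n nu nz K)

/-- The inverse of `sortVal`. -/
def unsortVal (a b : ℝ) (n : ℕ × ℕ × ℕ) (nu nz K : ℕ) :
    DelaySorted a b n nu nz K →L[ℝ] DelayVal a b n nu nz K :=
  (ContinuousLinearMap.fst ℝ _ _ ∘L ContinuousLinearMap.fst ℝ _ _).prod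
    (ContinuousLinearMap.pi fun j =>
      (onValues a b (ContinuousLinearMap.proj j) ∘L ContinuousLinearMap.snd ℝ _ _).prod
        (ContinuousLinearMap.proj j ∘L ContinuousLinearMap.snd ℝ _ _ ∘L
          ContinuousLinearMap.fst ℝ _ _))

theorem onValues_proj_packL {E : Type} [NormedAddCommGroup E] [NormedSpace ℝ E] (j : Fin K)
    (f : Fin K → L2 a b E) :
    onValues a b (ContinuousLinearMap.proj j : (Fin K → E) →L[ℝ] E) (packL a b K E f) = f j := by
  have h : packL a b K E f
      = ∑ i, onValues a b (ContinuousLinearMap.single ℝ (fun _ : Fin K => E) i) (f i) := by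
    simp [packL]
  rw [h, map_sum, Finset.sum_eq_single j]
  · rw [onValues_comp_apply]
    have : (ContinuousLinearMap.proj j : (Fin K → E) →L[ℝ] E) ∘L
        ContinuousLinearMap.single ℝ (fun _ : Fin K => E) j = ContinuousLinearMap.id ℝ E := by
      ext x
      simp
    rw [this, onValues_id_apply]
  · intro i _ hij
    rw [onValues_comp_apply]
    have : (ContinuousLinearMap.proj j : (Fin K → E) →L[ℝ] E) ∘L
        ContinuousLinearMap.single ℝ (fun _ : Fin K => E) i = 0 := by
      ext x
      simp [Pi.single_eq_of_ne hij.symm]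
    rw [this, onValues_zero_apply]
  · simp

theorem sortVal_apply (x : DelayVal a b n nu nz K) : sortVal a b n nu nz K x
    = ((x.1, fun j => (x.2 j).2), packL a b K (EP n) fun j => (x.2 j).1) := by
  refine Prod.ext (Prod.ext (add_zero _) (zero_add _)) (zero_add _)

/-- A one-sided inverse suffices, since the conjugated operators are only evaluated on sorted
states. -/
theorem unsortVal_comp_sortVal :
    unsortVal a b n nu nz K ∘L sortVal a b n nu nz K = ContinuousLinearMap.id ℝ _ := by
  refine ContinuousLinearMap.ext fun x => ?_
  change unsortVal a b n nu nz K (sortVal a b n nu nz K x) = x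
  rw [sortVal_apply]
  exact Prod.ext rfl (funext fun j => Prod.ext (onValues_proj_packL j _) rfl)

/-- The undelayed components of a state. -/
def headVal (v : CoupledState a b n nu nz K) : Vec nu × XP a b n := (v.1.1, v.2.1)

/-- The delayed components of a state. -/
def tailVal (v : CoupledState a b n nu nz K) : L2 0 1 (DelayVal a b n nu nz K) :=
  pairL 0 1 _ _ (v.1.2, v.2.2)

theorem onValues_coprod_pairL {c d : ℝ} {E F G : Type} [NormedAddCommGroup E] [NormedSpace ℝ E]
    [NormedAddCommGroup F] [NormedSpace ℝ F] [NormedAddCommGroup G] [NormedSpace ℝ G]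
    (A : E →L[ℝ] G) (B : F →L[ℝ] G) (p : L2 c d E × L2 c d F) :
    onValues c d (A.coprod B) (pairL c d E F p) = onValues c d A p.1 + onValues c d B p.2 := by
  have h : pairL c d E F p = onValues c d (ContinuousLinearMap.inl ℝ _ _) p.1
    + onValues c d (ContinuousLinearMap.inr ℝ _ _) p.2 := rfl
  rw [h, map_add, onValues_comp_apply, onValues_comp_apply,
    ContinuousLinearMap.coprod_comp_inl, ContinuousLinearMap.coprod_comp_inr]

theorem toZ12_eq : toZ12 a b n nu nz K = ((ContinuousLinearMap.fst ℝ _ _).prodMap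
      (ContinuousLinearMap.fst ℝ _ _)).prod
    (((onValues 0 1 (sortODE a b n nu nz K)).coprod (onValues 0 1 (sortPDE a b n nu nz K))) ∘L
      ((ContinuousLinearMap.snd ℝ _ _).prodMap (ContinuousLinearMap.snd ℝ _ _))) := rfl

theorem toZ12_fst (v : CoupledState a b n nu nz K) : (toZ12 a b n nu nz K v).1 = headVal v := rfl

theorem toZ12_snd (v : CoupledState a b n nu nz K) : (toZ12 a b n nu nz K v).2
    = onValues 0 1 (sortODE a b n nu nz K) v.1.2 + onValues 0 1 (sortPDE a b n nu nz K) v.2.2 := by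
  have h : ((ContinuousLinearMap.snd ℝ (Vec nu) (L2 0 1 (Fin K → Vec nu))).prodMap
      (ContinuousLinearMap.snd ℝ (XP a b n) (L2 0 1 (Fin K → XP a b n × Vec nz)))) v
      = (v.1.2, v.2.2) := rfl
  rw [toZ12_eq, ContinuousLinearMap.prod_apply]
  simp only [ContinuousLinearMap.comp_apply, ContinuousLinearMap.coprod_apply]
  rw [h]

theorem toZ12_apply (v : CoupledState a b n nu nz K) : toZ12 a b n nu nz K v
    = (headVal v, onValues 0 1 (sortVal a b n nu nz K) (tailVal v)) := by
  rw [← Prod.mk.eta (p := toZ12 a b n nu nz K v), toZ12_fst, toZ12_snd, sortVal, tailVal,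
    onValues_coprod_pairL]

theorem onValues_constFn {c d : ℝ} {E F : Type} [NormedAddCommGroup E] [NormedSpace ℝ E]
    [NormedAddCommGroup F] [NormedSpace ℝ F] (L : E →L[ℝ] F) (e : E) :
    onValues c d L (constFn c d e) = constFn c d (L e) := by
  refine Lp.ext ?_
  filter_upwards [onValues_ae L (constFn c d e), constFn_ae c d e, constFn_ae c d (L e)]
    with x h1 h2 h3
  rw [h1, h2, h3]

theorem primL_add_left {c d : ℝ} {E : Type} [NormedAddCommGroup E] [NormedSpace ℝ E] (x y : E)
    (f : L2 c d E) : primL c d E (x + y, f) = constFn c d x + primL c d E (y, f) := by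
  change constFn c d (x + y) + primitiveL c d E f
    = constFn c d x + (constFn c d y + primitiveL c d E f)
  rw [map_add, add_assoc]

/-- Conjugation of an operator by a map that acts on the values in `s`. -/
theorem z12Op_conj {E0 E1 E2 E3 Y : Type} [NormedAddCommGroup E0] [NormedSpace ℝ E0]
    [NormedAddCommGroup E1] [NormedSpace ℝ E1] [NormedAddCommGroup E2] [NormedSpace ℝ E2]
    [NormedAddCommGroup E3] [NormedSpace ℝ E3] [NormedAddCommGroup Y] [NormedSpace ℝ Y]
    [CompleteSpace E2] [CompleteSpace E3] [CompleteSpace Y]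
    (S : Y →L[ℝ] E2 × L2 a b E3) (U : E2 × L2 a b E3 →L[ℝ] Y)
    (hUS : U ∘L S = ContinuousLinearMap.id ℝ Y) (H : (E0 × L2 a b E1) × Y →L[ℝ] E0 × L2 a b E1)
    (R : (E0 × L2 a b E1) × Y →L[ℝ] Y) (N0 N : Y →L[ℝ] Y) (h : E0 × L2 a b E1) (t : L2 0 1 Y) :
    z12Op (H ∘L ContinuousLinearMap.inl ℝ _ _) (H ∘L ContinuousLinearMap.inr ℝ _ _ ∘L U)
      (S ∘L R ∘L ContinuousLinearMap.inl ℝ _ _) (S ∘L (R ∘L ContinuousLinearMap.inr ℝ _ _) ∘L U)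
      (S ∘L N0 ∘L U) (S ∘L N ∘L U) (h, onValues 0 1 S t)
    = (H (h, integralL 0 1 Y t), onValues 0 1 S (onValues 0 1 N0 t
      + primL 0 1 Y (R (h, integralL 0 1 Y t), onValues 0 1 N t))) := by
  have hU : ∀ x, U (S x) = x := fun x => congrArg (fun L => L x) hUS
  have hI : integralL 0 1 _ (onValues 0 1 S t) = S (integralL 0 1 Y t) := integralL_onValues S t
  have hx : ((h, integralL 0 1 Y t) : (E0 × L2 a b E1) × Y) = ContinuousLinearMap.inl ℝ _ _ h
      + ContinuousLinearMap.inr ℝ _ _ (integralL 0 1 Y t) := by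
    simp
  have hconj : ∀ L : Y →L[ℝ] Y, onValues 0 1 (S ∘L L ∘L U) (onValues 0 1 S t)
      = onValues 0 1 S (onValues 0 1 L t) := fun L => by
    rw [onValues_comp_apply, onValues_comp_apply, ContinuousLinearMap.comp_assoc,
      ContinuousLinearMap.comp_assoc, hUS, ContinuousLinearMap.comp_id]
  rw [hx, map_add H, map_add R, primL_add_left, add_left_comm, map_add, onValues_constFn, map_add,
    onValues_primL, ← hconj, ← hconj]
  refine Prod.ext ?_ ?_
  · change H _ + H (ContinuousLinearMap.inr ℝ _ _ (U (integralL 0 1 _ (onValues 0 1 S t)))) = _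
    rw [hI, hU]
    rfl
  · change constFn 0 1 _ + (_ + primL 0 1 _ (S (R (ContinuousLinearMap.inr ℝ _ _
      (U (integralL 0 1 _ (onValues 0 1 S t))))), _)) = _
    rw [hI, hU]
    rfl

/-- Operators that act on undelayed and delayed components by 3-PI operators are PI operators. -/
theorem isPI_of_apply {P : CoupledState a b n nu nz K →L[ℝ] CoupledState a b n nu nz K}
    (H : (Vec nu × XP a b n) × DelayVal a b n nu nz K →L[ℝ] Vec nu × XP a b n)
    (R : (Vec nu × XP a b n) × DelayVal a b n nu nz K →L[ℝ] DelayVal a b n nu nz K)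
    (N0 N : DelayVal a b n nu nz K →L[ℝ] DelayVal a b n nu nz K)
    (hH : ∀ v, headVal (P v) = H (headVal v, integralL 0 1 _ (tailVal v)))
    (hR : ∀ v, tailVal (P v) = onValues 0 1 N0 (tailVal v)
      + primL 0 1 _ (R (headVal v, integralL 0 1 _ (tailVal v)), onValues 0 1 N (tailVal v)))
    (h11 : Is3PI a b (ContinuousLinearMap.snd ℝ _ _ ∘L (H ∘L ContinuousLinearMap.inl ℝ _ _) ∘L
      ContinuousLinearMap.inr ℝ _ _))
    (h12 : Is3PI a b (ContinuousLinearMap.snd ℝ _ _ ∘L (H ∘L ContinuousLinearMap.inr ℝ _ _ ∘L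
      unsortVal a b n nu nz K) ∘L ContinuousLinearMap.inr ℝ _ _))
    (h21 : Is3PI a b (ContinuousLinearMap.snd ℝ _ _ ∘L (sortVal a b n nu nz K ∘L R ∘L
      ContinuousLinearMap.inl ℝ _ _) ∘L ContinuousLinearMap.inr ℝ _ _))
    (h22 : Is3PI a b (ContinuousLinearMap.snd ℝ _ _ ∘L (sortVal a b n nu nz K ∘L
      (R ∘L ContinuousLinearMap.inr ℝ _ _) ∘L unsortVal a b n nu nz K) ∘L
        ContinuousLinearMap.inr ℝ _ _))
    (h0 : Is3PI a b (ContinuousLinearMap.snd ℝ _ _ ∘L (sortVal a b n nu nz K ∘L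
      N0 ∘L unsortVal a b n nu nz K) ∘L ContinuousLinearMap.inr ℝ _ _))
    (h1 : Is3PI a b (ContinuousLinearMap.snd ℝ _ _ ∘L (sortVal a b n nu nz K ∘L
      N ∘L unsortVal a b n nu nz K) ∘L ContinuousLinearMap.inr ℝ _ _)) : IsPI P := by
  let S := sortVal a b n nu nz K
  let U := unsortVal a b n nu nz K
  have hUS : U ∘L S = ContinuousLinearMap.id ℝ _ := unsortVal_comp_sortVal
  refine ⟨z12Op (H ∘L ContinuousLinearMap.inl ℝ _ _) (H ∘L ContinuousLinearMap.inr ℝ _ _ ∘L U)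
    (S ∘L R ∘L ContinuousLinearMap.inl ℝ _ _) (S ∘L (R ∘L ContinuousLinearMap.inr ℝ _ _) ∘L U)
    (S ∘L N0 ∘L U) (S ∘L N ∘L U),
    is12PI_z12Op h11.is4PI h12.is4PI h21.is4PI h0.is4PI ?_ h22.is4PI, fun v => ?_⟩
  · refine Is3PI.is4PI ?_
    -- Below `s` the kernel is the sum of the contribution through the total integral and that of
    -- the primitive.
    have h : ContinuousLinearMap.snd ℝ _ _ ∘L (S ∘L (R ∘L ContinuousLinearMap.inr ℝ _ _) ∘L U
          + S ∘L N ∘L U) ∘L ContinuousLinearMap.inr ℝ _ _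
        = ContinuousLinearMap.snd ℝ _ _ ∘L (S ∘L (R ∘L ContinuousLinearMap.inr ℝ _ _) ∘L U) ∘L
            ContinuousLinearMap.inr ℝ _ _
          + ContinuousLinearMap.snd ℝ _ _ ∘L (S ∘L N ∘L U) ∘L ContinuousLinearMap.inr ℝ _ _ := by
      ext1 f
      rfl
    rw [h]
    exact h22.add h1
  · rw [toZ12_apply, toZ12_apply, hH, hR]
    exact (z12Op_conj S U hUS H R N0 N _ _).symm

end Sorting

/-! ### Primitives, integrals and operators on paired functions. -/

section PairValues

variable {c d : ℝ} {E F G X : Type} [NormedAddCommGroup E] [NormedSpace ℝ E]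
  [NormedAddCommGroup F] [NormedSpace ℝ F] [NormedAddCommGroup G] [NormedSpace ℝ G]
  [NormedAddCommGroup X] [NormedSpace ℝ X]

theorem eq_pairL_of_onValues {f : L2 c d (E × F)} {g : L2 c d E} {h : L2 c d F}
    (hg : onValues c d (ContinuousLinearMap.fst ℝ E F) f = g)
    (hh : onValues c d (ContinuousLinearMap.snd ℝ E F) f = h) : pairL c d E F (g, h) = f := by
  rw [← hg, ← hh, pairL_onValues]

theorem pairL_primL [CompleteSpace E] [CompleteSpace F] (x : E) (y : F) (f : L2 c d E)
    (g : L2 c d F) : pairL c d E F (primL c d E (x, f), primL c d F (y, g))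
      = primL c d (E × F) ((x, y), pairL c d E F (f, g)) :=
  eq_pairL_of_onValues (by rw [onValues_primL, onValues_fst_pairL]; rfl)
    (by rw [onValues_primL, onValues_snd_pairL]; rfl)

theorem onValues_prodMap_pairL (A : E →L[ℝ] G) (B : F →L[ℝ] X) (f : L2 c d E) (g : L2 c d F) :
    onValues c d (A.prodMap B) (pairL c d E F (f, g))
      = pairL c d G X (onValues c d A f, onValues c d B g) := by
  refine (eq_pairL_of_onValues ?_ ?_).symm
  · have h : ContinuousLinearMap.fst ℝ G X ∘L A.prodMap B = A ∘L ContinuousLinearMap.fst ℝ E F :=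
      rfl
    rw [onValues_comp_apply, h, ← onValues_comp_apply,
      onValues_fst_pairL]
  · have h : ContinuousLinearMap.snd ℝ G X ∘L A.prodMap B = B ∘L ContinuousLinearMap.snd ℝ E F :=
      rfl
    rw [onValues_comp_apply, h, ← onValues_comp_apply,
      onValues_snd_pairL]

theorem integralL_pairL [CompleteSpace E] [CompleteSpace F] (f : L2 c d E) (g : L2 c d F) :
    integralL c d (E × F) (pairL c d E F (f, g)) = (integralL c d E f, integralL c d F g) := by
  refine Prod.ext ?_ ?_
  · have h := integralL_onValues (ContinuousLinearMap.fst ℝ E F) (pairL c d E F (f, g))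
    rw [onValues_fst_pairL] at h
    exact h.symm
  · have h := integralL_onValues (ContinuousLinearMap.snd ℝ E F) (pairL c d E F (f, g))
    rw [onValues_snd_pairL] at h
    exact h.symm

end PairValues

section ProdComponents

variable {A B C D : Type}

theorem fst_mk_apply (x : (A × B) × C × D) :
    ((x.1.1, x.2.1) : A × C).1 = x.1.1 := rfl

theorem snd_mk_apply (x : (A × B) × C × D) :
    ((x.1.1, x.2.1) : A × C).2 = x.2.1 := rfl

end ProdComponents

/-! ### The PI property of the coupled operators. -/

section CoupledPI

variable {a b : ℝ} {n : ℕ × ℕ × ℕ} {nu nw nz K : ℕ}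

/-- The delayed values of the ODE state. -/
def endVal (a b : ℝ) (n : ℕ × ℕ × ℕ) (nu nz K : ℕ) :
    (Vec nu × XP a b n) × DelayVal a b n nu nz K →L[ℝ] (Fin K → Vec nu) :=
  (ContinuousLinearMap.pi fun _ => ContinuousLinearMap.fst ℝ _ _ ∘L ContinuousLinearMap.fst ℝ _ _)
    + ContinuousLinearMap.fst ℝ _ _ ∘L ContinuousLinearMap.snd ℝ _ _

/-- The undelayed fundamental state and input of the PDE. -/
def inputVal (a b : ℝ) (n : ℕ × ℕ × ℕ) (G : DdeParams nu nw nz K) :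
    (Vec nu × XP a b n) × DelayVal a b n nu nz K →L[ℝ] XP a b n × Vec nz :=
  (ContinuousLinearMap.snd ℝ _ _ ∘L ContinuousLinearMap.fst ℝ _ _).prod
    (G.Cz ∘L ContinuousLinearMap.fst ℝ _ _ ∘L ContinuousLinearMap.fst ℝ _ _
      + G.Czrow ∘L endVal a b n nu nz K)

theorem headVal_fst (v : CoupledState a b n nu nz K) : (headVal v).1 = v.1.1 := fst_mk_apply v

theorem headVal_snd (v : CoupledState a b n nu nz K) : (headVal v).2 = v.2.1 := snd_mk_apply v

theorem headVal_mk (x : Vec nu) (ψ : L2 0 1 (Fin K → Vec nu)) (y : XP a b n)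
    (φ : L2 0 1 (Fin K → XP a b n × Vec nz)) :
    headVal (((x, ψ), (y, φ)) : CoupledState a b n nu nz K) = (x, y) := rfl

theorem tailVal_mk (x : Vec nu) (ψ : L2 0 1 (Fin K → Vec nu)) (y : XP a b n)
    (φ : L2 0 1 (Fin K → XP a b n × Vec nz)) :
    tailVal (((x, ψ), (y, φ)) : CoupledState a b n nu nz K) = pairL 0 1 _ _ (ψ, φ) := rfl

theorem endVal_eq (h : Vec nu × XP a b n) (φ : DelayVal a b n nu nz K) :
    endVal a b n nu nz K (h, φ) = (fun _ => h.1) + φ.1 := rfl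

theorem inputVal_eq (G : DdeParams nu nw nz K) (h : Vec nu × XP a b n)
    (φ : DelayVal a b n nu nz K) :
    inputVal a b n G (h, φ) = (h.2, G.Cz h.1 + G.Czrow (endVal a b n nu nz K (h, φ))) := rfl

theorem ddeEnd_eq (y : DdeState nu K) :
    ddeEnd nu K y = (fun _ => y.1) + integralL 0 1 (Fin K → Vec nu) y.2 := rfl

theorem ddePie_C_apply (G : DdeParams nu nw nz K) (τ : Fin K → ℝ) (y : DdeState nu K) :
    (ddePie G τ).C y = G.Cz y.1 + G.Czrow (ddeEnd nu K y) := rfl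

theorem integralL_tailVal (v : CoupledState a b n nu nz K) :
    integralL 0 1 _ (tailVal v) = (integralL 0 1 _ v.1.2, integralL 0 1 _ v.2.2) :=
  integralL_pairL _ _

theorem endVal_apply (v : CoupledState a b n nu nz K) :
    endVal a b n nu nz K (headVal v, integralL 0 1 _ (tailVal v)) = ddeEnd nu K v.1 := by
  rw [endVal_eq, integralL_tailVal, ddeEnd_eq, headVal_fst]

theorem inputVal_apply (G : DdeParams nu nw nz K) (τ : Fin K → ℝ)
    (v : CoupledState a b n nu nz K) :
    inputVal a b n G (headVal v, integralL 0 1 _ (tailVal v)) = (v.2.1, (ddePie G τ).C v.1) := by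
  rw [inputVal_eq, endVal_apply, ddePie_C_apply, headVal_fst, headVal_snd]

/-- `z` depends only on the ODE state and its delays. It vanishes on the blocks acting between
functions of `x`, the only ones where the 3-PI property has to be checked. -/
theorem inputVal_of_zero (G : DdeParams nu nw nz K) (h : Vec nu × XP a b n)
    (φ : DelayVal a b n nu nz K) (h1 : h.1 = 0) (h2 : φ.1 = 0) :
    inputVal a b n G (h, φ) = (h.2, 0) := by
  have h0 : endVal a b n nu nz K (h, φ) = 0 := by
    rw [endVal_eq, h1, h2, add_zero]
    rfl
  rw [inputVal_eq, h0, h1, map_zero, map_zero, add_zero]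

theorem dpdePie_T_add_Tw_eq_primL (P : PddeParams a b n nw nz K) (E : BcParams a b n nz)
    (hab : a < b) (τ : Fin K → ℝ) (x : DpdeState a b n nz K) (z : Vec nz) :
    (dpdePie P E τ).T x + (dpdePie P E τ).Tw z = ((E.state (x.1, z)).1,
      primL 0 1 _ (fun _ => E.state (x.1, z), onValues 0 1 (eachL K E.state) x.2)) := by
  rw [dpdePie_T_add_Tw P E hab]
  refine Prod.ext (Prod.ext_iff.1 (E.incl_lift hab (x.1, z))).1 ?_
  change onValues 0 1 (eachL K (inclZ a b n nz)) (primL 0 1 _ (fun _ => E.lift (x.1, z),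
      onValues 0 1 (eachL K E.lift) x.2)) = _
  rw [onValues_primL, onValues_comp_apply, E.eachL_incl_lift hab]
  have h1 : eachL K (inclZ a b n nz) (fun _ => E.lift (x.1, z)) = fun _ => E.state (x.1, z) :=
    funext fun _ => E.incl_lift hab (x.1, z)
  rw [h1]

/-- The undelayed components of `𝒯 v`. -/
def headT (G : DdeParams nu nw nz K) (E : BcParams a b n nz) :
    (Vec nu × XP a b n) × DelayVal a b n nu nz K →L[ℝ] Vec nu × XP a b n :=
  (ContinuousLinearMap.fst ℝ _ _ ∘L ContinuousLinearMap.fst ℝ _ _).prod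
    (ContinuousLinearMap.fst ℝ _ _ ∘L E.state ∘L inputVal a b n G)

/-- The values at `s = 0` of the delayed components of `𝒯 v`. -/
def tailT (G : DdeParams nu nw nz K) (E : BcParams a b n nz) :
    (Vec nu × XP a b n) × DelayVal a b n nu nz K →L[ℝ] DelayVal a b n nu nz K :=
  (ContinuousLinearMap.pi fun _ => ContinuousLinearMap.fst ℝ _ _ ∘L
      ContinuousLinearMap.fst ℝ _ _).prod
    (ContinuousLinearMap.pi fun _ => E.state ∘L inputVal a b n G)

/-- The delayed components of `𝒯 v`, differentiated in `s`. -/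
def derT (E : BcParams a b n nz) (nu K : ℕ) :
    DelayVal a b n nu nz K →L[ℝ] DelayVal a b n nu nz K :=
  (ContinuousLinearMap.id ℝ _).prodMap (eachL K E.state)

theorem snd_sortVal (x : DelayVal a b n nu nz K) :
    (sortVal a b n nu nz K x).2 = packL a b K (EP n) fun j => (x.2 j).1 := by
  rw [sortVal_apply]

theorem headT_eq (G : DdeParams nu nw nz K) (E : BcParams a b n nz)
    (h : Vec nu × XP a b n) (φ : DelayVal a b n nu nz K) :
    headT G E (h, φ) = (h.1, (E.state (inputVal a b n G (h, φ))).1) := rfl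

theorem tailT_eq (G : DdeParams nu nw nz K) (E : BcParams a b n nz)
    (h : Vec nu × XP a b n) (φ : DelayVal a b n nu nz K) :
    tailT G E (h, φ) = (fun _ => h.1, fun _ => E.state (inputVal a b n G (h, φ))) := rfl

theorem ddePie_T_eq_primL (G : DdeParams nu nw nz K) (τ : Fin K → ℝ) (y : DdeState nu K) :
    (ddePie G τ).T y = (y.1, primL 0 1 _ (fun _ => y.1, y.2)) := rfl

theorem headVal_coupledPie_T (hab : a < b) (G : DdeParams nu nw nz K) (P : PddeParams a b n nw nz K)
    (E : BcParams a b n nz) (τ : Fin K → ℝ) (v : CoupledState a b n nu nz K) :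
    headVal ((coupledPie G P E τ).T v) = headT G E (headVal v, integralL 0 1 _ (tailVal v)) := by
  rw [headT_eq, inputVal_apply G τ, coupledPie_T_apply, dpdePie_T_add_Tw_eq_primL P E hab,
    ddePie_T_eq_primL, headVal_mk, headVal_fst]

theorem tailVal_coupledPie_T (hab : a < b) (G : DdeParams nu nw nz K) (P : PddeParams a b n nw nz K)
    (E : BcParams a b n nz) (τ : Fin K → ℝ) (v : CoupledState a b n nu nz K) :
    tailVal ((coupledPie G P E τ).T v) = primL 0 1 _
      (tailT G E (headVal v, integralL 0 1 _ (tailVal v)), onValues 0 1 (derT E nu K) (tailVal v)) := by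
  rw [tailT_eq, inputVal_apply G τ, coupledPie_T_apply, dpdePie_T_add_Tw_eq_primL P E hab,
    ddePie_T_eq_primL, derT, tailVal_mk, tailVal, onValues_prodMap_pairL, onValues_id_apply,
    ← pairL_primL, headVal_fst]

/-- Delayed components of `T v` are primitives in `s` with values at `s = 0` given by the undelayed
state, so there is no multiplier part. Every nonzero block reduces to `E.T0`; delayed functions of
`x` influence neither the undelayed components nor the values at `s = 0`. -/
theorem isPI_coupledPie_T (hab : a < b) (G : DdeParams nu nw nz K) (P : PddeParams a b n nw nz K)
    (E : BcParams a b n nz) (τ : Fin K → ℝ) : IsPI (coupledPie G P E τ).T := by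
  refine isPI_of_apply (headT G E) (tailT G E) 0 (derT E nu K) (headVal_coupledPie_T hab G P E τ)
    (fun v => ?_) ?_ ?_ ?_ ?_ ?_ ?_
  · rw [tailVal_coupledPie_T hab, onValues_zero_apply, zero_add]
  · have h : ContinuousLinearMap.snd ℝ _ _ ∘L (headT G E ∘L ContinuousLinearMap.inl ℝ _ _) ∘L
        ContinuousLinearMap.inr ℝ _ _ = E.T0 := ContinuousLinearMap.ext fun v => by
      change (E.state (inputVal a b n G ((0, v), 0))).1 = _
      rw [inputVal_of_zero G _ _ rfl rfl]
      rfl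
    rw [h]
    exact E.is3PI_T0
  · have h : ContinuousLinearMap.snd ℝ _ _ ∘L (headT G E ∘L ContinuousLinearMap.inr ℝ _ _ ∘L
        unsortVal a b n nu nz K) ∘L ContinuousLinearMap.inr ℝ _ _ = 0 :=
      ContinuousLinearMap.ext fun f => by
      change (E.state (inputVal a b n G (0, unsortVal a b n nu nz K (0, f)))).1 = 0
      rw [inputVal_of_zero G _ _ rfl rfl]
      exact congrArg Prod.fst (map_zero E.state)
    rw [h]
    exact Is3PI.zero
  · have h : ContinuousLinearMap.snd ℝ _ _ ∘L (sortVal a b n nu nz K ∘L tailT G E ∘L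
        ContinuousLinearMap.inl ℝ _ _) ∘L ContinuousLinearMap.inr ℝ _ _
        = packL a b K (EP n) ∘L ContinuousLinearMap.pi fun _ => E.T0 :=
      ContinuousLinearMap.ext fun v => by
      change (sortVal a b n nu nz K (tailT G E ((0, v), 0))).2 = _
      rw [snd_sortVal]
      change packL a b K (EP n) (fun _ => (E.state (inputVal a b n G ((0, v), 0))).1) = _
      rw [inputVal_of_zero G _ _ rfl rfl]
      rfl
    rw [h]
    exact Is3PI.packL_comp fun _ => E.is3PI_T0
  · have h : ContinuousLinearMap.snd ℝ _ _ ∘L (sortVal a b n nu nz K ∘L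
        (tailT G E ∘L ContinuousLinearMap.inr ℝ _ _) ∘L unsortVal a b n nu nz K) ∘L
          ContinuousLinearMap.inr ℝ _ _ = 0 := ContinuousLinearMap.ext fun f => by
      change (sortVal a b n nu nz K (tailT G E (0, unsortVal a b n nu nz K (0, f)))).2 = 0
      rw [snd_sortVal]
      change packL a b K (EP n) (fun _ =>
        (E.state (inputVal a b n G (0, unsortVal a b n nu nz K (0, f)))).1) = 0
      rw [inputVal_of_zero G _ _ rfl rfl]
      have h0 : (fun _ : Fin K => (E.state 0).1) = 0 :=
        funext fun _ => congrArg Prod.fst (map_zero E.state)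
      exact (congrArg _ h0).trans (map_zero _)
    rw [h]
    exact Is3PI.zero
  · have h : ContinuousLinearMap.snd ℝ _ _ ∘L (sortVal a b n nu nz K ∘L
        (0 : DelayVal a b n nu nz K →L[ℝ] DelayVal a b n nu nz K) ∘L unsortVal a b n nu nz K) ∘L
          ContinuousLinearMap.inr ℝ _ _ = 0 := ContinuousLinearMap.ext fun f =>
      congrArg Prod.snd (map_zero (sortVal a b n nu nz K))
    rw [h]
    exact Is3PI.zero
  · have h : ContinuousLinearMap.snd ℝ _ _ ∘L (sortVal a b n nu nz K ∘L
        derT E nu K ∘L unsortVal a b n nu nz K) ∘L ContinuousLinearMap.inr ℝ _ _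
        = packL a b K (EP n) ∘L ContinuousLinearMap.pi fun j =>
          E.T0 ∘L onValues a b (ContinuousLinearMap.proj j) := ContinuousLinearMap.ext fun f => by
      change (sortVal a b n nu nz K (derT E nu K (unsortVal a b n nu nz K (0, f)))).2 = _
      rw [snd_sortVal]
      rfl
    rw [h]
    exact Is3PI.packL_comp fun j => E.is3PI_T0.comp_onValues _

/-- The signals `(𝒢 q + ∑ⱼ 𝒢ⱼ rⱼ)` entering the PDE. -/
def rhsVal (G : DdeParams nu nw nz K) (P : PddeParams a b n nw nz K) (E : BcParams a b n nz) :
    (Vec nu × XP a b n) × DelayVal a b n nu nz K →L[ℝ] XP a b n × Vec nw :=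
  P.now.op ∘L E.full ∘L inputVal a b n G + P.delOp ∘L ContinuousLinearMap.pi fun j =>
    E.full ∘L (inputVal a b n G + ContinuousLinearMap.proj j ∘L ContinuousLinearMap.snd ℝ _ _ ∘L
      ContinuousLinearMap.snd ℝ _ _)

/-- The undelayed components of `𝒜 v`. -/
def headA (G : DdeParams nu nw nz K) (P : PddeParams a b n nw nz K) (E : BcParams a b n nz) :
    (Vec nu × XP a b n) × DelayVal a b n nu nz K →L[ℝ] Vec nu × XP a b n :=
  (G.A ∘L ContinuousLinearMap.fst ℝ _ _ ∘L ContinuousLinearMap.fst ℝ _ _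
      + G.Arow ∘L endVal a b n nu nz K
      + G.Bw ∘L ContinuousLinearMap.snd ℝ _ _ ∘L rhsVal G P E).prod
    (ContinuousLinearMap.fst ℝ _ _ ∘L rhsVal G P E)

/-- The delayed components of `𝒜 v`. -/
def tailA (E : BcParams a b n nz) (nu : ℕ) (τ : Fin K → ℝ) :
    DelayVal a b n nu nz K →L[ℝ] DelayVal a b n nu nz K :=
  (delayScale τ).prodMap (delayScale τ ∘L eachL K E.state)

theorem rhsVal_eq (G : DdeParams nu nw nz K) (P : PddeParams a b n nw nz K)
    (E : BcParams a b n nz) (h : Vec nu × XP a b n) (φ : DelayVal a b n nu nz K) :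
    rhsVal G P E (h, φ) = P.now.op (E.full (inputVal a b n G (h, φ)))
      + P.delOp (fun j => E.full (inputVal a b n G (h, φ) + φ.2 j)) := rfl

theorem rhsVal_apply (G : DdeParams nu nw nz K) (P : PddeParams a b n nw nz K)
    (E : BcParams a b n nz) (τ : Fin K → ℝ) (v : CoupledState a b n nu nz K) :
    rhsVal G P E (headVal v, integralL 0 1 _ (tailVal v))
      = P.now.op (E.full (v.2.1, (ddePie G τ).C v.1))
        + P.delOp (dpdeEnd E K v.2 ((ddePie G τ).C v.1)) := by
  rw [rhsVal_eq, inputVal_apply G τ, integralL_tailVal]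
  rfl

theorem delOp_apply (P : PddeParams a b n nw nz K) (r : Fin K → Sig a b n nz) :
    P.delOp r = ∑ j, (P.del j).op (r j) := by
  simp [PddeParams.delOp]

/-- With finite-dimensional data switched off, the undelayed term and each delay act through their
own 3-PI operator, the delays on the undelayed function plus the integral of `ψⱼ`. -/
theorem rhsVal_of_zero (G : DdeParams nu nw nz K) (P : PddeParams a b n nw nz K)
    (E : BcParams a b n nz) (h : Vec nu × XP a b n) (φ : DelayVal a b n nu nz K)
    (h1 : h.1 = 0) (h2 : φ.1 = 0) (h3 : ∀ j, (φ.2 j).2 = 0) :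
    (rhsVal G P E (h, φ)).1 = P.now.fundOp E h.2
      + ∑ j, (P.del j).fundOp E (h.2 + (φ.2 j).1) := by
  rw [rhsVal_eq, inputVal_of_zero G h φ h1 h2, delOp_apply, Prod.fst_add, Prod.fst_sum]
  refine congrArg₂ (· + ·) rfl (Finset.sum_congr rfl fun j _ => ?_)
  have h4 : ((h.2, 0) : XP a b n × Vec nz) + φ.2 j = (h.2 + (φ.2 j).1, 0) :=
    Prod.ext rfl ((zero_add _).trans (h3 j))
  rw [h4]
  rfl

theorem headA_eq (G : DdeParams nu nw nz K) (P : PddeParams a b n nw nz K) (E : BcParams a b n nz)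
    (h : Vec nu × XP a b n) (φ : DelayVal a b n nu nz K) :
    headA G P E (h, φ) = (G.A h.1 + G.Arow (endVal a b n nu nz K (h, φ))
      + G.Bw (rhsVal G P E (h, φ)).2, (rhsVal G P E (h, φ)).1) := rfl

theorem headVal_coupledPie_A (G : DdeParams nu nw nz K) (P : PddeParams a b n nw nz K)
    (E : BcParams a b n nz) (τ : Fin K → ℝ) (v : CoupledState a b n nu nz K) :
    headVal ((coupledPie G P E τ).A v)
      = headA G P E (headVal v, integralL 0 1 _ (tailVal v)) := by
  rw [headA_eq, rhsVal_apply G P E τ, endVal_apply, coupledPie_A_apply, ddePie_A_add_B,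
    dpdePie_fst_A_add_B, dpdePie_C_add_D, headVal_mk, headVal_fst]

theorem tailVal_coupledPie_A (G : DdeParams nu nw nz K) (P : PddeParams a b n nw nz K)
    (E : BcParams a b n nz) (τ : Fin K → ℝ) (v : CoupledState a b n nu nz K) :
    tailVal ((coupledPie G P E τ).A v) = onValues 0 1 (tailA E nu τ) (tailVal v) := by
  rw [coupledPie_A_apply, ddePie_A_add_B, dpdePie_fst_A_add_B, tailA, tailVal_mk, tailVal,
    onValues_prodMap_pairL, ← onValues_comp_apply]

/-- The delayed rows of `A` are pure multipliers in `s`, so the three blocks that would add values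
at `s = 0` or primitives vanish. Delayed values reach the undelayed rows only through integrals over
`[0, 1]`. -/
theorem isPI_coupledPie_A (G : DdeParams nu nw nz K) (P : PddeParams a b n nw nz K)
    (E : BcParams a b n nz) (τ : Fin K → ℝ) : IsPI (coupledPie G P E τ).A := by
  have hzero : ∀ {F : Type} [NormedAddCommGroup F] [NormedSpace ℝ F]
      (L : F →L[ℝ] DelayVal a b n nu nz K) (hL : L = 0) {E1 : Type} [NormedAddCommGroup E1]
      [NormedSpace ℝ E1] (M : L2 a b E1 →L[ℝ] F), Is3PI a b (ContinuousLinearMap.snd ℝ _ _ ∘L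
        (sortVal a b n nu nz K ∘L L) ∘L M) := by
    intro F _ _ L hL E1 _ _ M
    have h : ContinuousLinearMap.snd ℝ _ _ ∘L (sortVal a b n nu nz K ∘L L) ∘L M = 0 := by
      rw [hL, ContinuousLinearMap.comp_zero, ContinuousLinearMap.zero_comp,
        ContinuousLinearMap.comp_zero]
    rw [h]
    exact Is3PI.zero
  refine isPI_of_apply (headA G P E) 0 (tailA E nu τ) 0 (headVal_coupledPie_A G P E τ)
    (fun v => ?_) ?_ ?_ ?_ ?_ ?_ ?_
  · have h0 : ((0, 0) : DelayVal a b n nu nz K × L2 0 1 (DelayVal a b n nu nz K)) = 0 := rfl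
    rw [tailVal_coupledPie_A, onValues_zero_apply, zero_apply, h0, map_zero, add_zero]
  · have h : ContinuousLinearMap.snd ℝ _ _ ∘L (headA G P E ∘L ContinuousLinearMap.inl ℝ _ _) ∘L
        ContinuousLinearMap.inr ℝ _ _ = P.now.fundOp E + ∑ j, (P.del j).fundOp E :=
      ContinuousLinearMap.ext fun v => by
      change (rhsVal G P E ((0, v), 0)).1 = _
      rw [rhsVal_of_zero G P E _ _ rfl rfl fun _ => rfl, add_apply, sum_apply]
      refine congrArg₂ (· + ·) rfl (Finset.sum_congr rfl fun j _ => congrArg _ (add_zero v))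
    rw [h]
    exact (P.now.is3PI_fundOp E).add (Is3PI.sum _ fun j _ => (P.del j).is3PI_fundOp E)
  · have h : ContinuousLinearMap.snd ℝ _ _ ∘L (headA G P E ∘L ContinuousLinearMap.inr ℝ _ _ ∘L
        unsortVal a b n nu nz K) ∘L ContinuousLinearMap.inr ℝ _ _
        = ∑ j, (P.del j).fundOp E ∘L onValues a b (ContinuousLinearMap.proj j) :=
      ContinuousLinearMap.ext fun f => by
      change (rhsVal G P E (0, unsortVal a b n nu nz K (0, f))).1 = _
      rw [rhsVal_of_zero G P E _ _ rfl rfl fun _ => rfl, sum_apply]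
      have h0 : P.now.fundOp E ((0 : Vec nu × XP a b n)).2 = 0 := map_zero _
      rw [h0, zero_add]
      exact Finset.sum_congr rfl fun j _ => congrArg _ (zero_add _)
    rw [h]
    exact Is3PI.sum _ fun j _ => ((P.del j).is3PI_fundOp E).comp_onValues _
  · exact hzero _ (ContinuousLinearMap.zero_comp _) _
  · exact hzero _ (by rw [ContinuousLinearMap.zero_comp, ContinuousLinearMap.zero_comp]) _
  · have h : ContinuousLinearMap.snd ℝ _ _ ∘L (sortVal a b n nu nz K ∘L
        tailA E nu τ ∘L unsortVal a b n nu nz K) ∘L ContinuousLinearMap.inr ℝ _ _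
        = packL a b K (EP n) ∘L ContinuousLinearMap.pi fun j =>
          (-(1 / τ j)) • (E.T0 ∘L onValues a b (ContinuousLinearMap.proj j)) :=
      ContinuousLinearMap.ext fun f => by
      change (sortVal a b n nu nz K (tailA E nu τ (unsortVal a b n nu nz K (0, f)))).2 = _
      rw [snd_sortVal]
      rfl
    rw [h]
    exact Is3PI.packL_comp fun j => (E.is3PI_T0.comp_onValues _).smul _
  · exact hzero _ (ContinuousLinearMap.zero_comp _) _

end CoupledPI

end

end DelayPIE

theorem mainTheorem8 {a b : ℝ} (hab : a < b) {n : ℕ × ℕ × ℕ} {nu nw nz K : ℕ}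
    (G : DelayPIE.DdeParams nu nw nz K) (P : DelayPIE.PddeParams a b n nw nz K)
    (E : DelayPIE.BcParams a b n nz) (hE : E.WellPosed)
    (τ : Fin K → ℝ) (hτ : ∀ j, 0 < τ j) (hτ' : StrictMono τ) :
    DelayPIE.IsPI (DelayPIE.coupledPie G P E τ).T ∧
    DelayPIE.IsPI (DelayPIE.coupledPie G P E τ).A ∧
    ∀ (v₀ : DelayPIE.CoupledState a b n nu nz K) (v : ℝ → DelayPIE.CoupledState a b n nu nz K),
      DelayPIE.IsPieSolution (DelayPIE.coupledPie G P E τ).T (DelayPIE.coupledPie G P E τ).A v₀ v ↔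
      DelayPIE.IsCoupledSolution G P E τ ((DelayPIE.coupledPie G P E τ).T v₀)
        (fun t => (DelayPIE.coupledPie G P E τ).T (v t)) :=
  ⟨DelayPIE.isPI_coupledPie_T hab G P E τ, DelayPIE.isPI_coupledPie_A G P E τ,
    DelayPIE.isPieSolution_iff_isCoupledSolution hab G P E hE τ⟩
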